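/- Let $n \ge 1$ and let $A$ be an $n$-homogeneous C*-algebra, i.e. a (not necessarily unital) C*-algebra all of whose irreducible representations have dimension $n$. Let $T = \mathrm{Prim}(A)$ be its primitive ideal space with the hull-kernel topology, and let $\mathcal A$ be the $M_n(\mathbb C)$-bundle over $T$ corresponding to $A$: its fibre over $t \in T$ is $A/t \cong M_n$, and its topology is generated by the sets $\{x \in A/t : t \in U,\ \|x - (a+t)\| < \varepsilon\}$ with $a \in A$, $U \subseteq T$ open, $\varepsilon > 0$. Let $\mathrm{Aut}(M_n)$ be the group of *-automorphisms of $M_n$ with the topology of pointwise convergence, $D_n \subseteq M_n$ the diagonal matrices, and $\mathrm{Aut}(M_n,D_n) = \{\varphi \in \mathrm{Aut}(M_n) : \varphi(D_n) = D_n\}$. Let $\alpha$ be the principal $\mathrm{Aut}(M_n)$-bundle of $\mathcal A$: its fibre over $t$ is the set of *-isomorphisms $M_n \to A/t$, its topology is that of pointwise convergence of maps $M_n \to \mathcal A$, and $\mathrm{Aut}(M_n)$ acts from the right by composition. A Cartan subalgebra of $A$ is a maximal abelian sub-C*-algebra $B \subseteq A$ which contains an approximate unit of $A$, is regular (the set $\{m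 \in A : mBm^* \subseteq B,\ m^*Bm \subseteq B\}$ generates $A$ as a C*-algebra), and is the range of a faithful conditional expectation $A \to B$. We say that $\alpha$ reduces to a principal $\mathrm{Aut}(M_n,D_n)$-bundle if there is a (locally trivial) principal $\mathrm{Aut}(M_n,D_n)$-bundle $\beta$ over $T$ such that $\alpha$ is isomorphic over $T$, as a principal $\mathrm{Aut}(M_n)$-bundle, to $\beta \times_{\mathrm{Aut}(M_n,D_n)} \mathrm{Aut}(M_n)$, where $\mathrm{Aut}(M_n,D_n)$ acts on $\mathrm{Aut}(M_n)$ by left multiplication. Then $A$ has a Cartan subalgebra if and only if $\alpha$ reduces to a principal $\mathrm{Aut}(M_n,D_n)$-bundle. -/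

import Mathlib

open Topology

universe u

noncomputable section

/-! ### Homogeneous C*-algebras and the primitive ideal space -/

section Representations

variable {A : Type u} [NonUnitalCStarAlgebra A]

/-- A representation `π` of `A` on a Hilbert space is (topologically) irreducible: it is nonzero and
the only closed invariant subspaces are the trivial ones. -/
def IsIrreducibleRep {H : Type u} [NormedAddCommGroup H] [InnerProductSpace ℂ H] [CompleteSpace H]
    (π : A →⋆ₙₐ[ℂ] (H →L[ℂ] H)) : Prop :=
  π ≠ 0 ∧ ∀ K : Submodule ℂ H, IsClosed (K : Set H) → (∀ a : A, ∀ v ∈ K, π a v ∈ K) →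
    K = ⊥ ∨ K = ⊤

end Representations

/-- `A` is `n`-homogeneous (for `n ≥ 1`): all its irreducible representations have dimension `n`.
Irreducible representations are cyclic, so Hilbert spaces in the universe of `A` suffice. -/
def IsHomogeneous (n : ℕ) (A : Type u) [NonUnitalCStarAlgebra A] : Prop :=
  ∀ (H : Type u) [NormedAddCommGroup H] [InnerProductSpace ℂ H] [CompleteSpace H]
    (π : A →⋆ₙₐ[ℂ] (H →L[ℂ] H)), IsIrreducibleRep π → Module.finrank ℂ H = n

/-- The points of the primitive ideal space `Prim A`: the kernels of irreducible representations. -/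
structure PrimitiveIdeal (A : Type u) [NonUnitalCStarAlgebra A] where
  toSubmodule : Submodule ℂ A
  exists_rep : ∃ (H : Type u) (_ : NormedAddCommGroup H) (_ : InnerProductSpace ℂ H)
    (_ : CompleteSpace H) (π : A →⋆ₙₐ[ℂ] (H →L[ℂ] H)), IsIrreducibleRep π ∧
      ∀ a : A, a ∈ toSubmodule ↔ π a = 0

namespace PrimitiveIdeal

variable {A : Type u} [NonUnitalCStarAlgebra A]

/-- The hull-kernel (Jacobson) topology: the closed sets are the hulls `{t | S ⊆ t}` of subsets
`S` of `A`, so the sets `{t | a ∉ t}` generate it. -/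
instance : TopologicalSpace (PrimitiveIdeal A) :=
  TopologicalSpace.generateFrom {U | ∃ a : A, U = {t | a ∉ t.toSubmodule}}

theorem mul_mem_left (t : PrimitiveIdeal A) (a : A) {b : A} (hb : b ∈ t.toSubmodule) :
    a * b ∈ t.toSubmodule := by
  obtain ⟨H, _, _, _, π, -, h⟩ := t.exists_rep
  rw [h] at hb ⊢
  rw [map_mul, hb, mul_zero]

theorem mul_mem_right (t : PrimitiveIdeal A) {a : A} (b : A) (ha : a ∈ t.toSubmodule) :
    a * b ∈ t.toSubmodule := by
  obtain ⟨H, _, _, _, π, -, h⟩ := t.exists_rep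
  rw [h] at ha ⊢
  rw [map_mul, ha, zero_mul]

theorem star_mem (t : PrimitiveIdeal A) {a : A} (ha : a ∈ t.toSubmodule) :
    star a ∈ t.toSubmodule := by
  obtain ⟨H, _, _, _, π, -, h⟩ := t.exists_rep
  rw [h] at ha ⊢
  rw [map_star, ha, star_zero]

/-! ### The C*-bundle of a C*-algebra over its primitive ideal space -/

/-- The fibre `A / t`, with the quotient norm and the quotient *-algebra structure. -/
def Fibre (t : PrimitiveIdeal A) : Type u := A ⧸ t.toSubmodule

instance (t : PrimitiveIdeal A) : SeminormedAddCommGroup (Fibre t) :=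
  Submodule.Quotient.seminormedAddCommGroup t.toSubmodule

instance (t : PrimitiveIdeal A) : Module ℂ (Fibre t) :=
  Submodule.Quotient.module t.toSubmodule

/-- The value `a(t)` of `a` at `t`, its class in `A / t`. -/
def value (a : A) (t : PrimitiveIdeal A) : Fibre t := t.toSubmodule.mkQ a

instance (t : PrimitiveIdeal A) : Mul (Fibre t) where
  mul := Quotient.map₂ (· * ·) fun a a' h b b' h' => by
    have h₁ : a - a' ∈ t.toSubmodule := (Submodule.quotientRel_def _).1 h
    have h₂ : b - b' ∈ t.toSubmodule := (Submodule.quotientRel_def _).1 h'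
    refine (Submodule.quotientRel_def _).2 ?_
    have e : a * b - a' * b' = (a - a') * b + a' * (b - b') := by
      rw [sub_mul, mul_sub]; abel
    change a * b - a' * b' ∈ t.toSubmodule
    rw [e]
    exact add_mem (t.mul_mem_right b h₁) (t.mul_mem_left a' h₂)

instance (t : PrimitiveIdeal A) : Star (Fibre t) where
  star := Quotient.map star fun a a' h => by
    have h₁ : a - a' ∈ t.toSubmodule := (Submodule.quotientRel_def _).1 h
    refine (Submodule.quotientRel_def _).2 ?_
    rw [← star_sub]
    exact t.star_mem h₁

theorem value_mul (t : PrimitiveIdeal A) (a b : A) :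
    value (a * b) t = value a t * value b t := rfl

theorem value_star (t : PrimitiveIdeal A) (a : A) : value (star a) t = star (value a t) := rfl

end PrimitiveIdeal

/-- The total space of the C*-bundle over `Prim A` corresponding to `A`, with fibres `A / t`. -/
structure BundleSpace (A : Type u) [NonUnitalCStarAlgebra A] where
  base : PrimitiveIdeal A
  val : PrimitiveIdeal.Fibre base

/-- The tube of radius `ε` around the section `t ↦ a(t)` over the subset `U` of the base. -/
def BundleSpace.tube {A : Type u} [NonUnitalCStarAlgebra A] (a : A) (U : Set (PrimitiveIdeal A))
    (ε : ℝ) : Set (BundleSpace A) :=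
  {x : BundleSpace A | x.base ∈ U ∧ ‖x.val - PrimitiveIdeal.value a x.base‖ < ε}

/-- The topology of the C*-bundle: it is generated by the tubes of radius `ε` around the sections
`t ↦ a(t)`, `a ∈ A`, over open subsets `U` of the base. -/
instance (A : Type u) [NonUnitalCStarAlgebra A] : TopologicalSpace (BundleSpace A) :=
  TopologicalSpace.generateFrom
    {V | ∃ (a : A) (U : Set (PrimitiveIdeal A)) (ε : ℝ), IsOpen U ∧ 0 < ε ∧
      V = BundleSpace.tube a U ε}

/-! ### The groups `Aut(M_n)` and `Aut(M_n, D_n)` -/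

/-- The *-algebra `M_n` of complex `n × n` matrices; the star is the conjugate transpose. -/
abbrev Mat (n : ℕ) : Type := Matrix (Fin n) (Fin n) ℂ

/-- The group of *-automorphisms of `M_n`. -/
abbrev AutMat (n : ℕ) : Type := Mat n ≃⋆ₐ[ℂ] Mat n

/-- The topology of pointwise convergence; as `M_n` is finite-dimensional it is the norm topology. -/
instance (n : ℕ) : TopologicalSpace (AutMat n) :=
  TopologicalSpace.induced (fun (g : AutMat n) (x : Mat n) => g x) inferInstance

/-- The subalgebra `D_n` of diagonal matrices, as a set. -/
def diagMat (n : ℕ) : Set (Mat n) := {x | x.IsDiag}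

/-- The subgroup `Aut(M_n, D_n)` of the automorphisms `g` of `M_n` with `g(D_n) = D_n`. -/
def autDiag (n : ℕ) : Subgroup (AutMat n) where
  carrier := {g | (fun x => g x) '' diagMat n = diagMat n}
  mul_mem' := by
    intro g h hg hh
    change (fun x => g (h x)) '' diagMat n = diagMat n
    rw [← Set.image_image (fun x => g x) (fun x => h x)]
    exact (congrArg _ hh).trans hg
  one_mem' := by
    change (fun x => x) '' diagMat n = diagMat n
    exact Set.image_id' _
  inv_mem' := by
    intro g hg
    change (fun x => g.symm x) '' diagMat n = diagMat n
    have hg' : (fun x => g x) '' diagMat n = diagMat n := hg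
    conv_lhs => rw [← hg']
    rw [Set.image_image]
    simp

/-! ### Principal bundles, extension and reduction of the structure group

The structure group acts from the right, that is, through its opposite group: `x · g` is
`MulOpposite.op g • x`. -/

/-- `p : P → T` is a (locally trivial) principal `G`-bundle. -/
structure IsPrincipalBundle (G : Type*) [Group G] [TopologicalSpace G] {P T : Type*}
    [TopologicalSpace P] [TopologicalSpace T] [MulAction Gᵐᵒᵖ P] (p : P → T) : Prop where
  proj_smul : ∀ (g : G) (x : P), p (MulOpposite.op g • x) = p x
  locally_trivial : ∀ t : T, ∃ e : Bundle.Trivialization G p, t ∈ e.baseSet ∧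
    ∀ x : P, p x ∈ e.baseSet → ∀ g : G, (e (MulOpposite.op g • x)).2 = (e x).2 * g

section Extension

variable {G : Type*} [Group G] (H : Subgroup G) (Q : Type*) [MulAction (H)ᵐᵒᵖ Q]

/-- The relation `(x · h, g) ∼ (x, h g)` on `Q × G`. -/
def extensionSetoid : Setoid (Q × G) where
  r y z := ∃ h : H, z.1 = MulOpposite.op h • y.1 ∧ y.2 = (h : G) * z.2
  iseqv :=
    { refl := fun y => ⟨1, by simp, by simp⟩
      symm := by
        rintro y z ⟨h, h₁, h₂⟩
        refine ⟨h⁻¹, ?_, ?_⟩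
        · rw [h₁, smul_smul, ← MulOpposite.op_mul]; simp
        · rw [h₂]; simp
      trans := by
        rintro x y z ⟨h, h₁, h₂⟩ ⟨k, k₁, k₂⟩
        refine ⟨h * k, ?_, ?_⟩
        · rw [k₁, h₁, smul_smul, ← MulOpposite.op_mul]
        · rw [h₂, k₂, Subgroup.coe_mul, mul_assoc] }

/-- The extension `Q ×_H G` of a principal `H`-bundle `Q` to the structure group `G`, constructed
from `Q` and the action of `H` on `G` by left multiplication. -/
def Extension : Type _ := Quotient (extensionSetoid H Q)

/-- The quotient topology of the product topology. -/
instance [TopologicalSpace G] [TopologicalSpace Q] : TopologicalSpace (Extension H Q) :=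
  inferInstanceAs (TopologicalSpace (Quotient (extensionSetoid H Q)))

/-- The right action `[x, g] · k = [x, g k]` of `G`. -/
instance : MulAction Gᵐᵒᵖ (Extension H Q) where
  smul k := Quotient.map (fun y : Q × G => (y.1, y.2 * k.unop)) (by
    rintro y z ⟨h, h₁, h₂⟩
    exact ⟨h, h₁, by rw [h₂, mul_assoc]⟩)
  one_smul := by
    rintro ⟨x, g⟩
    exact congrArg (Quotient.mk (extensionSetoid H Q)) (Prod.ext rfl (mul_one g))
  mul_smul := by
    rintro k l ⟨x, g⟩
    exact congrArg (Quotient.mk (extensionSetoid H Q))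
      (Prod.ext rfl (mul_assoc g l.unop k.unop).symm)

/-- The class `[x, g]` in `Q ×_H G`. -/
def Extension.mk {Q : Type*} [MulAction (H)ᵐᵒᵖ Q] (x : Q) (g : G) : Extension H Q :=
  Quotient.mk (extensionSetoid H Q) (x, g)

end Extension

/-- The principal `G`-bundle `p : P → T` reduces to a principal `H`-bundle: there are a principal
`H`-bundle `q : Q → T` and an isomorphism over `T` (an equivariant homeomorphism that respects the
projections) from the principal `G`-bundle `Q ×_H G → T`, `[x, g] ↦ q x`, onto `P`. -/
def ReducesTo {G : Type*} [Group G] [TopologicalSpace G] (H : Subgroup G) {P T : Type u}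
    [TopologicalSpace P] [TopologicalSpace T] [MulAction Gᵐᵒᵖ P] (p : P → T) : Prop :=
  ∃ (Q : Type u) (_ : TopologicalSpace Q) (_ : MulAction (H)ᵐᵒᵖ Q) (q : Q → T),
    IsPrincipalBundle H q ∧
      ∃ f : Extension H Q ≃ₜ P,
        (∀ (g : G) (y : Extension H Q), f (MulOpposite.op g • y) = MulOpposite.op g • f y) ∧
        ∀ (x : Q) (g : G), p (f (Extension.mk H x g)) = q x

/-! ### The principal `Aut(M_n)`-bundle of the `M_n`-bundle corresponding to `A` -/

/-- The principal bundle associated with the bundle of the fibres `A / t`: its points over `t` are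
the admissible maps `M_n → A / t`, that is, the *-isomorphisms of `M_n` onto the fibre. -/
structure FrameSpace (n : ℕ) (A : Type u) [NonUnitalCStarAlgebra A] where
  base : PrimitiveIdeal A
  frame : Mat n ≃⋆ₐ[ℂ] PrimitiveIdeal.Fibre base

namespace FrameSpace

variable {n : ℕ} {A : Type u} [NonUnitalCStarAlgebra A]

/-- A point of the principal bundle, as a map from `M_n` to the total space of the bundle. -/
def toBundle (w : FrameSpace n A) (x : Mat n) : BundleSpace A := ⟨w.base, w.frame x⟩

/-- The topology of pointwise convergence of maps from `M_n` to the total space of the bundle. -/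
instance : TopologicalSpace (FrameSpace n A) :=
  TopologicalSpace.induced (fun (w : FrameSpace n A) (x : Mat n) => w.toBundle x) inferInstance

/-- The right action of `Aut(M_n)` by composition: `φ · g = φ ∘ g`. -/
instance : MulAction (AutMat n)ᵐᵒᵖ (FrameSpace n A) where
  smul g w := ⟨w.base, g.unop.trans w.frame⟩
  one_smul _ := rfl
  mul_smul _ _ _ := rfl

theorem toBundle_smul (w : FrameSpace n A) (g : AutMat n) (x : Mat n) :
    (MulOpposite.op g • w).toBundle x = w.toBundle (g x) := rfl

end FrameSpace

/-! ### Cartan subalgebras -/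

section Cartan

variable {A : Type u} [NonUnitalCStarAlgebra A]

/-- `E` is a faithful conditional expectation of `A` onto the sub-C*-algebra `B`: a positive
contractive `B`-bimodule map which is the identity on `B`, such that `E (a* a) = 0` only for
`a = 0`. -/
structure IsFaithfulCondExp (B : NonUnitalStarSubalgebra ℂ A) (E : A →ₗ[ℂ] B) : Prop where
  map_coe : ∀ b : B, E (b : A) = b
  norm_le : ∀ a : A, ‖E a‖ ≤ ‖a‖
  map_positive : ∀ a : A, ∃ b : B, E (star a * a) = star b * b
  map_mul_left : ∀ (b : B) (a : A), E ((b : A) * a) = b * E a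
  map_mul_right : ∀ (a : A) (b : B), E (a * (b : A)) = E a * b
  faithful : ∀ a : A, E (star a * a) = 0 → a = 0

/-- The normalizer `{m ∈ A | m B m* ⊆ B and m* B m ⊆ B}` of `B` in `A`. -/
def normalizerSet (B : NonUnitalStarSubalgebra ℂ A) : Set A :=
  {m | ∀ b ∈ B, m * b * star m ∈ B ∧ star m * b * m ∈ B}

/-- `B` is a Cartan subalgebra of `A`. -/
structure IsCartanSubalgebra (B : NonUnitalStarSubalgebra ℂ A) : Prop where
  /-- `B` is maximal among the abelian sub-C*-algebras of `A`. -/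
  maximal_abelian : Maximal (fun C : NonUnitalStarSubalgebra ℂ A =>
    IsClosed (C : Set A) ∧ ∀ x ∈ C, ∀ y ∈ C, x * y = y * x) B
  /-- `B` contains an approximate unit of `A`. -/
  approximate_unit : ∃ l : Filter A, l.IsApproximateUnit ∧ ∀ᶠ x in l, x ∈ B
  /-- `B` is regular: the normalizer of `B` generates `A` as a C*-algebra. -/
  regular : (NonUnitalStarAlgebra.adjoin ℂ (normalizerSet B)).topologicalClosure = ⊤
  /-- There is a faithful conditional expectation of `A` onto `B`. -/
  expectation : ∃ E : A →ₗ[ℂ] B, IsFaithfulCondExp B E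

end Cartan

end

/-! A frame at `t` is the same thing as a representation of `A` onto `M_n` with kernel `t`
(`FrameSpace.coord`), and the topology of the frame bundle is pointwise convergence of these
representations (`FrameSpace.isInducing_coord`). A reduction of the structure group is then a set
`R` of "adapted" frames: stable under `Aut(M_n, D_n)`, with any two members over one point differing
by that subgroup, and with continuous local sections (`IsReduction`). The maps
`exists_isReduction_of_reducesTo` and `IsReduction.reducesTo` translate between this picture and
associated bundles.

Given `R`, let `B` consist of the elements that are diagonal in all adapted frames. In each fibre
this is `D_n` inside `M_n`: the diagonal part is a faithful expectation, only diagonal matrices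
commute with `D_n`, and the corners `e_jj x e_kk` normalize `D_n` and add up to `x`. What has to be
proved is that such fibrewise constructions come from elements of `A`. This is `exists_section`: a
section that is locally approximable by elements of `A` and dominated by some `‖b(t)‖` belongs to
`A`. It rests on partitions of unity by central elements, which are built by hand from orthogonal
elements (`exists_isScalar_of_orthogonal`, `exists_isScalar`).

Given a Cartan subalgebra `B`, its expectation is linear over the central elements, so it descends
to a projection of `M_n` onto the fibre of `B`. The trace of this projection is its rank and varies
continuously, so the fibre dimension `k` is locally constant and the fibres are locally spanned by
`k` orthogonal self-adjoint elements `p i` of `B` (`IsCartanSubalgebra.exists_orthogonal_span`).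
Cut-off elements of `p i A p i` commute with `B`, hence lie in `B` by maximality; so each `p i` has
rank one in the fibre, and since the fibre of `B` contains the identity, `k ≥ n`
(`IsCartanSubalgebra.exists_orthogonal`). The frames carrying `D_n` onto the fibre of `B` form the
reduction. A continuous local section is obtained by making chosen elements of `p i A p i₀`
nonnegative multiples of matrix units, which pins the frame down uniquely.

The analytic input is that irreducible representations separate points (extreme states and GNS),
that they are onto in finite dimension (Burnside), and a compactness principle: frames over
convergent points converge along ultrafilters (`FrameSpace.exists_tendsto`). It makes `t ↦ ‖a(t)‖`
continuous, and in the same way ultralimits make the sets `{ε ≤ ‖a(t)‖}` compact. -/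

/-! ### Pure states and irreducible representations -/

section States

open scoped ComplexOrder InnerProductSpace

variable {U : Type u} [CStarAlgebra U]

/-- A function on a unital C*-algebra is a state: linear, positive and unital. -/
structure IsStateFun (φ : U → ℂ) : Prop where
  map_add : ∀ a b, φ (a + b) = φ a + φ b
  map_smul : ∀ (c : ℂ) a, φ (c • a) = c * φ a
  nonneg : ∀ a, 0 ≤ φ (star a * a)
  map_one : φ 1 = 1

/-- The nonnegative functional on self-adjoint elements is real: a functional of norm at most one
with value one at the unit takes real values at self-adjoint elements. -/
theorem im_eq_zero_of_norm_le_one (g : U →L[ℂ] ℂ) (hg : ‖g‖ ≤ 1) (h1 : g 1 = 1) {h : U}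
    (hh : IsSelfAdjoint h) : (g h).im = 0 := by
  have key : ∀ t : ℝ, ((g h).im + t) ^ 2 ≤ ‖h‖ ^ 2 + ‖(1 : U)‖ * t ^ 2 := by
    intro t
    have e1 : g (h + ((t : ℂ) * Complex.I) • (1 : U)) = g h + (t : ℂ) * Complex.I := by
      simp [h1]
    have e2 : ‖h + ((t : ℂ) * Complex.I) • (1 : U)‖ ^ 2 ≤ ‖h‖ ^ 2 + ‖(1 : U)‖ * t ^ 2 := by
      rw [sq, ← CStarRing.norm_star_mul_self]
      have : star (h + ((t : ℂ) * Complex.I) • (1 : U)) * (h + ((t : ℂ) * Complex.I) • (1 : U))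
          = h * h + ((t : ℂ) ^ 2) • (1 : U) := by
        rw [star_add, hh.star_eq, star_smul, star_one]
        simp only [add_mul, mul_add, smul_mul_assoc, mul_smul_comm, mul_one, one_mul, smul_add,
          smul_smul]
        simp only [star_mul', RCLike.star_def, Complex.conj_I, Complex.conj_ofReal]
        have : (t : ℂ) * Complex.I * (t * -Complex.I) = (t : ℂ) ^ 2 := by
          ring_nf; simp
        rw [this]; module
      rw [this]
      refine (norm_add_le _ _).trans ?_
      gcongr
      · rw [sq]; exact norm_mul_le _ _
      · rw [norm_smul, mul_comm]; simp
    have e3 : ‖g h + (t : ℂ) * Complex.I‖ ≤ ‖h + ((t : ℂ) * Complex.I) • (1 : U)‖ := by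
      rw [← e1]
      exact (g.le_of_opNorm_le hg _).trans (by rw [one_mul])
    have e4 : |(g h).im + t| ≤ ‖g h + (t : ℂ) * Complex.I‖ := by
      simpa using Complex.abs_im_le_norm (g h + (t : ℂ) * Complex.I)
    calc ((g h).im + t) ^ 2 = |(g h).im + t| ^ 2 := (sq_abs _).symm
      _ ≤ ‖h + ((t : ℂ) * Complex.I) • (1 : U)‖ ^ 2 := by gcongr; exact e4.trans e3
      _ ≤ _ := e2
  have h1n : ‖(1 : U)‖ ≤ 1 := by
    rcases subsingleton_or_nontrivial U with _ | _
    · rw [Subsingleton.elim (1 : U) 0]; simp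
    · simp
  by_contra hne
  -- This `t` makes the cross term `2 t Im g(h)` equal to `‖h‖ ^ 2 + 1`, more than `key` allows when
  -- `‖1‖ ≤ 1`.
  have hk := key ((‖h‖ ^ 2 + 1) / (2 * (g h).im))
  set β := (g h).im
  have : ((β + (‖h‖ ^ 2 + 1) / (2 * β))) ^ 2 = β ^ 2 + (‖h‖ ^ 2 + 1) + ((‖h‖ ^ 2 + 1) / (2 * β)) ^ 2 := by
    field_simp; ring
  nlinarith [sq_nonneg β, sq_nonneg ((‖h‖ ^ 2 + 1) / (2 * β))]

/-- For positive `x`, the element `‖x‖ - x` has norm at most `‖x‖`; hence `g x` lies within `‖x‖` of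
`‖x‖`, and its real part cannot be negative. -/
theorem isStateFun_of_norm_le_one (g : U →L[ℂ] ℂ) (hg : ‖g‖ ≤ 1) (h1 : g 1 = 1) :
    IsStateFun g := by
  refine ⟨fun a b => map_add g a b, fun c a => map_smul g c a, fun a => ?_, h1⟩
  let _ := CStarAlgebra.spectralOrder U
  let _ := CStarAlgebra.spectralOrderedRing U
  rcases subsingleton_or_nontrivial U with _ | _
  · rw [Subsingleton.elim (star a * a) 0]; simp
  have him := im_eq_zero_of_norm_le_one g hg h1 (IsSelfAdjoint.star_mul_self a)
  rw [Complex.nonneg_iff]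
  refine ⟨?_, him.symm⟩
  set x := star a * a
  have hx : 0 ≤ x := star_mul_self_nonneg a
  have hb : ‖algebraMap ℝ U ‖x‖ - x‖ ≤ ‖x‖ := by
    have h0 : 0 ≤ algebraMap ℝ U ‖x‖ - x := sub_nonneg.2 (IsSelfAdjoint.le_algebraMap_norm_self
      (IsSelfAdjoint.star_mul_self a))
    rw [CStarAlgebra.norm_le_iff_le_algebraMap _ (norm_nonneg _) h0]
    simpa using hx
  have := (g.le_of_opNorm_le hg (algebraMap ℝ U ‖x‖ - x)).trans ((one_mul _).le.trans hb)
  have e : g (algebraMap ℝ U ‖x‖) = (‖x‖ : ℂ) := by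
    rw [Algebra.algebraMap_eq_smul_one, ← Complex.coe_smul, map_smul, h1]; simp
  rw [map_sub, e] at this
  have h2 := (Complex.re_le_norm _).trans this
  simp at h2
  exact h2

/-- The norm of a positive element lies in its spectrum, so a character of the commutative
C*-algebra generated by it attains the norm. A norm-preserving Hahn–Banach extension of the
character is a state. -/
theorem exists_isStateFun [Nontrivial U] (c : U) :
    ∃ φ : U → ℂ, IsStateFun φ ∧ φ (star c * c) = ‖star c * c‖ := by
  let _ := CStarAlgebra.spectralOrder U
  let _ := CStarAlgebra.spectralOrderedRing U
  set b := star c * c with hb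
  have hbs : IsSelfAdjoint b := IsSelfAdjoint.star_mul_self c
  have : IsStarNormal b := hbs.isStarNormal
  have hmem : ((‖b‖ : ℝ) : ℂ) ∈ spectrum ℂ b := by
    have := CStarAlgebra.norm_mem_spectrum_of_nonneg (a := b) (star_mul_self_nonneg c)
    exact spectrum.algebraMap_mem_iff ℂ |>.2 this
  let S := StarAlgebra.elemental ℂ b
  have : IsClosed (S : Set U) := StarAlgebra.elemental.isClosed ℂ b
  let b' : S := ⟨b, StarAlgebra.elemental.self_mem ℂ b⟩
  have hmem' : ((‖b‖ : ℝ) : ℂ) ∈ spectrum ℂ b' := by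
    rw [StarSubalgebra.spectrum_eq]; exact hmem
  obtain ⟨χ, hχ⟩ := WeakDual.CharacterSpace.mem_spectrum_iff_exists.1 hmem'
  let p : Subspace ℂ U := Subalgebra.toSubmodule S.toSubalgebra
  have hf₀ : ‖(WeakDual.CharacterSpace.toCLM χ : S →L[ℂ] ℂ)‖ ≤ 1 := by
    refine ContinuousLinearMap.opNorm_le_bound _ zero_le_one fun x => ?_
    rw [one_mul]
    exact AlgHom.norm_apply_le_self χ x
  let f : StrongDual ℂ p := WeakDual.CharacterSpace.toCLM χ
  have hf : ‖f‖ ≤ 1 := hf₀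
  obtain ⟨g, hg, hgn⟩ := exists_extension_norm_eq p f
  refine ⟨g, isStateFun_of_norm_le_one g (hgn.trans_le hf) ?_, ?_⟩
  · have := hg ⟨1, one_mem S⟩
    exact this.trans (_root_.map_one χ)
  · exact (hg ⟨b, StarAlgebra.elemental.self_mem ℂ b⟩).trans hχ

/-- The positive linear functional given by a state. -/
noncomputable def IsStateFun.toPositive [PartialOrder U] [StarOrderedRing U] {φ : U → ℂ}
    (h : IsStateFun φ) : U →ₚ[ℂ] ℂ :=
  PositiveLinearMap.mk₀ { toFun := φ, map_add' := h.map_add, map_smul' := h.map_smul } (by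
    intro x hx
    obtain ⟨b, rfl⟩ := CStarAlgebra.nonneg_iff_eq_star_mul_self.1 hx
    exact h.nonneg b)

/-! ### The GNS representation and its cyclic vector -/

section GNS

variable [PartialOrder U] [StarOrderedRing U] (f : U →ₚ[ℂ] ℂ)

/-- The canonical cyclic vector of the GNS representation of a unital C*-algebra. -/
noncomputable def gnsVector : f.GNS := ((f.toPreGNS 1 : f.PreGNS) : f.GNS)

theorem gns_apply_vector (a : U) :
    f.gnsNonUnitalStarAlgHom a (gnsVector f) = ((f.toPreGNS a : f.PreGNS) : f.GNS) := by
  rw [gnsVector, PositiveLinearMap.gnsNonUnitalStarAlgHom_apply_coe]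
  simp

theorem inner_gns_vector (a : U) :
    ⟪gnsVector f, f.gnsNonUnitalStarAlgHom a (gnsVector f)⟫_ℂ = f a := by
  rw [gns_apply_vector, gnsVector, UniformSpace.Completion.inner_coe,
    PositiveLinearMap.preGNS_inner_def]
  simp

/-- The orbit of the canonical vector is the dense image of the pre-Hilbert space: the vector is
cyclic. -/
theorem eq_zero_of_inner_gns_vector {v : f.GNS}
    (h : ∀ a, ⟪v, f.gnsNonUnitalStarAlgHom a (gnsVector f)⟫_ℂ = 0) : v = 0 := by
  have : ∀ x : f.GNS, ⟪v, x⟫_ℂ = 0 := by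
    intro x
    induction x using UniformSpace.Completion.induction_on with
    | hp => exact isClosed_eq (by fun_prop) continuous_const
    | ih x => simpa [gns_apply_vector] using h (f.ofPreGNS x)
  exact inner_self_eq_zero.1 (this v)

end GNS

/-- Cauchy–Schwarz for the vector state of the unit GNS vector. The bound confines states to a
product of discs. -/
theorem IsStateFun.norm_le {φ : U → ℂ} (h : IsStateFun φ) (a : U) : ‖φ a‖ ≤ ‖a‖ := by
  let _ := CStarAlgebra.spectralOrder U
  let _ := CStarAlgebra.spectralOrderedRing U
  let f := h.toPositive
  have e : ∀ a, f a = φ a := fun _ => rfl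
  rw [← e, ← inner_gns_vector]
  have h1 : ‖gnsVector f‖ = 1 := by
    have := inner_gns_vector f 1
    rw [gns_apply_vector, e, h.map_one] at this
    rw [← gnsVector, inner_self_eq_norm_sq_to_K] at this
    have h2 : ‖gnsVector f‖ ^ 2 = 1 := by
      rw [← Complex.ofReal_inj]; simpa using this
    nlinarith [norm_nonneg (gnsVector f)]
  calc _ ≤ ‖gnsVector f‖ * ‖f.gnsNonUnitalStarAlgHom a (gnsVector f)‖ := norm_inner_le_norm _ _
    _ ≤ 1 * (‖a‖ * 1) := by
      rw [h1]
      gcongr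
      refine (ContinuousLinearMap.le_opNorm _ _).trans ?_
      rw [h1]
      gcongr
      exact NonUnitalStarAlgHom.norm_apply_le _ a
    _ = ‖a‖ := by ring

/-- The states which take the value `‖b‖` at `b`. -/
def normingStates (b : U) : Set (U → ℂ) := {φ | IsStateFun φ ∧ φ b = ‖b‖}

/-- Banach–Alaoglu in the topology of pointwise convergence: the defining conditions are closed, and
the product of discs is compact by Tychonoff. -/
theorem isCompact_normingStates (b : U) : IsCompact (normingStates b) := by
  have hsub : normingStates b ⊆ Set.univ.pi fun a => Metric.closedBall (0 : ℂ) ‖a‖ := by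
    rintro φ ⟨h, -⟩ a -
    simpa using h.norm_le a
  refine (isCompact_univ_pi fun a => isCompact_closedBall (0 : ℂ) ‖a‖).of_isClosed_subset ?_ hsub
  have : normingStates b = (⋂ (x : U) (y : U), {φ | φ (x + y) = φ x + φ y}) ∩
      (⋂ (c : ℂ) (x : U), {φ | φ (c • x) = c * φ x}) ∩ (⋂ x : U, {φ | 0 ≤ φ (star x * x)}) ∩
      {φ | φ 1 = 1} ∩ {φ | φ b = ((‖b‖ : ℝ) : ℂ)} := by
    ext φ
    simp only [normingStates, Set.mem_ofPred_eq, Set.mem_inter_iff, Set.mem_iInter]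
    exact ⟨fun h => ⟨⟨⟨⟨h.1.1, h.1.2⟩, h.1.3⟩, h.1.4⟩, h.2⟩,
      fun h => ⟨⟨h.1.1.1.1, h.1.1.1.2, h.1.1.2, h.1.2⟩, h.2⟩⟩
  rw [this]
  refine IsClosed.inter (IsClosed.inter (IsClosed.inter (IsClosed.inter ?_ ?_) ?_) ?_) ?_
  · exact isClosed_iInter fun x => isClosed_iInter fun y => isClosed_eq (by fun_prop) (by fun_prop)
  · exact isClosed_iInter fun x => isClosed_iInter fun y => isClosed_eq (by fun_prop) (by fun_prop)
  · exact isClosed_iInter fun x => isClosed_le (by fun_prop) (by fun_prop)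
  · exact isClosed_eq (by fun_prop) (by fun_prop)
  · exact isClosed_eq (by fun_prop) (by fun_prop)

/-- A nonzero vector gives a state of a unital C*-algebra. -/
theorem isStateFun_vector [PartialOrder U] [StarOrderedRing U] (f : U →ₚ[ℂ] ℂ) {v : f.GNS}
    (hv : v ≠ 0) :
    IsStateFun fun a => ((‖v‖ ^ 2 : ℝ) : ℂ)⁻¹ * ⟪v, f.gnsNonUnitalStarAlgHom a v⟫_ℂ where
  map_add a b := by rw [map_add, add_apply, inner_add_right, mul_add]
  map_smul c a := by
    rw [map_smul, smul_apply, inner_smul_right]; ring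
  nonneg a := by
    rw [map_mul, map_star, ContinuousLinearMap.star_eq_adjoint, mul_apply_eq_comp,
      ContinuousLinearMap.adjoint_inner_right, inner_self_eq_norm_sq_to_K]
    have : (0 : ℝ) ≤ (‖v‖ ^ 2)⁻¹ * ‖f.gnsNonUnitalStarAlgHom a v‖ ^ 2 := by positivity
    have := Complex.zero_le_real.2 this
    rw [Complex.ofReal_mul, Complex.ofReal_inv, Complex.ofReal_pow] at this
    simpa using this
  map_one := by
    have : f.gnsNonUnitalStarAlgHom 1 = 1 := f.gnsStarAlgHom.map_one'
    rw [this, one_apply_eq_self, inner_self_eq_norm_sq_to_K]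
    have : (‖v‖ : ℂ) ≠ 0 := by simpa using hv
    push_cast
    exact inv_mul_cancel₀ (pow_ne_zero 2 this)

/-- The GNS representation of an extreme norming state is irreducible. -/
theorem gns_irreducible_of_extreme [PartialOrder U] [StarOrderedRing U] {b : U} {φ : U → ℂ}
    (hφ : φ ∈ Set.extremePoints ℝ (normingStates b)) (f : U →ₚ[ℂ] ℂ) (hf : ∀ a, f a = φ a)
    (K : Submodule ℂ f.GNS) (hK : IsClosed (K : Set f.GNS))
    (hinv : ∀ a, ∀ v ∈ K, f.gnsNonUnitalStarAlgHom a v ∈ K) : K = ⊥ ∨ K = ⊤ := by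
  have : CompleteSpace K := hK.completeSpace_coe
  set π := f.gnsNonUnitalStarAlgHom with hπ
  set ξ := gnsVector f with hξ
  set x := K.starProjection ξ with hx
  set y := ξ - x with hy
  have hxy : ξ = x + y := by rw [hy]; abel
  have hyK : ∀ u ∈ K, ⟪u, y⟫_ℂ = 0 := fun u hu =>
    (Submodule.mem_orthogonal K _).1 (K.sub_starProjection_mem_orthogonal ξ) u hu
  have hxK : x ∈ K := by simp [hx]
  have hyπ : ∀ a, ∀ u ∈ K, ⟪u, π a y⟫_ℂ = 0 := by
    intro a u hu
    rw [← ContinuousLinearMap.adjoint_inner_left, ← ContinuousLinearMap.star_eq_adjoint,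
      ← map_star]
    exact hyK _ (hinv _ _ hu)
  have hyπ' : ∀ a, ∀ u ∈ K, ⟪y, π a u⟫_ℂ = 0 := by
    intro a u hu
    rw [← inner_conj_symm, hyK _ (hinv a u hu), map_zero]
  have hsplit : ∀ a, f a = ⟪x, π a x⟫_ℂ + ⟪y, π a y⟫_ℂ := by
    intro a
    rw [← inner_gns_vector, ← hξ, hxy, map_add, inner_add_left, inner_add_right, inner_add_right,
      hyπ a x hxK, hyπ' a x hxK]
    ring
  by_cases hx0 : x = 0
  · left
    rw [eq_bot_iff]
    intro v hv
    rw [Submodule.mem_bot]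
    apply eq_zero_of_inner_gns_vector f
    intro a
    have : ⟪v, π a y⟫_ℂ = 0 := hyπ a v hv
    rwa [← hξ, hxy, hx0, zero_add]
  by_cases hy0 : y = 0
  · right
    have hξK : ξ ∈ K := by rw [hxy, hy0, add_zero]; exact hxK
    rw [eq_top_iff]
    intro v _
    have : v - K.starProjection v = 0 := by
      apply eq_zero_of_inner_gns_vector f
      intro a
      rw [← inner_conj_symm]
      have := (Submodule.mem_orthogonal K _).1 (K.sub_starProjection_mem_orthogonal v) _
        (hinv a _ hξK)
      rw [this, map_zero]
    rw [sub_eq_zero.1 this]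
    simp
  exfalso
  have hφs := hφ.1.1
  have hnorm : ‖x‖ ^ 2 + ‖y‖ ^ 2 = 1 := by
    have h1 := hsplit 1
    have h2 : π 1 = 1 := f.gnsStarAlgHom.map_one'
    rw [hf, hφs.map_one, h2, one_apply_eq_self, one_apply_eq_self,
      inner_self_eq_norm_sq_to_K, inner_self_eq_norm_sq_to_K] at h1
    have : ((‖x‖ ^ 2 + ‖y‖ ^ 2 : ℝ) : ℂ) = ((1 : ℝ) : ℂ) := by push_cast; exact h1.symm
    exact Complex.ofReal_injective this
  have hxp : 0 < ‖x‖ ^ 2 := by have := norm_pos_iff.2 hx0; positivity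
  have hyp : 0 < ‖y‖ ^ 2 := by have := norm_pos_iff.2 hy0; positivity
  let φ₁ : U → ℂ := fun a => ((‖x‖ ^ 2 : ℝ) : ℂ)⁻¹ * ⟪x, π a x⟫_ℂ
  let φ₂ : U → ℂ := fun a => ((‖y‖ ^ 2 : ℝ) : ℂ)⁻¹ * ⟪y, π a y⟫_ℂ
  have h₁ : IsStateFun φ₁ := isStateFun_vector f hx0
  have h₂ : IsStateFun φ₂ := isStateFun_vector f hy0
  have hxc : ((‖x‖ ^ 2 : ℝ) : ℂ) ≠ 0 := Complex.ofReal_ne_zero.2 hxp.ne'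
  have hyc : ((‖y‖ ^ 2 : ℝ) : ℂ) ≠ 0 := Complex.ofReal_ne_zero.2 hyp.ne'
  have hconv : ∀ a, φ a = ((‖x‖ ^ 2 : ℝ) : ℂ) * φ₁ a + ((‖y‖ ^ 2 : ℝ) : ℂ) * φ₂ a := by
    intro a
    rw [← hf, hsplit, mul_inv_cancel_left₀ hxc, mul_inv_cancel_left₀ hyc]
  have hre : ‖b‖ = ‖x‖ ^ 2 * (φ₁ b).re + ‖y‖ ^ 2 * (φ₂ b).re := by
    have := congrArg Complex.re (hconv b)
    rw [hφ.1.2] at this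
    simpa only [Complex.add_re, Complex.re_ofReal_mul, Complex.ofReal_re] using this
  have hle₁ := (Complex.re_le_norm _).trans (h₁.norm_le b)
  have hle₂ := (Complex.re_le_norm _).trans (h₂.norm_le b)
  have heq : ∀ {z : ℂ}, ‖z‖ ≤ ‖b‖ → z.re = ‖b‖ → z = (‖b‖ : ℂ) := by
    intro z hz hzr
    have h1 : ‖z‖ = z.re := le_antisymm (by rw [hzr]; exact hz) (Complex.re_le_norm z)
    have h2 : z.im = 0 := by
      have := Complex.sq_norm z
      rw [Complex.normSq_apply, h1] at this
      nlinarith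
    exact Complex.ext (by simpa using hzr) (by simpa using h2)
  -- The value `‖b‖` is a proper average of two numbers that are at most `‖b‖`, so both equal it:
  -- the norming states form a face of the state space.
  have hsum : ‖x‖ ^ 2 * (‖b‖ - (φ₁ b).re) + ‖y‖ ^ 2 * (‖b‖ - (φ₂ b).re) = 0 := by
    linear_combination hre + ‖b‖ * hnorm
  have hb₁ : (φ₁ b).re = ‖b‖ := by nlinarith [mul_nonneg hyp.le (sub_nonneg.2 hle₂)]
  have hb₂ : (φ₂ b).re = ‖b‖ := by nlinarith [mul_nonneg hxp.le (sub_nonneg.2 hle₁)]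
  have hm₁ : φ₁ ∈ normingStates b := ⟨h₁, heq (h₁.norm_le b) hb₁⟩
  have hm₂ : φ₂ ∈ normingStates b := ⟨h₂, heq (h₂.norm_le b) hb₂⟩
  have hseg : φ ∈ openSegment ℝ φ₁ φ₂ :=
    ⟨‖x‖ ^ 2, ‖y‖ ^ 2, hxp, hyp, hnorm, funext fun a => by
      rw [hconv a]; simp [Complex.real_smul]⟩
  have hφ₁ : φ₁ = φ := hφ.2 hm₁ hm₂ hseg
  -- As `φ₁ = φ`, the vectors `x` and `‖x‖² ξ` have the same inner products with the orbit of `ξ`,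
  -- so they agree. Then `ξ` is a multiple of `x`, which contradicts `y ≠ 0`.
  have hvec : x - ((‖x‖ ^ 2 : ℝ) : ℂ) • ξ = 0 := by
    apply eq_zero_of_inner_gns_vector f
    intro a
    rw [inner_sub_left, inner_smul_left, inner_gns_vector, hf, ← hφ₁, ← hξ, hxy, map_add,
      inner_add_right, hyπ a x hxK]
    simp only [φ₁, Complex.conj_ofReal, mul_inv_cancel_left₀ hxc]
    ring
  have hyx : ⟪y, x⟫_ℂ = 0 := by rw [← inner_conj_symm, hyK x hxK, map_zero]
  have hinner := congrArg (fun v => ⟪y, v⟫_ℂ) hvec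
  simp only [inner_sub_right, inner_smul_right, inner_zero_right, hyx, zero_sub, neg_eq_zero,
    mul_eq_zero, hxc, false_or] at hinner
  rw [hxy, inner_add_right, hyx, zero_add] at hinner
  exact hy0 (inner_self_eq_zero.1 hinner)

/-- Irreducible representations separate the points of a C*-algebra. -/
theorem exists_isIrreducibleRep_apply_ne_zero {A : Type u} [NonUnitalCStarAlgebra A] {a : A}
    (ha : a ≠ 0) : ∃ (H : Type u) (_ : NormedAddCommGroup H) (_ : InnerProductSpace ℂ H)
      (_ : CompleteSpace H) (π : A →⋆ₙₐ[ℂ] (H →L[ℂ] H)), IsIrreducibleRep π ∧ π a ≠ 0 := by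
  let V := Unitization ℂ A
  let _ : PartialOrder V := CStarAlgebra.spectralOrder V
  let _ : StarOrderedRing V := CStarAlgebra.spectralOrderedRing V
  let c : V := (a : Unitization ℂ A)
  obtain ⟨φ₀, h₀, h₀'⟩ := exists_isStateFun c
  obtain ⟨φ, hφ⟩ := (isCompact_normingStates (star c * c)).extremePoints_nonempty ⟨φ₀, h₀, h₀'⟩
  let f : V →ₚ[ℂ] ℂ := hφ.1.1.toPositive
  let π : A →⋆ₙₐ[ℂ] (f.GNS →L[ℂ] f.GNS) :=
    f.gnsNonUnitalStarAlgHom.comp (Unitization.inrNonUnitalStarAlgHom ℂ A)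
  have hπ : ∀ x : A, π x = f.gnsNonUnitalStarAlgHom (x : Unitization ℂ A) := fun _ => rfl
  have hne : π a ≠ 0 := by
    intro h
    have h1 : f (star c * c) = 0 := by
      rw [← inner_gns_vector, map_mul, ← hπ, h, mul_zero]
      simp
    have h2 : f (star c * c) = ‖star c * c‖ := hφ.1.2
    rw [h1, CStarRing.norm_star_mul_self] at h2
    have h3 : ‖c‖ = 0 := by
      have : ‖c‖ * ‖c‖ = 0 := by exact_mod_cast h2.symm
      simpa using this
    rw [Unitization.norm_inr] at h3
    exact ha (norm_eq_zero.1 h3)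
  refine ⟨f.GNS, inferInstance, inferInstance, inferInstance, π, ⟨fun h => hne (by rw [h]; rfl), ?_⟩,
    hne⟩
  intro K hK hinv
  refine gns_irreducible_of_extreme hφ f (fun _ => rfl) K hK fun u v hv => ?_
  -- Elements of the unitization are scalars plus elements of `A`, so subspaces invariant under `A`
  -- are invariant under all of it.
  have hu : u = u.fst • (1 : V) + ((u.snd : A) : Unitization ℂ A) := by
    ext <;> simp [V]
  have h1 : f.gnsNonUnitalStarAlgHom 1 = 1 := f.gnsStarAlgHom.map_one'
  rw [hu, map_add, map_smul, h1, ← hπ]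
  exact K.add_mem (K.smul_mem _ hv) (hinv _ _ hv)

end States

/-! ### Burnside's theorem -/

section Burnside

open Module

variable {V : Type*} [AddCommGroup V] [Module ℂ V] [FiniteDimensional ℂ V]

/-- By Schur's lemma (an eigenspace of a module endomorphism is invariant) the endomorphisms of the
module are scalars. So every linear map commutes with them, and Jacobson density matches it with an
element of the algebra on a basis. -/
theorem Algebra.adjoin_eq_top_of_irreducible [Nontrivial V] (S : Set (End ℂ V))
    (hirr : ∀ K : Submodule ℂ V, (∀ f ∈ S, ∀ v ∈ K, f v ∈ K) → K = ⊥ ∨ K = ⊤) :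
    Algebra.adjoin ℂ S = ⊤ := by
  let R := Algebra.adjoin ℂ S
  have hsimple : IsSimpleModule R V := by
    refine { eq_bot_or_eq_top := fun K => ?_ }
    have := hirr (K.restrictScalars ℂ) fun f hf v hv =>
      K.smul_mem (⟨f, Algebra.subset_adjoin hf⟩ : R) hv
    rcases this with h | h
    · left; simpa using h
    · right; simpa using h
  have hschur : ∀ g : End R V, ∃ c : ℂ, ∀ v, g v = c • v := by
    intro g
    obtain ⟨c, hc⟩ := Module.End.exists_eigenvalue (g.restrictScalars ℂ)
    refine ⟨c, fun v => ?_⟩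
    have h := hirr (Module.End.eigenspace (g.restrictScalars ℂ) c) (by
      intro f hf x hx
      rw [Module.End.mem_eigenspace_iff] at hx ⊢
      have h1 := g.map_smul (⟨f, Algebra.subset_adjoin hf⟩ : R) x
      have h2 : g x = c • x := hx
      change g (f x) = c • f x
      change g (f x) = f (g x) at h1
      rw [h1, h2, map_smul])
    rcases h with h | h
    · exact absurd h hc
    · exact Module.End.mem_eigenspace_iff.1 (h ▸ Submodule.mem_top : v ∈ _)
  rw [Algebra.eq_top_iff]
  intro T
  let T' : End (End R V) V :=
    { toFun := T
      map_add' := map_add T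
      map_smul' := by
        intro g x
        obtain ⟨c, hc⟩ := hschur g
        simp only [RingHom.id_apply, Module.End.smul_def, hc, map_smul] }
  classical
  let b := Module.finBasis ℂ V
  obtain ⟨r, hr⟩ := jacobson_density (R := R) T' (Finset.univ.image b)
  have : T = (r : End ℂ V) := by
    refine b.ext fun i => ?_
    exact hr (b i) (Finset.mem_image_of_mem _ (Finset.mem_univ i))
  rw [this]
  exact r.2

/-- Burnside's theorem, for algebras which are not assumed to contain the identity. -/
theorem NonUnitalSubalgebra.eq_top_of_irreducible (S : NonUnitalSubalgebra ℂ (End ℂ V))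
    {P : End ℂ V} (hP : P ∈ S) (hP0 : P ≠ 0)
    (hirr : ∀ K : Submodule ℂ V, (∀ f ∈ S, ∀ v ∈ K, f v ∈ K) → K = ⊥ ∨ K = ⊤) :
    ∀ T : End ℂ V, T ∈ S := by
  obtain ⟨u, hu⟩ : ∃ u, P u ≠ 0 := by
    by_contra! h
    exact hP0 (LinearMap.ext h)
  have : Nontrivial V := ⟨⟨_, _, hu⟩⟩
  have htop := Algebra.adjoin_eq_top_of_irreducible (S : Set (End ℂ V)) hirr
  -- Together with the identity, `S` generates all operators, so multiplication by any operator on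
  -- either side preserves `S`: it is a two-sided ideal.
  have hleft : ∀ (X : End ℂ V), ∀ Y ∈ S, X * Y ∈ S := by
    intro X
    have hX : X ∈ Algebra.adjoin ℂ (S : Set (End ℂ V)) := htop ▸ Algebra.mem_top
    induction hX using Algebra.adjoin_induction with
    | mem x hx => exact fun Y hY => S.mul_mem hx hY
    | algebraMap r =>
      intro Y hY
      rw [Algebra.algebraMap_eq_smul_one, smul_mul_assoc, one_mul]; exact S.smul_mem r hY
    | add x y _ _ h₁ h₂ => exact fun Y hY => by rw [add_mul]; exact S.add_mem (h₁ Y hY) (h₂ Y hY)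
    | mul x y _ _ h₁ h₂ => exact fun Y hY => by rw [mul_assoc]; exact h₁ _ (h₂ Y hY)
  have hright : ∀ (X : End ℂ V), ∀ Y ∈ S, Y * X ∈ S := by
    intro X
    have hX : X ∈ Algebra.adjoin ℂ (S : Set (End ℂ V)) := htop ▸ Algebra.mem_top
    induction hX using Algebra.adjoin_induction with
    | mem x hx => exact fun Y hY => S.mul_mem hY hx
    | algebraMap r =>
      intro Y hY
      rw [Algebra.algebraMap_eq_smul_one, mul_smul_comm, mul_one]; exact S.smul_mem r hY
    | add x y _ _ h₁ h₂ => exact fun Y hY => by rw [mul_add]; exact S.add_mem (h₁ Y hY) (h₂ Y hY)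
    | mul x y _ _ h₁ h₂ => exact fun Y hY => by rw [← mul_assoc]; exact h₂ _ (h₁ Y hY)
  -- A nonzero element of an ideal, sandwiched between rank-one operators, yields every rank-one
  -- operator.
  have hrank : ∀ (f : V →ₗ[ℂ] ℂ) (y : V), f.smulRight y ∈ S := by
    intro f y
    obtain ⟨g, hg⟩ := Module.Projective.exists_dual_ne_zero ℂ hu
    have : f.smulRight y = (((g (P u))⁻¹ • g).smulRight y) * P * (f.smulRight u) := by
      ext x
      simp [hg]
    rw [this]
    exact hright _ _ (hleft _ _ hP)
  intro T
  let b := Module.finBasis ℂ V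
  have : T = ∑ i, (b.coord i).smulRight (T (b i)) := by
    refine b.ext fun j => ?_
    simp [Finsupp.single_apply]
  rw [this]
  exact sum_mem fun i _ => hrank _ _

end Burnside

/-! ### Homomorphisms of C*-algebras and the functional calculus -/

section Truncation

variable {A : Type*} [NonUnitalCStarAlgebra A]

/-- The function used to cut off the part of an element of norm larger than `r`. -/
noncomputable def truncFun (r x : ℝ) : ℝ := 1 - r / max r (Real.sqrt x)

theorem truncFun_zero {r : ℝ} (hr : 0 < r) : truncFun r 0 = 0 := by
  simp [truncFun, max_eq_left hr.le, hr.ne']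

theorem continuous_truncFun {r : ℝ} (hr : 0 < r) : Continuous (truncFun r) := by
  unfold truncFun
  refine continuous_const.sub (continuous_const.div (by fun_prop) fun x => ?_)
  exact (lt_max_of_lt_left hr).ne'

/-- The element `k` with `‖a - a k‖ ≤ r` which vanishes if `‖a‖ ≤ r`. -/
noncomputable def truncElem (r : ℝ) (a : A) : A := cfcₙ (truncFun r) (star a * a)

theorem quasispectrum_star_mul_self_le (a : A) {x : ℝ}
    (hx : x ∈ quasispectrum ℝ (star a * a)) : 0 ≤ x ∧ x ≤ ‖a‖ ^ 2 := by
  let _ := CStarAlgebra.spectralOrder A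
  let _ := CStarAlgebra.spectralOrderedRing A
  refine ⟨quasispectrum_nonneg_of_nonneg _ (star_mul_self_nonneg a) x hx, ?_⟩
  have := NonUnitalIsometricContinuousFunctionalCalculus.norm_quasispectrum_le (𝕜 := ℝ) (star a * a) hx
    (IsSelfAdjoint.star_mul_self a)
  rw [CStarRing.norm_star_mul_self, ← sq] at this
  exact (le_abs_self x).trans this

theorem truncElem_eq_zero {r : ℝ} (hr : 0 < r) {a : A} (ha : ‖a‖ ≤ r) : truncElem r a = 0 := by
  rw [truncElem, ← cfcₙ_zero ℝ (star a * a)]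
  refine cfcₙ_congr fun x hx => ?_
  have h := (quasispectrum_star_mul_self_le a hx).2
  have : Real.sqrt x ≤ r := by
    rw [Real.sqrt_le_left hr.le]
    exact h.trans (by gcongr)
  simp [truncFun, max_eq_left this, hr.ne']

/-- The element `(a - a k)* (a - a k)` is the function `t (r / max r √t) ^ 2` of `a* a`, and this
function is bounded by `r ^ 2`. -/
theorem norm_sub_mul_truncElem_le {r : ℝ} (hr : 0 < r) (a : A) :
    ‖a - a * truncElem r a‖ ≤ r := by
  set k := truncElem r a with hk
  set x := star a * a with hx
  have hxs : IsSelfAdjoint x := IsSelfAdjoint.star_mul_self a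
  have hks : star k = k := by
    have : IsSelfAdjoint k := cfcₙ_predicate (truncFun r) x
    exact this.star_eq
  have hcont : ContinuousOn (truncFun r) (quasispectrum ℝ x) := (continuous_truncFun hr).continuousOn
  have h0 := truncFun_zero hr
  have e : star (a - a * k) * (a - a * k) =
      cfcₙ (fun t => t - truncFun r t * t - (t * truncFun r t - truncFun r t * t * truncFun r t)) x := by
    have e1 : star (a - a * k) * (a - a * k) = x - k * x - (x * k - k * x * k) := by
      rw [star_sub, star_mul, hks, hx]
      noncomm_ring
    rw [e1, hk, truncElem]
    have c1 : cfcₙ (truncFun r) x * x = cfcₙ (fun t => truncFun r t * t) x := by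
      rw [cfcₙ_mul (truncFun r) (fun t => t) x hcont h0 continuousOn_id rfl, cfcₙ_id' ℝ x]
    have c2 : x * cfcₙ (truncFun r) x = cfcₙ (fun t => t * truncFun r t) x := by
      rw [cfcₙ_mul (fun t => t) (truncFun r) x continuousOn_id rfl hcont h0, cfcₙ_id' ℝ x]
    have c3 : cfcₙ (truncFun r) x * x * cfcₙ (truncFun r) x =
        cfcₙ (fun t => truncFun r t * t * truncFun r t) x := by
      rw [c1, ← cfcₙ_mul (fun t => truncFun r t * t) (truncFun r) x
        (hcont.mul continuousOn_id) (by simp) hcont h0]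
    rw [cfcₙ_sub (fun t => t - truncFun r t * t)
      (fun t => t * truncFun r t - truncFun r t * t * truncFun r t) x
      (continuousOn_id.sub (hcont.mul continuousOn_id)) (by simp)
      ((continuousOn_id.mul hcont).sub ((hcont.mul continuousOn_id).mul hcont)) (by simp),
      cfcₙ_sub (fun t => t) (fun t => truncFun r t * t) x continuousOn_id (by simp)
      (hcont.mul continuousOn_id) (by simp),
      cfcₙ_sub (fun t => t * truncFun r t) (fun t => truncFun r t * t * truncFun r t) x
      (continuousOn_id.mul hcont) (by simp) ((hcont.mul continuousOn_id).mul hcont) (by simp),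
      c1, c2, ← c3, c1, cfcₙ_id' ℝ x]
  have hb : ‖a - a * k‖ * ‖a - a * k‖ ≤ r * r := by
    rw [← CStarRing.norm_star_mul_self, e]
    refine norm_cfcₙ_le fun t ht => ?_
    have ht0 := (quasispectrum_star_mul_self_le a ht).1
    have hm : 0 < max r (Real.sqrt t) := lt_max_of_lt_left hr
    have e2 : t - truncFun r t * t - (t * truncFun r t - truncFun r t * t * truncFun r t) =
        t * (r / max r (Real.sqrt t)) ^ 2 := by
      unfold truncFun; ring
    rw [e2, Real.norm_of_nonneg (by positivity), div_pow, mul_div_assoc', div_le_iff₀ (by positivity)]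
    have : t ≤ max r (Real.sqrt t) ^ 2 := by
      calc t = Real.sqrt t ^ 2 := (Real.sq_sqrt ht0).symm
        _ ≤ _ := by gcongr; exact le_max_right _ _
    nlinarith [mul_pos hr hr]
  nlinarith [norm_nonneg (a - a * k)]

theorem NonUnitalStarAlgHom.continuous_of_cstar {B : Type*} [NonUnitalCStarAlgebra B]
    (φ : A →⋆ₙₐ[ℂ] B) : Continuous φ :=
  AddMonoidHomClass.continuous_of_bound φ 1 fun a => by
    rw [one_mul]; exact NonUnitalStarAlgHom.norm_apply_le φ a

theorem map_truncElem {B : Type*} [NonUnitalCStarAlgebra B] (φ : A →⋆ₙₐ[ℂ] B) {r : ℝ}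
    (hr : 0 < r) (a : A) : φ (truncElem r a) = truncElem r (φ a) := by
  unfold truncElem
  rw [φ.map_cfcₙ (truncFun r) (star a * a) (continuous_truncFun hr).continuousOn
    (truncFun_zero hr) φ.continuous_of_cstar (IsSelfAdjoint.star_mul_self a)
    (by rw [map_mul, map_star]; exact IsSelfAdjoint.star_mul_self _), map_mul, map_star]

/-- Where `k` vanishes, `a` agrees with `a - a k`, which has norm at most `r`. This turns a norm
inequality in a fibre into membership in an ideal, the language of the hull-kernel topology. -/
theorem map_truncElem_eq_zero_iff {B : Type*} [NonUnitalCStarAlgebra B] (φ : A →⋆ₙₐ[ℂ] B) {r : ℝ}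
    (hr : 0 < r) (a : A) : φ (truncElem r a) = 0 ↔ ‖φ a‖ ≤ r := by
  constructor
  · intro h
    have : φ a = φ (a - a * truncElem r a) := by rw [map_sub, map_mul, h, mul_zero, sub_zero]
    rw [this]
    exact (NonUnitalStarAlgHom.norm_apply_le φ _).trans (norm_sub_mul_truncElem_le hr a)
  · intro h
    rw [map_truncElem φ hr]
    exact truncElem_eq_zero hr h

/-- Elements in the range of a *-homomorphism have preimages of the same norm. -/
theorem exists_map_eq_norm_le {B : Type*} [NonUnitalCStarAlgebra B] (φ : A →⋆ₙₐ[ℂ] B) (a : A) :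
    ∃ a', φ a' = φ a ∧ ‖a'‖ ≤ ‖φ a‖ := by
  by_cases h : φ a = 0
  · exact ⟨0, by rw [h, map_zero], by simp⟩
  · have hr : 0 < ‖φ a‖ := norm_pos_iff.2 h
    refine ⟨a - a * truncElem ‖φ a‖ a, ?_, norm_sub_mul_truncElem_le hr a⟩
    rw [map_sub, map_mul, (map_truncElem_eq_zero_iff φ hr a).2 le_rfl, mul_zero, sub_zero]

end Truncation

/-! ### Coordinates with respect to a frame -/

section Coordinates

open scoped Matrix.Norms.L2Operator

open PrimitiveIdeal

variable {n : ℕ} {A : Type u} [NonUnitalCStarAlgebra A]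

namespace PrimitiveIdeal

theorem value_add (t : PrimitiveIdeal A) (a b : A) : value (a + b) t = value a t + value b t := rfl

theorem value_sub (t : PrimitiveIdeal A) (a b : A) : value (a - b) t = value a t - value b t := rfl

theorem value_smul (t : PrimitiveIdeal A) (c : ℂ) (a : A) : value (c • a) t = c • value a t := rfl

theorem value_zero (t : PrimitiveIdeal A) : value (0 : A) t = 0 := rfl

theorem value_surjective (t : PrimitiveIdeal A) : Function.Surjective fun a : A => value a t :=
  Submodule.mkQ_surjective _

theorem value_eq_zero_iff (t : PrimitiveIdeal A) (a : A) : value a t = 0 ↔ a ∈ t.toSubmodule :=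
  Submodule.Quotient.mk_eq_zero _

@[ext]
theorem ext {s t : PrimitiveIdeal A} (h : ∀ a, a ∈ s.toSubmodule ↔ a ∈ t.toSubmodule) : s = t := by
  cases s; cases t
  simp only [mk.injEq]
  exact Submodule.ext h

end PrimitiveIdeal

namespace FrameSpace

/-- The representation of `A` on `ℂⁿ` given by a frame. -/
noncomputable def coord (w : FrameSpace n A) : A →⋆ₙₐ[ℂ] Mat n where
  toFun a := w.frame.symm (value a w.base)
  map_smul' c a := by rw [value_smul, map_smul]; rfl
  map_zero' := by
    have : value (0 : A) w.base = (0 : ℂ) • value (0 : A) w.base := by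
      rw [← value_smul, zero_smul]
    rw [this, map_smul, zero_smul]
  map_add' a b := by rw [value_add, map_add]
  map_mul' a b := by rw [value_mul, map_mul]
  map_star' a := by rw [value_star, map_star]

theorem coord_def (w : FrameSpace n A) (a : A) : w.coord a = w.frame.symm (value a w.base) := rfl

theorem frame_coord (w : FrameSpace n A) (a : A) : w.frame (w.coord a) = value a w.base :=
  w.frame.apply_symm_apply _

theorem coord_surjective (w : FrameSpace n A) : Function.Surjective w.coord := fun x => by
  obtain ⟨a, ha⟩ := value_surjective w.base (w.frame x)
  exact ⟨a, by rw [coord_def]; simp only at ha; rw [ha]; exact w.frame.symm_apply_apply x⟩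

theorem coord_eq_zero_iff (w : FrameSpace n A) (a : A) :
    w.coord a = 0 ↔ a ∈ w.base.toSubmodule := by
  rw [← value_eq_zero_iff, ← frame_coord]
  constructor
  · intro h
    rw [h, ← map_zero w.coord, frame_coord, value_zero]
  · intro h
    refine EquivLike.injective w.frame ?_
    rw [h, ← map_zero w.coord, frame_coord, value_zero]

theorem coord_smul (w : FrameSpace n A) (g : AutMat n) (a : A) :
    (MulOpposite.op g • w).coord a = g.symm (w.coord a) := rfl

theorem base_smul (w : FrameSpace n A) (g : AutMat n) : (MulOpposite.op g • w).base = w.base := rfl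

theorem ext_coord {w w' : FrameSpace n A} (h : ∀ a, w.coord a = w'.coord a) : w = w' := by
  obtain ⟨t, φ⟩ := w
  obtain ⟨s, ψ⟩ := w'
  have hb : t = s := by
    ext a
    rw [← coord_eq_zero_iff ⟨t, φ⟩, ← coord_eq_zero_iff ⟨s, ψ⟩, h]
  subst hb
  have : φ.symm = ψ.symm := by
    refine StarAlgEquiv.ext fun y => ?_
    obtain ⟨a, rfl⟩ := value_surjective t y
    exact h a
  have : φ = ψ := by rw [← StarAlgEquiv.symm_symm φ, this, StarAlgEquiv.symm_symm]
  rw [this]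

/-- The automorphism `g` with `w' = w · g`, for two frames at the same point. -/
noncomputable def diff (w w' : FrameSpace n A) (h : w.base = w'.base) : AutMat n :=
  (h ▸ w'.frame : Mat n ≃⋆ₐ[ℂ] Fibre w.base).trans w.frame.symm

theorem diff_coord (w w' : FrameSpace n A) (h : w.base = w'.base) (a : A) :
    diff w w' h (w'.coord a) = w.coord a := by
  obtain ⟨t, φ⟩ := w
  obtain ⟨s, ψ⟩ := w'
  simp only at h
  subst h
  change φ.symm (ψ (ψ.symm (value a t))) = φ.symm (value a t)
  rw [StarAlgEquiv.apply_symm_apply]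

theorem smul_diff (w w' : FrameSpace n A) (h : w.base = w'.base) :
    MulOpposite.op (diff w w' h) • w = w' := by
  refine ext_coord fun a => ?_
  rw [coord_smul, ← diff_coord w w' h]
  exact StarAlgEquiv.symm_apply_apply _ _

theorem diff_eq_of_smul {w w' : FrameSpace n A} (h : w.base = w'.base) {g : AutMat n}
    (hg : MulOpposite.op g • w = w') : diff w w' h = g := by
  refine StarAlgEquiv.ext fun x => ?_
  obtain ⟨a, rfl⟩ := w'.coord_surjective x
  rw [diff_coord, ← hg, coord_smul]
  exact (StarAlgEquiv.apply_symm_apply _ _).symm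

/-- By truncation a matrix lifts to an element of `A` of no larger norm; conversely, representations
are contractive. In particular the quotient seminorm of a fibre is definite. -/
theorem norm_value (w : FrameSpace n A) (a : A) : ‖value a w.base‖ = ‖w.coord a‖ := by
  apply le_antisymm
  · obtain ⟨a', h1, h2⟩ := exists_map_eq_norm_le w.coord a
    have : value a w.base = value a' w.base := by rw [← frame_coord, ← h1, frame_coord]
    rw [this]
    exact (QuotientAddGroup.norm_mk_le_norm (S := w.base.toSubmodule.toAddSubgroup)).trans h2
  · refine le_of_forall_pos_le_add fun ε hε => ?_
    obtain ⟨a', h1, h2⟩ := QuotientAddGroup.norm_lt_iff.1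
      (show ‖(value a w.base : A ⧸ w.base.toSubmodule.toAddSubgroup)‖ < ‖value a w.base‖ + ε by
        exact lt_add_of_pos_right _ hε)
    have : value a' w.base = value a w.base := h1
    have h3 : w.coord a = w.coord a' := by rw [coord_def, ← this]; rfl
    rw [h3]
    exact (NonUnitalStarAlgHom.norm_apply_le _ _).trans h2.le

theorem norm_frame (w : FrameSpace n A) (x : Mat n) : ‖w.frame x‖ = ‖x‖ := by
  obtain ⟨a, rfl⟩ := w.coord_surjective x
  rw [frame_coord, norm_value]

theorem frame_sub (w : FrameSpace n A) (x y : Mat n) : w.frame (x - y) = w.frame x - w.frame y := by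
  obtain ⟨a, rfl⟩ := w.coord_surjective x
  obtain ⟨b, rfl⟩ := w.coord_surjective y
  rw [← map_sub, frame_coord, frame_coord, frame_coord, value_sub]

end FrameSpace

theorem AutMat.norm_map (g : AutMat n) (x : Mat n) : ‖g x‖ = ‖x‖ :=
  NonUnitalStarAlgHom.norm_map g g.injective x

end Coordinates

/-! ### Frames and representations on `ℂⁿ` -/

section Representations

open scoped Matrix.Norms.L2Operator InnerProductSpace

open PrimitiveIdeal

variable {n : ℕ} {A : Type u} [NonUnitalCStarAlgebra A]

/-- The matrices as operators on a Hilbert space with an orthonormal basis. -/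
noncomputable def matrixToOperator {H : Type*} [NormedAddCommGroup H] [InnerProductSpace ℂ H]
    [FiniteDimensional ℂ H] [CompleteSpace H] (b : OrthonormalBasis (Fin n) ℂ H) :
    Mat n ≃⋆ₐ[ℂ] (H →L[ℂ] H) :=
  (LinearMap.toMatrixOrthonormal b).symm.trans
    { LinearMap.toContinuousLinearMap with
      map_mul' := fun _ _ => rfl
      map_star' := LinearMap.adjoint_toContinuousLinearMap }

section Irreducible

variable {H : Type u} [NormedAddCommGroup H] [InnerProductSpace ℂ H] [CompleteSpace H]

/-- The restriction of a representation to a closed invariant subspace. -/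
noncomputable def restrictRep (π : A →⋆ₙₐ[ℂ] (H →L[ℂ] H)) (K : Submodule ℂ H) [CompleteSpace K]
    (hinv : ∀ a, ∀ v ∈ K, π a v ∈ K) : A →⋆ₙₐ[ℂ] (K →L[ℂ] K) where
  toFun a := ((π a).comp K.subtypeL).codRestrict K fun v => hinv a v v.2
  map_smul' c a := by
    ext v
    change π (c • a) v = c • π a v
    simp
  map_zero' := by
    ext v
    change π 0 v = 0
    simp
  map_add' a b := by
    ext v
    change π (a + b) v = π a v + π b v
    simp
  map_mul' a b := by
    ext v
    change π (a * b) v = π a (π b v)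
    simp
  map_star' a := by
    rw [ContinuousLinearMap.star_eq_adjoint, ContinuousLinearMap.eq_adjoint_iff]
    intro x y
    rw [Submodule.coe_inner, Submodule.coe_inner]
    change ⟪π (star a) x, (y : H)⟫_ℂ = ⟪(x : H), π a y⟫_ℂ
    rw [map_star, ContinuousLinearMap.star_eq_adjoint, ContinuousLinearMap.adjoint_inner_left]

/-- If `A` acts by zero on an invariant subspace, the orthogonal complement is invariant and still
carries a nonzero action, so it is the whole space. -/
theorem isIrreducibleRep_of_minimal [FiniteDimensional ℂ H] (π : A →⋆ₙₐ[ℂ] (H →L[ℂ] H))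
    (hπ : ∃ a v, π a v ≠ 0)
    (hmin : ∀ K : Submodule ℂ H, (∀ a, ∀ v ∈ K, π a v ∈ K) → (∃ a, ∃ v ∈ K, π a v ≠ 0) → K = ⊤) :
    IsIrreducibleRep π := by
  obtain ⟨a₀, v₀, h₀⟩ := hπ
  refine ⟨fun h => h₀ (by simp [h]), fun K _ hinv => ?_⟩
  by_cases h : ∃ a, ∃ v ∈ K, π a v ≠ 0
  · exact Or.inr (hmin K hinv h)
  push Not at h
  left
  have hinv' : ∀ a, ∀ v ∈ Kᗮ, π a v ∈ Kᗮ := by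
    intro a v hv
    rw [Submodule.mem_orthogonal] at hv ⊢
    intro u hu
    rw [← ContinuousLinearMap.adjoint_inner_left, ← ContinuousLinearMap.star_eq_adjoint,
      ← map_star]
    exact hv _ (hinv _ _ hu)
  have : Kᗮ = ⊤ := by
    refine hmin _ hinv' ?_
    refine ⟨a₀, v₀ - K.starProjection v₀, K.sub_starProjection_mem_orthogonal v₀, ?_⟩
    rw [map_sub, h a₀ (K.starProjection v₀) (by simp), sub_zero]
    exact h₀
  exact (Submodule.orthogonal_eq_top_iff K).1 this

/-- All nonzero `n`-dimensional representations of an `n`-homogeneous C*-algebra are irreducible. -/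
theorem IsHomogeneous.isIrreducibleRep (hA : IsHomogeneous n A) [FiniteDimensional ℂ H]
    (hH : Module.finrank ℂ H = n) (π : A →⋆ₙₐ[ℂ] (H →L[ℂ] H)) (hπ : ∃ a v, π a v ≠ 0) :
    IsIrreducibleRep π := by
  let S : Set (Submodule ℂ H) :=
    {K | (∀ a, ∀ v ∈ K, π a v ∈ K) ∧ ∃ a, ∃ v ∈ K, π a v ≠ 0}
  have hS : S.Nonempty := by
    obtain ⟨a, v, h⟩ := hπ
    exact ⟨⊤, fun _ _ _ => Submodule.mem_top, a, v, Submodule.mem_top, h⟩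
  -- The restriction to a minimal invariant subspace with nonzero action is irreducible, hence of
  -- dimension `n` by homogeneity: the subspace is everything.
  obtain ⟨K, ⟨hinv, a₀, v₀, hv₀, h₀⟩, hmin⟩ := WellFounded.has_min (wellFounded_lt) S hS
  have hirr : IsIrreducibleRep (restrictRep π K hinv) := by
    refine isIrreducibleRep_of_minimal _ ⟨a₀, ⟨v₀, hv₀⟩, fun h => h₀ ?_⟩ ?_
    · exact congrArg Subtype.val h
    · rintro K' hK' ⟨a, v, hv, hav⟩
      have hmem : K'.map K.subtype ∈ S := by
        refine ⟨?_, a, v, Submodule.mem_map_of_mem hv, fun h => hav (Subtype.ext h)⟩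
        rintro b _ ⟨x, hx, rfl⟩
        exact ⟨_, hK' b x hx, rfl⟩
      have hle : K'.map K.subtype ≤ K := Submodule.map_subtype_le K K'
      have heq : K'.map K.subtype = K := hle.eq_of_not_lt (hmin _ hmem)
      rw [eq_top_iff]
      rintro ⟨x, hx⟩ -
      rw [← heq] at hx
      obtain ⟨y, hy, rfl⟩ := hx
      exact hy
  have htop : K = ⊤ := Submodule.eq_top_of_finrank_eq ((hA K _ hirr).trans hH.symm)
  refine isIrreducibleRep_of_minimal π hπ fun K' h1 h2 => ?_
  by_contra hne
  exact hmin K' ⟨h1, h2⟩ (htop ▸ lt_top_iff_ne_top.2 hne)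

/-- Burnside's theorem for the image; all subspaces are closed in finite dimension. -/
theorem IsIrreducibleRep.surjective [FiniteDimensional ℂ H] {π : A →⋆ₙₐ[ℂ] (H →L[ℂ] H)}
    (hπ : IsIrreducibleRep π) : Function.Surjective π := by
  obtain ⟨a₀, ha₀⟩ : ∃ a, π a ≠ 0 := by
    by_contra! h
    exact hπ.1 (NonUnitalStarAlgHom.ext h)
  let S : NonUnitalSubalgebra ℂ (Module.End ℂ H) :=
    { carrier := {T | ∃ a, (π a : H →ₗ[ℂ] H) = T}
      add_mem' := by rintro _ _ ⟨a, rfl⟩ ⟨b, rfl⟩; exact ⟨a + b, by simp⟩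
      zero_mem' := ⟨0, by simp⟩
      mul_mem' := by rintro _ _ ⟨a, rfl⟩ ⟨b, rfl⟩; exact ⟨a * b, by rw [map_mul]; rfl⟩
      smul_mem' := by rintro c _ ⟨a, rfl⟩; exact ⟨c • a, by simp⟩ }
  intro T
  obtain ⟨a, ha⟩ := NonUnitalSubalgebra.eq_top_of_irreducible S (P := (π a₀ : H →ₗ[ℂ] H))
    ⟨a₀, rfl⟩ (fun h => ha₀ (ContinuousLinearMap.coe_injective (by simpa using h))) (fun K hK =>
      hπ.2 K (Submodule.closed_of_finiteDimensional K) fun a v hv => hK _ ⟨a, rfl⟩ v hv)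
    (T : H →ₗ[ℂ] H)
  exact ⟨a, ContinuousLinearMap.coe_injective ha⟩

end Irreducible

namespace FrameSpace

/-- The frame at `t` given by a homomorphism of `A` onto `M_n` with kernel `t`. -/
noncomputable def ofHom (t : PrimitiveIdeal A) (ρ : A →⋆ₙₐ[ℂ] Mat n)
    (hs : Function.Surjective ρ) (hk : ∀ a, a ∈ t.toSubmodule ↔ ρ a = 0) : FrameSpace n A where
  base := t
  frame := StarAlgEquiv.symm
    { toFun := t.toSubmodule.liftQ
        (ρ : A →ₗ[ℂ] Mat n) (fun a ha => (hk a).1 ha)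
      invFun := fun x => value (Function.surjInv hs x) t
      left_inv := by
        intro y
        obtain ⟨a, rfl⟩ := value_surjective t y
        change value (Function.surjInv hs (ρ a)) t = value a t
        rw [← sub_eq_zero, ← value_sub, value_eq_zero_iff, hk, map_sub, Function.surjInv_eq hs, sub_self]
      right_inv := fun x => Function.surjInv_eq hs x
      map_mul' := by
        intro x y
        obtain ⟨a, rfl⟩ := value_surjective t x
        obtain ⟨b, rfl⟩ := value_surjective t y
        exact map_mul ρ a b
      map_add' := by
        intro x y
        obtain ⟨a, rfl⟩ := value_surjective t x
        obtain ⟨b, rfl⟩ := value_surjective t y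
        exact map_add ρ a b
      map_star' := by
        intro x
        obtain ⟨a, rfl⟩ := value_surjective t x
        exact map_star ρ a
      map_smul' := by
        intro c x
        obtain ⟨a, rfl⟩ := value_surjective t x
        exact map_smul ρ c a }

end FrameSpace

/-- Every fibre of the bundle of an `n`-homogeneous C*-algebra has a frame. -/
theorem IsHomogeneous.exists_frame (hn : 1 ≤ n) (hA : IsHomogeneous n A) (t : PrimitiveIdeal A) :
    ∃ w : FrameSpace n A, w.base = t := by
  obtain ⟨H, _, _, _, π, hπ, hk⟩ := t.exists_rep
  have hH := hA H π hπ
  have : FiniteDimensional ℂ H := Module.finite_of_finrank_pos (by omega)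
  let b : OrthonormalBasis (Fin n) ℂ H := (stdOrthonormalBasis ℂ H).reindex (finCongr hH)
  let ρ : A →⋆ₙₐ[ℂ] Mat n :=
    ((matrixToOperator b).symm : (H →L[ℂ] H) →⋆ₙₐ[ℂ] Mat n).comp π
  have hρ : ∀ a, ρ a = (matrixToOperator b).symm (π a) := fun _ => rfl
  refine ⟨FrameSpace.ofHom t ρ ?_ ?_, rfl⟩
  · intro x
    obtain ⟨a, ha⟩ := hπ.surjective (matrixToOperator b x)
    exact ⟨a, by rw [hρ, ha, StarAlgEquiv.symm_apply_apply]⟩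
  · intro a
    rw [hk, hρ]
    constructor
    · intro h; rw [h, map_zero]
    · intro h
      rw [← StarAlgEquiv.apply_symm_apply (matrixToOperator b) (π a), h, map_zero]

/-- Every nonzero homomorphism of an `n`-homogeneous C*-algebra to `M_n` comes from a frame. -/
theorem IsHomogeneous.exists_frame_of_hom (hA : IsHomogeneous n A) (ρ : A →⋆ₙₐ[ℂ] Mat n)
    {a₀ : A} (h₀ : ρ a₀ ≠ 0) : ∃ w : FrameSpace n A, ∀ a, w.coord a = ρ a := by
  -- The lift places `ℂⁿ` in the universe of `A`, the only one over which homogeneity quantifies.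
  let H := EuclideanSpace ℂ (ULift.{u} (Fin n))
  have hH : Module.finrank ℂ H = n := by simp [H]
  let b : OrthonormalBasis (Fin n) ℂ H :=
    (EuclideanSpace.basisFun (ULift.{u} (Fin n)) ℂ).reindex Equiv.ulift
  let π : A →⋆ₙₐ[ℂ] (H →L[ℂ] H) := (matrixToOperator b : Mat n →⋆ₙₐ[ℂ] (H →L[ℂ] H)).comp ρ
  have hπ : ∀ a, π a = matrixToOperator b (ρ a) := fun _ => rfl
  have hπ0 : ∀ a, π a = 0 ↔ ρ a = 0 := by
    intro a
    rw [hπ]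
    constructor
    · intro h
      rw [← StarAlgEquiv.symm_apply_apply (matrixToOperator b) (ρ a), h, map_zero]
    · intro h; rw [h, map_zero]
  have hirr : IsIrreducibleRep π := by
    refine hA.isIrreducibleRep hH π ?_
    by_contra! h
    exact h₀ ((hπ0 a₀).1 (ContinuousLinearMap.ext (h a₀)))
  let t : PrimitiveIdeal A :=
    { toSubmodule := LinearMap.ker (ρ : A →ₗ[ℂ] Mat n)
      exists_rep := ⟨H, inferInstance, inferInstance, inferInstance, π, hirr, fun a => by
        rw [hπ0]; exact LinearMap.mem_ker⟩ }
  refine ⟨FrameSpace.ofHom t ρ ?_ fun a => LinearMap.mem_ker, fun a => rfl⟩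
  intro x
  obtain ⟨a, ha⟩ := hirr.surjective (matrixToOperator b x)
  exact ⟨a, EquivLike.injective (matrixToOperator b) ha⟩

end Representations

/-! ### The topology of the frame space and of the primitive ideal space -/

section FrameTopology

open scoped Matrix.Norms.L2Operator

open PrimitiveIdeal Filter

variable {n : ℕ} {A : Type u} [NonUnitalCStarAlgebra A]

theorem Matrix.mul_single_mul_apply (x y : Mat n) (i j k l : Fin n) :
    (x * (Matrix.single j k (1 : ℂ) : Mat n) * y : Mat n) i l = x i j * y k l := by
  rw [Matrix.mul_assoc, Matrix.mul_apply, Finset.sum_eq_single j]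
  · simp
  · intro m _ hm
    simp [Matrix.mul_apply, hm.symm]
  · simp

namespace FrameSpace

theorem continuous_toBundle (x : Mat n) :
    Continuous fun w : FrameSpace n A => w.toBundle x :=
  (continuous_apply x).comp
    (continuous_induced_dom (f := fun (w : FrameSpace n A) (x : Mat n) => w.toBundle x))

theorem continuous_coord (a : A) : Continuous fun w : FrameSpace n A => w.coord a := by
  rw [continuous_iff_continuousAt]
  intro w
  rw [ContinuousAt, Metric.tendsto_nhds]
  intro ε hε
  have hopen : IsOpen (BundleSpace.tube a Set.univ ε) :=
    TopologicalSpace.isOpen_generateFrom_of_mem ⟨a, Set.univ, ε, isOpen_univ, hε, rfl⟩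
  have hmem : w.toBundle (w.coord a) ∈ BundleSpace.tube a Set.univ ε := by
    refine ⟨trivial, ?_⟩
    change ‖w.frame (w.coord a) - value a w.base‖ < ε
    rw [frame_coord, sub_self, norm_zero]
    exact hε
  filter_upwards [(continuous_toBundle (w.coord a)).continuousAt.preimage_mem_nhds
    (hopen.mem_nhds hmem)] with v hv
  have h2 : ‖v.frame (w.coord a) - value a v.base‖ < ε := hv.2
  rw [← frame_coord, ← frame_sub, norm_frame] at h2
  rwa [dist_comm, dist_eq_norm]

/-- Frames are isometric, so a tube condition on `w.toBundle x` is a condition on the base point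
together with `‖x - w.coord a‖ < ε`; the base point itself depends continuously on the matrices
`w.coord a`. From here on, convergence of frames means convergence of representations. -/
theorem isInducing_coord :
    IsInducing fun (w : FrameSpace n A) (a : A) => w.coord a := by
  refine ⟨le_antisymm ?_ ?_⟩
  · exact (continuous_pi continuous_coord).le_induced
  · let τ : TopologicalSpace (FrameSpace n A) :=
      TopologicalSpace.induced (fun (w : FrameSpace n A) (a : A) => w.coord a) inferInstance
    have hc : ∀ a : A, @Continuous _ _ τ _ fun w : FrameSpace n A => w.coord a := fun a =>
      (continuous_apply a).comp continuous_induced_dom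
    have hb : @Continuous _ _ τ _ (FrameSpace.base : FrameSpace n A → PrimitiveIdeal A) := by
      rw [continuous_generateFrom_iff]
      rintro _ ⟨a, rfl⟩
      have : FrameSpace.base ⁻¹' {t : PrimitiveIdeal A | a ∉ t.toSubmodule} =
          (fun w : FrameSpace n A => w.coord a) ⁻¹' {0}ᶜ := by
        ext w
        simp [coord_eq_zero_iff]
      rw [this]
      exact isOpen_compl_singleton.preimage (hc a)
    refine continuous_iff_le_induced.1 (continuous_pi fun x => ?_)
    rw [continuous_generateFrom_iff]
    rintro _ ⟨a, U, ε, hU, hε, rfl⟩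
    have : (fun w : FrameSpace n A => w.toBundle x) ⁻¹' BundleSpace.tube a U ε =
        FrameSpace.base ⁻¹' U ∩ (fun w : FrameSpace n A => ‖x - w.coord a‖) ⁻¹' Set.Iio ε := by
      ext w
      change (w.base ∈ U ∧ ‖w.frame x - value a w.base‖ < ε) ↔ w.base ∈ U ∧ ‖x - w.coord a‖ < ε
      rw [← frame_coord, ← frame_sub, norm_frame]
    rw [this]
    exact (hU.preimage hb).inter (isOpen_Iio.preimage (continuous_const.sub (hc a)).norm)

theorem continuous_base : Continuous (FrameSpace.base : FrameSpace n A → PrimitiveIdeal A) := by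
  rw [continuous_generateFrom_iff]
  rintro _ ⟨a, rfl⟩
  have : FrameSpace.base ⁻¹' {t : PrimitiveIdeal A | a ∉ t.toSubmodule} =
      (fun w : FrameSpace n A => w.coord a) ⁻¹' {0}ᶜ := by
    ext w
    simp [coord_eq_zero_iff]
  rw [this]
  exact isOpen_compl_singleton.preimage (continuous_coord a)

theorem tendsto_nhds_iff {ι : Type*} {l : Filter ι} {f : ι → FrameSpace n A} {w : FrameSpace n A} :
    Tendsto f l (𝓝 w) ↔ ∀ a, Tendsto (fun i => (f i).coord a) l (𝓝 (w.coord a)) := by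
  rw [isInducing_coord.tendsto_nhds_iff, tendsto_pi_nhds]
  rfl

end FrameSpace

namespace AutMat

theorem tendsto_nhds_iff {ι : Type*} {l : Filter ι} {f : ι → AutMat n} {g : AutMat n} :
    Tendsto f l (𝓝 g) ↔ ∀ x, Tendsto (fun i => f i x) l (𝓝 (g x)) := by
  have : IsInducing fun (g : AutMat n) (x : Mat n) => g x := ⟨rfl⟩
  rw [this.tendsto_nhds_iff, tendsto_pi_nhds]
  rfl

theorem norm_symm (g : AutMat n) (x : Mat n) : ‖g.symm x‖ = ‖x‖ := norm_map g.symm x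

/-- Automorphisms are isometric, so errors can be measured after applying `f i`, and continuity of
inversion costs nothing. -/
theorem tendsto_symm_apply {ι : Type*} {l : Filter ι} {f : ι → AutMat n} {g : AutMat n}
    (hf : Tendsto f l (𝓝 g)) {x : ι → Mat n} {x₀ : Mat n} (hx : Tendsto x l (𝓝 x₀)) :
    Tendsto (fun i => (f i).symm (x i)) l (𝓝 (g.symm x₀)) := by
  rw [tendsto_iff_norm_sub_tendsto_zero]
  have h1 : Tendsto (fun i => ‖x i - x₀‖ + ‖f i (g.symm x₀) - x₀‖) l (𝓝 0) := by
    have a1 := tendsto_iff_norm_sub_tendsto_zero.1 hx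
    have a2 := tendsto_iff_norm_sub_tendsto_zero.1 (tendsto_nhds_iff.1 hf (g.symm x₀))
    rw [StarAlgEquiv.apply_symm_apply] at a2
    simpa using a1.add a2
  refine squeeze_zero (fun _ => norm_nonneg _) (fun i => ?_) h1
  have e : (f i).symm (x i) - g.symm x₀ =
      (f i).symm (x i - x₀) - (f i).symm (f i (g.symm x₀) - x₀) := by
    rw [map_sub, map_sub, StarAlgEquiv.symm_apply_apply]; abel
  rw [e]
  refine (norm_sub_le _ _).trans ?_
  rw [norm_symm, norm_symm]

end AutMat

namespace FrameSpace

theorem tendsto_smul {ι : Type*} {l : Filter ι} {f : ι → AutMat n} {g : AutMat n}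
    (hf : Tendsto f l (𝓝 g)) {w : ι → FrameSpace n A} {w₀ : FrameSpace n A}
    (hw : Tendsto w l (𝓝 w₀)) :
    Tendsto (fun i => MulOpposite.op (f i) • w i) l (𝓝 (MulOpposite.op g • w₀)) := by
  rw [tendsto_nhds_iff]
  intro a
  simp only [coord_smul]
  exact AutMat.tendsto_symm_apply hf (tendsto_nhds_iff.1 hw a)

/-- The automorphism carries the matrices of `w' i` to those of `w i`, and the limit frame reaches
every matrix. This is continuity of the translation function of the frame bundle. -/
theorem tendsto_of_smul_eq {ι : Type*} {l : Filter ι} {w w' : ι → FrameSpace n A}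
    {w₀ w₀' : FrameSpace n A} {g : ι → AutMat n} {g₀ : AutMat n} (hw : Tendsto w l (𝓝 w₀))
    (hw' : Tendsto w' l (𝓝 w₀')) (h : ∀ᶠ i in l, MulOpposite.op (g i) • w i = w' i)
    (h₀ : MulOpposite.op g₀ • w₀ = w₀') : Tendsto g l (𝓝 g₀) := by
  rw [AutMat.tendsto_nhds_iff]
  intro x
  obtain ⟨a, rfl⟩ := w₀'.coord_surjective x
  have e₀ : g₀ (w₀'.coord a) = w₀.coord a := by
    rw [← h₀, coord_smul, StarAlgEquiv.apply_symm_apply]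
  rw [e₀, tendsto_iff_norm_sub_tendsto_zero]
  have a1 := tendsto_iff_norm_sub_tendsto_zero.1 (tendsto_nhds_iff.1 hw a)
  have a2 := tendsto_iff_norm_sub_tendsto_zero.1 (tendsto_nhds_iff.1 hw' a)
  have h1 : Tendsto (fun i => ‖(w' i).coord a - w₀'.coord a‖ + ‖(w i).coord a - w₀.coord a‖) l
      (𝓝 0) := by simpa using a2.add a1
  refine squeeze_zero' (Eventually.of_forall fun _ => norm_nonneg _) ?_ h1
  filter_upwards [h] with i hi
  have e1 : g i ((w' i).coord a) = (w i).coord a := by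
    rw [← hi, coord_smul, StarAlgEquiv.apply_symm_apply]
  have e : g i (w₀'.coord a) - w₀.coord a =
      ((w i).coord a - w₀.coord a) - g i ((w' i).coord a - w₀'.coord a) := by
    rw [map_sub, e1]; abel
  rw [e]
  refine (norm_sub_le _ _).trans ?_
  rw [AutMat.norm_map, add_comm]

/-- Limits of representations along an ultrafilter. -/
theorem exists_ultralimit {ι : Type*} (𝒰 : Ultrafilter ι) (w : ι → FrameSpace n A) :
    ∃ ρ : A →⋆ₙₐ[ℂ] Mat n, ∀ a, Tendsto (fun i => (w i).coord a) 𝒰 (𝓝 (ρ a)) := by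
  have hlim : ∀ a : A, ∃ x : Mat n, Tendsto (fun i => (w i).coord a) 𝒰 (𝓝 x) := by
    intro a
    have : ProperSpace (Mat n) := FiniteDimensional.proper ℂ (Mat n)
    obtain ⟨x, -, hx⟩ := (isCompact_closedBall (0 : Mat n) ‖a‖).ultrafilter_le_nhds
      (𝒰.map fun i => (w i).coord a) (by
        rw [Filter.le_principal_iff, Ultrafilter.mem_coe, Ultrafilter.mem_map]
        refine Filter.univ_mem' fun i => ?_
        simpa using NonUnitalStarAlgHom.norm_apply_le (w i).coord a)
    exact ⟨x, hx⟩
  choose ρ hρ using hlim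
  refine ⟨{ toFun := ρ
            map_smul' := fun c a => ?_
            map_zero' := ?_
            map_add' := fun a b => ?_
            map_mul' := fun a b => ?_
            map_star' := fun a => ?_ }, hρ⟩
  · refine tendsto_nhds_unique (hρ (c • a)) ?_
    simpa using (hρ a).const_smul c
  · refine tendsto_nhds_unique (hρ 0) ?_
    simp
  · refine tendsto_nhds_unique (hρ (a + b)) ?_
    simpa using (hρ a).add (hρ b)
  · refine tendsto_nhds_unique (hρ (a * b)) ?_
    simpa using (hρ a).mul (hρ b)
  · refine tendsto_nhds_unique (hρ (star a)) ?_
    simpa [map_star] using (hρ a).star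

/-- An inclusion of kernels induces a surjection of `M_n` onto `M_n`, which is injective by
dimension. Primitive ideals are therefore incomparable. -/
theorem base_eq_of_le {w w' : FrameSpace n A} (h : w.base.toSubmodule ≤ w'.base.toSubmodule) :
    w.base = w'.base := by
  refine PrimitiveIdeal.ext fun a => ⟨fun ha => h ha, fun ha => ?_⟩
  let L : A →ₗ[ℂ] Mat n := (w.coord : A →ₗ[ℂ] Mat n)
  let L' : A →ₗ[ℂ] Mat n := (w'.coord : A →ₗ[ℂ] Mat n)
  have hL : Function.Surjective L := w.coord_surjective
  have hL' : Function.Surjective L' := w'.coord_surjective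
  have hle : LinearMap.ker L ≤ LinearMap.ker L' := fun x hx =>
    (coord_eq_zero_iff w' x).2 (h ((coord_eq_zero_iff w x).1 hx))
  let e := L.quotKerEquivOfSurjective hL
  let F : Mat n →ₗ[ℂ] Mat n := ((LinearMap.ker L).liftQ L' hle).comp e.symm.toLinearMap
  have hF : ∀ x, F (L x) = L' x := by
    intro x
    have : e.symm (L x) = (LinearMap.ker L).mkQ x := by
      rw [LinearEquiv.symm_apply_eq]; rfl
    simp only [F, LinearMap.comp_apply, LinearEquiv.coe_coe, this]
    rfl
  have hsurj : Function.Surjective F := fun y => by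
    obtain ⟨x, rfl⟩ := hL' y
    exact ⟨L x, hF x⟩
  have hinj := LinearMap.injective_iff_surjective.2 hsurj
  rw [← coord_eq_zero_iff]
  apply hinj
  rw [map_zero]
  exact (hF a).trans ((coord_eq_zero_iff w' a).2 ha)

end FrameSpace

theorem eq_zero_of_forall_value {a : A} (h : ∀ t : PrimitiveIdeal A, value a t = 0) : a = 0 := by
  by_contra ha
  obtain ⟨H, _, _, _, π, hπ, hπa⟩ := exists_isIrreducibleRep_apply_ne_zero ha
  let t : PrimitiveIdeal A :=
    { toSubmodule := LinearMap.ker (π : A →ₗ[ℂ] (H →L[ℂ] H))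
      exists_rep := ⟨H, _, _, _, π, hπ, fun _ => LinearMap.mem_ker⟩ }
  exact hπa ((value_eq_zero_iff t a).1 (h t))

theorem eq_of_forall_value {a b : A} (h : ∀ t : PrimitiveIdeal A, value a t = value b t) :
    a = b := by
  rw [← sub_eq_zero]
  refine eq_zero_of_forall_value fun t => ?_
  rw [value_sub, h, sub_self]

/-! ### Limits of frames, continuity of norms and compactness in the primitive ideal space -/

variable (hn : 1 ≤ n) (hA : IsHomogeneous n A)

include hn hA

theorem norm_value_pos_iff (t : PrimitiveIdeal A) (a : A) :
    0 < ‖value a t‖ ↔ a ∉ t.toSubmodule := by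
  obtain ⟨w, rfl⟩ := hA.exists_frame hn t
  rw [FrameSpace.norm_value, norm_pos_iff, ne_eq, FrameSpace.coord_eq_zero_iff]

/-- By truncation this set is a subbasic open set of the hull-kernel topology. -/
theorem isOpen_lt_norm_value (a : A) {r : ℝ} (hr : 0 < r) :
    IsOpen {t : PrimitiveIdeal A | r < ‖value a t‖} := by
  have : {t : PrimitiveIdeal A | r < ‖value a t‖} =
      {t | truncElem r a ∉ t.toSubmodule} := by
    ext t
    obtain ⟨w, rfl⟩ := hA.exists_frame hn t
    change r < ‖value a w.base‖ ↔ truncElem r a ∉ w.base.toSubmodule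
    rw [FrameSpace.norm_value, ← FrameSpace.coord_eq_zero_iff, map_truncElem_eq_zero_iff _ hr,
      not_le]
  rw [this]
  exact TopologicalSpace.isOpen_generateFrom_of_mem ⟨_, rfl⟩

theorem exists_notMem (t : PrimitiveIdeal A) : ∃ a, a ∉ t.toSubmodule := by
  obtain ⟨w, rfl⟩ := hA.exists_frame hn t
  have : Nonempty (Fin n) := ⟨⟨0, hn⟩⟩
  obtain ⟨a, ha⟩ := w.coord_surjective 1
  exact ⟨a, by rw [← FrameSpace.coord_eq_zero_iff, ha]; exact one_ne_zero⟩

/-- Lower semicontinuity of the norms forces the kernel of the ultralimit representation into `t`.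
The limit is therefore nonzero, comes from a frame by homogeneity, and lies over `t` because
primitive ideals are incomparable. -/
theorem FrameSpace.exists_tendsto {ι : Type*} (𝒰 : Ultrafilter ι) (w : ι → FrameSpace n A)
    {t : PrimitiveIdeal A} (h : Tendsto (fun i => (w i).base) 𝒰 (𝓝 t)) :
    ∃ w₀ : FrameSpace n A, w₀.base = t ∧ Tendsto w 𝒰 (𝓝 w₀) := by
  obtain ⟨ρ, hρ⟩ := exists_ultralimit 𝒰 w
  have hker : ∀ b, ρ b = 0 → b ∈ t.toSubmodule := by
    intro b hb
    by_contra hbt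
    have hpos := (norm_value_pos_iff hn hA t b).2 hbt
    have h1 : ∀ᶠ i in (𝒰 : Filter ι), ‖value b t‖ / 2 < ‖(w i).coord b‖ := by
      have := h.eventually ((isOpen_lt_norm_value hn hA b (half_pos hpos)).mem_nhds
        (show t ∈ {s : PrimitiveIdeal A | ‖value b t‖ / 2 < ‖value b s‖} from half_lt_self hpos))
      filter_upwards [this] with i hi
      rw [← norm_value]
      exact hi
    have h2 := (hρ b).norm
    rw [hb, norm_zero] at h2
    have h3 := ge_of_tendsto h2 (h1.mono fun i hi => hi.le)
    linarith
  obtain ⟨a₀, ha₀⟩ := exists_notMem hn hA t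
  obtain ⟨w₁, hw₁⟩ := hA.exists_frame_of_hom ρ (a₀ := a₀) fun h => ha₀ (hker _ h)
  obtain ⟨w₂, hw₂⟩ := hA.exists_frame hn t
  have hbase : w₁.base = w₂.base := base_eq_of_le fun b hb => by
    rw [hw₂]
    exact hker b (by rw [← hw₁]; exact (coord_eq_zero_iff w₁ b).2 hb)
  refine ⟨w₁, hbase.trans hw₂, ?_⟩
  rw [tendsto_nhds_iff]
  intro a
  rw [hw₁]
  exact hρ a

/-- Along an ultrafilter the frames converge to a frame over the limit point, and the matrix norms
converge with them. -/
theorem continuous_norm_value (a : A) : Continuous fun t : PrimitiveIdeal A => ‖value a t‖ := by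
  rw [continuous_iff_ultrafilter]
  intro t 𝒰 h𝒰
  choose w hw using hA.exists_frame hn
  obtain ⟨w₀, rfl, hw₀⟩ := FrameSpace.exists_tendsto hn hA 𝒰 w (t := t) (by
    simp only [hw]; exact h𝒰)
  rw [FrameSpace.norm_value]
  have : (fun t => ‖value a t‖) = fun t => ‖(w t).coord a‖ := by
    funext t
    conv_lhs => rw [← hw t]
    rw [FrameSpace.norm_value]
  rw [this]
  exact (FrameSpace.tendsto_nhds_iff.1 hw₀ a).norm

/-- The bound `ε ≤ ‖ρ a‖` keeps the ultralimit representation nonzero, so it comes from a frame,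
whose base point is the required limit. -/
theorem isCompact_le_norm_value (a : A) {ε : ℝ} (hε : 0 < ε) :
    IsCompact {t : PrimitiveIdeal A | ε ≤ ‖value a t‖} := by
  rw [isCompact_iff_ultrafilter_le_nhds]
  intro 𝒰 h𝒰
  rw [Filter.le_principal_iff] at h𝒰
  choose w hw using hA.exists_frame hn
  obtain ⟨ρ, hρ⟩ := FrameSpace.exists_ultralimit 𝒰 w
  have h1 : ε ≤ ‖ρ a‖ := by
    refine ge_of_tendsto (hρ a).norm ?_
    filter_upwards [h𝒰] with t ht
    rw [← FrameSpace.norm_value, hw]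
    exact ht
  have h2 : ρ a ≠ 0 := norm_pos_iff.1 (hε.trans_le h1)
  obtain ⟨w₀, hw₀⟩ := hA.exists_frame_of_hom ρ h2
  refine ⟨w₀.base, ?_, ?_⟩
  · change ε ≤ ‖value a w₀.base‖
    rw [FrameSpace.norm_value, hw₀]
    exact h1
  · have h3 : Tendsto w 𝒰 (𝓝 w₀) := FrameSpace.tendsto_nhds_iff.2 fun b => by
      rw [hw₀]; exact hρ b
    have h4 := (FrameSpace.continuous_base.tendsto w₀).comp h3
    have : FrameSpace.base ∘ w = id := funext hw
    rw [this] at h4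
    exact h4

theorem exists_mul_mul_notMem (t : PrimitiveIdeal A) {a b : A} (ha : a ∉ t.toSubmodule)
    (hb : b ∉ t.toSubmodule) : ∃ x, a * x * b ∉ t.toSubmodule := by
  obtain ⟨w, rfl⟩ := hA.exists_frame hn t
  rw [← FrameSpace.coord_eq_zero_iff] at ha hb
  obtain ⟨i, j, hij⟩ : ∃ i j, w.coord a i j ≠ 0 := by
    by_contra! h; exact ha (Matrix.ext h)
  obtain ⟨k, l, hkl⟩ : ∃ i j, w.coord b i j ≠ 0 := by
    by_contra! h; exact hb (Matrix.ext h)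
  obtain ⟨x, hx⟩ := w.coord_surjective (Matrix.single j k 1)
  refine ⟨x, ?_⟩
  rw [← FrameSpace.coord_eq_zero_iff, map_mul, map_mul, hx]
  intro h
  have := congrFun (congrFun h i) l
  rw [Matrix.mul_single_mul_apply] at this
  exact (mul_ne_zero hij hkl) this

/-- Only intersections need an idea: `c x d` lies in every ideal containing `c` or `d`, and
primeness of `M_n` provides an `x` for which it stays outside `t`. -/
theorem exists_notMem_of_isOpen {V : Set (PrimitiveIdeal A)} (hV : IsOpen V)
    {t : PrimitiveIdeal A} (ht : t ∈ V) :
    ∃ c, c ∉ t.toSubmodule ∧ ∀ s ∉ V, c ∈ s.toSubmodule := by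
  induction hV with
  | basic U hU =>
    obtain ⟨a, rfl⟩ := hU
    exact ⟨a, ht, fun s hs => not_not.1 hs⟩
  | univ =>
    obtain ⟨a, ha⟩ := exists_notMem hn hA t
    exact ⟨a, ha, fun s hs => absurd trivial hs⟩
  | inter U V _ _ hU hV =>
    obtain ⟨c, hc, hc'⟩ := hU ht.1
    obtain ⟨d, hd, hd'⟩ := hV ht.2
    obtain ⟨x, hx⟩ := exists_mul_mul_notMem hn hA t hc hd
    refine ⟨c * x * d, hx, fun s hs => ?_⟩
    by_cases h : s ∈ U
    · exact s.mul_mem_left _ (hd' s fun h' => hs ⟨h, h'⟩)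
    · exact s.mul_mem_right _ (s.mul_mem_right _ (hc' s h))
  | sUnion S _ hS =>
    obtain ⟨U, hU, htU⟩ := ht
    obtain ⟨c, hc, hc'⟩ := hS U hU htU
    exact ⟨c, hc, fun s hs => hc' s fun h => hs ⟨U, hU, h⟩⟩

/-- By incomparability any other primitive ideal omits some `b` of `t`, so points are closed. -/
theorem isOpen_compl_point (t : PrimitiveIdeal A) : IsOpen {s : PrimitiveIdeal A | s ≠ t} := by
  rw [isOpen_iff_forall_mem_open]
  intro s hs
  obtain ⟨b, hbt, hbs⟩ : ∃ b ∈ t.toSubmodule, b ∉ s.toSubmodule := by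
    by_contra! h
    obtain ⟨w, rfl⟩ := hA.exists_frame hn t
    obtain ⟨v, rfl⟩ := hA.exists_frame hn s
    exact hs (FrameSpace.base_eq_of_le h).symm
  refine ⟨{r | b ∉ r.toSubmodule}, ?_, TopologicalSpace.isOpen_generateFrom_of_mem ⟨b, rfl⟩, hbs⟩
  rintro r hr rfl
  exact hr hbt

theorem eq_of_forall_coord {a b : A} (h : ∀ w : FrameSpace n A, w.coord a = w.coord b) :
    a = b := by
  refine eq_of_forall_value fun t => ?_
  obtain ⟨w, rfl⟩ := hA.exists_frame hn t
  rw [← FrameSpace.frame_coord, h, FrameSpace.frame_coord]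

/-- The truncating element vanishes in every frame, hence is zero, so truncation at `r` leaves `a`
unchanged. -/
theorem norm_le_of_forall_coord {a : A} {r : ℝ} (hr : 0 < r)
    (h : ∀ w : FrameSpace n A, ‖w.coord a‖ ≤ r) : ‖a‖ ≤ r := by
  have h0 : truncElem r a = 0 := by
    refine eq_of_forall_coord hn hA fun w => ?_
    rw [map_zero, map_truncElem_eq_zero_iff _ hr]
    exact h w
  have := norm_sub_mul_truncElem_le hr a
  rwa [h0, mul_zero, sub_zero] at this

theorem norm_le_of_forall_value {a : A} {r : ℝ} (hr : 0 < r)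
    (h : ∀ t : PrimitiveIdeal A, ‖value a t‖ ≤ r) : ‖a‖ ≤ r :=
  norm_le_of_forall_coord hn hA hr fun w => by rw [← FrameSpace.norm_value]; exact h _

end FrameTopology

/-! ### Orthogonal families and central elements -/

section Central

open scoped Matrix.Norms.L2Operator

open PrimitiveIdeal Filter

variable {n : ℕ}

/-- `n` nonzero mutually orthogonal self-adjoint `n × n` matrices are simultaneously diagonal in some
orthonormal basis, each with exactly one nonzero entry. -/
theorem exists_aut_of_orthogonal (p : Fin n → Mat n) (hs : ∀ i, star (p i) = p i)
    (ho : ∀ i j, i ≠ j → p i * p j = 0) (h0 : ∀ i, p i ≠ 0) :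
    ∃ (g : AutMat n) (c : Fin n → ℂ), (∀ i, c i ≠ 0) ∧ ∀ i, g.symm (p i) = Matrix.single i i (c i) := by
  have hex : ∀ i, ∃ (v : Fin n → ℂ) (t : ℂ), t ≠ 0 ∧ star t = t ∧ star v ⬝ᵥ v = 1 ∧
      (p i).mulVec v = t • v := by
    intro i
    obtain ⟨v, t, ht, hv, h⟩ := Matrix.IsHermitian.exists_eigenvector_of_ne_zero (A := p i) (hs i) (h0 i)
    have hpos : 0 < ∑ k, ‖v k‖ ^ 2 := by
      obtain ⟨k, hk⟩ := Function.ne_iff.1 hv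
      refine Finset.sum_pos' (fun _ _ => by positivity) ⟨k, Finset.mem_univ k, ?_⟩
      have : 0 < ‖v k‖ := norm_pos_iff.2 hk
      positivity
    set r := Real.sqrt (∑ k, ‖v k‖ ^ 2) with hr
    have hrpos : 0 < r := Real.sqrt_pos.2 hpos
    have hr2 : r * r = ∑ k, ‖v k‖ ^ 2 := Real.mul_self_sqrt hpos.le
    have hdot : star v ⬝ᵥ v = ((r * r : ℝ) : ℂ) := by
      rw [hr2, dotProduct]
      push_cast
      refine Finset.sum_congr rfl fun k _ => ?_
      rw [Pi.star_apply, RCLike.star_def, ← Complex.normSq_eq_conj_mul_self, Complex.normSq_eq_norm_sq]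
      push_cast; rfl
    refine ⟨((r : ℂ)⁻¹) • v, (t : ℂ), by exact_mod_cast ht, by simp, ?_, ?_⟩
    · rw [star_smul, smul_dotProduct, dotProduct_smul, hdot]
      have : (r : ℂ) ≠ 0 := by exact_mod_cast hrpos.ne'
      simp
      field_simp
    · rw [Matrix.mulVec_smul, h, smul_comm]
      rfl
  choose v t ht hts hv hp using hex
  -- Since `t j ≠ 0`, the vector `v j` lies in the range of `p j`, which `p i` annihilates.
  have hpv : ∀ i j, i ≠ j → (p i).mulVec (v j) = 0 := by
    intro i j hij
    have h1 : (p i).mulVec ((p j).mulVec (v j)) = 0 := by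
      rw [Matrix.mulVec_mulVec, ho i j hij, Matrix.zero_mulVec]
    rw [hp j, Matrix.mulVec_smul] at h1
    exact (smul_eq_zero.1 h1).resolve_left (ht j)
  have hort : ∀ i j, i ≠ j → star (v i) ⬝ᵥ v j = 0 := by
    intro i j hij
    have h1 : star ((p j).mulVec (v i)) ⬝ᵥ v j = star (v i) ⬝ᵥ ((p j).mulVec (v j)) := by
      rw [Matrix.star_mulVec, ← Matrix.dotProduct_mulVec]
      congr 2
      exact hs j
    rw [hpv j i hij.symm, hp j, star_zero, zero_dotProduct, dotProduct_smul] at h1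
    exact (smul_eq_zero.1 h1.symm).resolve_left (ht j)
  -- There are `n` orthonormal eigenvectors, so they are the columns of a unitary.
  let U : Mat n := Matrix.of fun k i => v i k
  have hU : U ∈ unitary (Mat n) := by
    have : U ∈ Matrix.unitaryGroup (Fin n) ℂ := by
      rw [Matrix.mem_unitaryGroup_iff']
      ext i j
      have e : (star U * U) i j = star (v i) ⬝ᵥ v j := rfl
      rw [e]
      by_cases hij : i = j
      · subst hij; rw [hv, Matrix.one_apply_eq]
      · rw [hort i j hij, Matrix.one_apply_ne hij]
    exact this
  have hpU : ∀ i, p i * U = U * Matrix.single i i (t i) := by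
    intro i
    ext k j
    have e1 : (p i * U) k j = (p i).mulVec (v j) k := rfl
    rw [e1]
    by_cases hij : i = j
    · subst hij
      rw [hp i, Matrix.mul_single_apply_same]
      simp [U, mul_comm]
    · rw [hpv i j hij, Matrix.mul_single_apply_of_ne (hbj := fun h => hij h.symm)]
      rfl
  let g : AutMat n := Unitary.conjStarAlgAut ℂ (Mat n) ⟨U, hU⟩
  refine ⟨g, t, ht, fun i => ?_⟩
  have : g (Matrix.single i i (t i)) = p i := by
    change U * Matrix.single i i (t i) * star U = p i
    rw [← hpU, mul_assoc, Unitary.mul_star_self_of_mem hU, mul_one]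
  rw [← this, StarAlgEquiv.symm_apply_apply]

/-! #### Bump functions -/

/-- A bump function supported in the interval of length one around `i + 1`. -/
noncomputable def bumpFun (i : ℕ) (x : ℝ) : ℝ := max 0 (1 - 2 * |x - (i + 1)|)

theorem continuous_bumpFun (i : ℕ) : Continuous (bumpFun i) := by
  unfold bumpFun; fun_prop

theorem bumpFun_zero (i : ℕ) : bumpFun i 0 = 0 := by
  unfold bumpFun
  have : (0 : ℝ) ≤ i := Nat.cast_nonneg i
  rw [zero_sub, abs_neg, abs_of_nonneg (by linarith)]
  exact max_eq_left (by linarith)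

theorem bumpFun_self (i : ℕ) : bumpFun i (i + 1) = 1 := by simp [bumpFun]

theorem bumpFun_mul (i j : ℕ) (hij : i ≠ j) (x : ℝ) : bumpFun i x * bumpFun j x = 0 := by
  by_contra h
  have h1 : bumpFun i x ≠ 0 := left_ne_zero_of_mul h
  have h2 : bumpFun j x ≠ 0 := right_ne_zero_of_mul h
  have key : ∀ k : ℕ, bumpFun k x ≠ 0 → |x - (k + 1)| < 1 / 2 := by
    intro k hk
    by_contra hc
    exact hk (max_eq_left (by linarith))
  have := key i h1
  have := key j h2
  have h3 : (1 : ℝ) ≤ |(i : ℝ) - j| := by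
    have : (1 : ℤ) ≤ |(i : ℤ) - j| := Int.one_le_abs (by omega)
    exact_mod_cast this
  have h4 : |(i : ℝ) - j| ≤ |x - (j + 1)| + |x - (i + 1)| := by
    have : (i : ℝ) - j = (x - (j + 1)) - (x - (i + 1)) := by ring
    rw [this]
    exact abs_sub _ _
  linarith

/-- The function `bumpFun i` of a self-adjoint element. -/
noncomputable def bump {A : Type*} [NonUnitalCStarAlgebra A] (i : ℕ) (h : A) : A :=
  cfcₙ (bumpFun i) h

section Bump

variable {A : Type*} [NonUnitalCStarAlgebra A]

theorem star_bump (i : ℕ) (h : A) : star (bump i h) = bump i h := by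
  have : IsSelfAdjoint (bump i h) := cfcₙ_predicate (bumpFun i) h
  exact this.star_eq

theorem bump_mul_bump (h : A) {i j : ℕ} (hij : i ≠ j) : bump i h * bump j h = 0 := by
  unfold bump
  rw [← cfcₙ_mul (bumpFun i) (bumpFun j) h (continuous_bumpFun i).continuousOn (bumpFun_zero i)
    (continuous_bumpFun j).continuousOn (bumpFun_zero j)]
  simp only [bumpFun_mul i j hij]
  exact cfcₙ_const_zero ℝ h

theorem map_bump {B : Type*} [NonUnitalCStarAlgebra B] (φ : A →⋆ₙₐ[ℂ] B) (i : ℕ) {h : A}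
    (hh : IsSelfAdjoint h) : φ (bump i h) = bump i (φ h) :=
  φ.map_cfcₙ (bumpFun i) h (continuous_bumpFun i).continuousOn (bumpFun_zero i)
    φ.continuous_of_cstar hh (hh.map φ)

theorem bump_ne_zero {i : ℕ} {h : Mat n} (hh : IsSelfAdjoint h)
    (hi : ((i : ℝ) + 1) ∈ spectrum ℝ h) : bump i h ≠ 0 := by
  intro h0
  rw [bump, cfcₙ_eq_cfc (continuous_bumpFun i).continuousOn (bumpFun_zero i)] at h0
  have h1 := cfc_map_spectrum (bumpFun i) h hh (continuous_bumpFun i).continuousOn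
  rw [h0] at h1
  have h2 : (1 : ℝ) ∈ spectrum ℝ (0 : Mat n) := by
    rw [h1]; exact ⟨_, hi, bumpFun_self i⟩
  have : Nontrivial (Mat n) := by
    by_contra hc
    rw [not_nontrivial_iff_subsingleton] at hc
    rw [spectrum.of_subsingleton] at h2
    exact h2
  rw [spectrum.zero_eq] at h2
  simp at h2

end Bump

variable {A : Type u} [NonUnitalCStarAlgebra A]

theorem FrameSpace.exists_selfAdjoint_lift (w : FrameSpace n A) {x : Mat n} (hx : star x = x) :
    ∃ h : A, IsSelfAdjoint h ∧ w.coord h = x := by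
  obtain ⟨a, ha⟩ := w.coord_surjective x
  refine ⟨(1 / 2 : ℂ) • (a + star a), ?_, ?_⟩
  · rw [IsSelfAdjoint, star_smul, star_add, star_star, add_comm (star a)]
    congr 1
    simp
  · rw [map_smul, map_add, map_star, ha, hx]
    rw [← two_smul ℂ x, smul_smul]
    norm_num

/-- A frame in which orthogonal elements are diagonal. -/
theorem FrameSpace.exists_adapted (w : FrameSpace n A) (p : Fin n → A)
    (hs : ∀ i, star (p i) = p i) (ho : ∀ i j, i ≠ j → p i * p j = 0) (h0 : ∀ i, w.coord (p i) ≠ 0) :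
    ∃ w' : FrameSpace n A, w'.base = w.base ∧ ∃ c : Fin n → ℂ, (∀ i, c i ≠ 0) ∧
      ∀ i, w'.coord (p i) = Matrix.single i i (c i) := by
  obtain ⟨g, c, hc, hg⟩ := exists_aut_of_orthogonal (fun i => w.coord (p i))
    (fun i => by rw [← map_star, hs]) (fun i j hij => by rw [← map_mul, ho i j hij, map_zero]) h0
  exact ⟨MulOpposite.op g • w, rfl, c, hc, hg⟩

variable (n) in
/-- `z` acts in all fibres as multiplication by the scalar `ζ`. -/
def IsScalar (z : A) (ζ : PrimitiveIdeal A → ℝ) : Prop :=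
  ∀ w : FrameSpace n A, w.coord z = ((ζ w.base : ℝ) : ℂ) • (1 : Mat n)

/-- The products used to build a central element. -/
def scalarBlock (v : Fin n → A) (q : A) (l : List (Fin n)) : A :=
  l.foldr (fun j y => star (v j) * v j * y) q

theorem map_scalarBlock_zero (φ : A →⋆ₙₐ[ℂ] Mat n) (v : Fin n → A) (q : A) {l : List (Fin n)}
    {j : Fin n} (hj : j ∈ l) (h0 : φ (v j) = 0) : φ (scalarBlock v q l) = 0 := by
  induction l with
  | nil => simp at hj
  | cons k l ih =>
    rw [scalarBlock, List.foldr_cons, map_mul, map_mul]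
    rcases List.mem_cons.1 hj with rfl | hj
    · rw [h0, mul_zero, zero_mul]
    · have := ih hj
      rw [scalarBlock] at this
      rw [this, mul_zero]

theorem map_scalarBlock (φ : A →⋆ₙₐ[ℂ] Mat n) (v : Fin n → A) (q : A) (l : List (Fin n))
    (σ : Fin n → ℂ) (k : Fin n) (c : ℂ) (hq : φ q = Matrix.single k k c)
    (hv : ∀ j, φ (star (v j) * v j) = Matrix.single k k (σ j)) :
    φ (scalarBlock v q l) = Matrix.single k k ((l.map σ).prod * c) := by
  induction l with
  | nil => simpa [scalarBlock] using hq
  | cons j l ih =>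
    rw [scalarBlock] at ih ⊢
    rw [List.foldr_cons, map_mul, hv, ih, Matrix.single_mul_single_same, List.map_cons,
      List.prod_cons, mul_assoc]

/-- A central element, built from orthogonal elements `p i` and elements `v i` of `p i A p k`. -/
theorem exists_isScalar_of_orthogonal (hn : 1 ≤ n) (p a : Fin n → A) (k : Fin n)
    (hs : ∀ i, star (p i) = p i) (ho : ∀ i j, i ≠ j → p i * p j = 0) :
    ∃ (z : A) (ζ : FrameSpace n A → ℂ), ∀ w : FrameSpace n A, w.coord z = ζ w • (1 : Mat n) ∧
      (ζ w = 0 ↔ ∃ i, w.coord (p i * a i * p k) = 0) := by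
  have : Nonempty (Fin n) := ⟨⟨0, hn⟩⟩
  let v : Fin n → A := fun i => p i * a i * p k
  -- In a frame diagonalizing the `p i`, `v i` is `m i` times the matrix unit at `(i, k)`. The block
  -- multiplies `|m j| ^ 2` over `j ≠ i` in the corner `k`; conjugation by `v i` supplies the
  -- missing factor and moves it to the corner `i`. All corners thus carry the same scalar, and all
  -- summands vanish if some `v j` does.
  let z : A := ∑ i, v i * scalarBlock v (p k) ((List.finRange n).erase i) * star (v i)
  have key : ∀ w : FrameSpace n A, ∃ ζ : ℂ, w.coord z = ζ • (1 : Mat n) ∧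
      (ζ = 0 ↔ ∃ i, w.coord (v i) = 0) := by
    intro w
    by_cases hw : ∃ i, w.coord (v i) = 0
    · refine ⟨0, ?_, by simpa using hw⟩
      obtain ⟨j, hj⟩ := hw
      rw [zero_smul, map_sum]
      refine Finset.sum_eq_zero fun i _ => ?_
      rw [map_mul, map_mul]
      by_cases hij : i = j
      · rw [hij, hj, zero_mul, zero_mul]
      · rw [map_scalarBlock_zero w.coord v (p k) _ hj, mul_zero, zero_mul]
        exact (List.mem_erase_of_ne (Ne.symm hij)).2 (List.mem_finRange j)
    · have hp0 : ∀ i, w.coord (p i) ≠ 0 := by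
        intro i hi
        refine hw ⟨i, ?_⟩
        rw [map_mul, map_mul, hi, zero_mul, zero_mul]
      obtain ⟨w', hw', c, hc, hp⟩ := w.exists_adapted p hs ho hp0
      let m : Fin n → ℂ := fun i => c i * w'.coord (a i) i k * c k
      have hv : ∀ i, w'.coord (v i) = Matrix.single i k (m i) := by
        intro i
        rw [map_mul, map_mul, hp, hp]
        ext r s
        by_cases hr : r = i
        · by_cases hs' : s = k
          · subst hr hs'
            rw [Matrix.mul_single_apply_same, Matrix.single_mul_apply_same]
            simp [m]
          · rw [Matrix.mul_single_apply_of_ne (hbj := hs')]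
            simp [Ne.symm hs']
        · rw [mul_assoc, Matrix.single_mul_apply_of_ne (h := hr)]
          simp [Ne.symm hr]
      have hsv : ∀ i, w'.coord (star (v i)) = Matrix.single k i (star (m i)) := by
        intro i
        rw [map_star, hv, Matrix.star_eq_conjTranspose, Matrix.conjTranspose_single]
      let σ : Fin n → ℂ := fun i => star (m i) * m i
      have hsvv : ∀ i, w'.coord (star (v i) * v i) = Matrix.single k k (σ i) := by
        intro i
        rw [map_mul, hsv, hv, Matrix.single_mul_single_same]
      have hz : w'.coord z = (((List.finRange n).map σ).prod * c k) • (1 : Mat n) := by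
        rw [map_sum]
        have : ∀ i, w'.coord (v i * scalarBlock v (p k) ((List.finRange n).erase i) * star (v i)) =
            Matrix.single i i (((List.finRange n).map σ).prod * c k) := by
          intro i
          rw [map_mul, map_mul, hv, hsv, map_scalarBlock w'.coord v (p k) _ σ k (c k) (hp k) hsvv,
            Matrix.single_mul_single_same, Matrix.single_mul_single_same,
            ← List.prod_map_erase σ (List.mem_finRange i)]
          congr 1
          simp only [σ]
          ring
        rw [Finset.sum_congr rfl fun i _ => this i]
        ext r s
        rw [Matrix.sum_apply, Finset.sum_eq_single r]
        · simp [Matrix.single_apply, Matrix.one_apply]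
        · intro i _ hi
          simp [hi]
        · simp
      have hm : ∀ i, m i ≠ 0 := by
        intro i hi
        refine hw ⟨i, ?_⟩
        rw [FrameSpace.coord_eq_zero_iff, ← hw', ← FrameSpace.coord_eq_zero_iff, hv, hi,
          Matrix.single_zero]
      have hne : ((List.finRange n).map σ).prod * c k ≠ 0 := by
        refine mul_ne_zero (List.prod_ne_zero ?_) (hc k)
        rw [List.mem_map]
        rintro ⟨i, -, hi⟩
        exact (mul_ne_zero (star_ne_zero.2 (hm i)) (hm i)) hi
      refine ⟨((List.finRange n).map σ).prod * c k, ?_, iff_of_false hne hw⟩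
      have hd := FrameSpace.diff_coord w w' hw'.symm z
      rw [← hd, hz, map_smul, map_one]
  choose ζ hζ using key
  exact ⟨z, ζ, hζ⟩

end Central

/-! ### Partitions of unity and continuous sections -/

section Sections

open scoped Matrix.Norms.L2Operator

open PrimitiveIdeal Filter

variable {n : ℕ} {A : Type u} [NonUnitalCStarAlgebra A]

namespace IsScalar

theorem mul {z z' : A} {ζ ζ' : PrimitiveIdeal A → ℝ} (h : IsScalar n z ζ) (h' : IsScalar n z' ζ') :
    IsScalar n (z * z') fun t => ζ t * ζ' t := by
  intro w
  rw [map_mul, h, h', smul_mul_smul_comm, one_mul]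
  push_cast; rfl

theorem sum {ι : Type*} (F : Finset ι) {z : ι → A} {ζ : ι → PrimitiveIdeal A → ℝ}
    (h : ∀ i ∈ F, IsScalar n (z i) (ζ i)) : IsScalar n (∑ i ∈ F, z i) fun t => ∑ i ∈ F, ζ i t := by
  intro w
  rw [map_sum, Finset.sum_congr rfl fun i hi => h i hi w, ← Finset.sum_smul]
  push_cast; rfl

theorem coord_mul {z : A} {ζ : PrimitiveIdeal A → ℝ} (h : IsScalar n z ζ) (w : FrameSpace n A)
    (a : A) : w.coord (z * a) = ((ζ w.base : ℝ) : ℂ) • w.coord a := by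
  rw [map_mul, h, smul_mul_assoc, one_mul]

theorem coord_mul' {z : A} {ζ : PrimitiveIdeal A → ℝ} (h : IsScalar n z ζ) (w : FrameSpace n A)
    (a : A) : w.coord (a * z) = ((ζ w.base : ℝ) : ℂ) • w.coord a := by
  rw [map_mul, h, mul_smul_comm, mul_one]

end IsScalar

theorem FrameSpace.norm_sub_value (w : FrameSpace n A) (s : Fibre w.base) (a : A) :
    ‖s - value a w.base‖ = ‖w.frame.symm s - w.coord a‖ := by
  obtain ⟨b, rfl⟩ := value_surjective w.base s
  simp only
  rw [← value_sub, norm_value, map_sub]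
  rfl

theorem FrameSpace.norm_symm (w : FrameSpace n A) (s : Fibre w.base) :
    ‖w.frame.symm s‖ = ‖s‖ := by
  obtain ⟨b, rfl⟩ := value_surjective w.base s
  exact (norm_value w b).symm

variable (hn : 1 ≤ n) (hA : IsHomogeneous n A)

theorem norm_smul_one (hn : 1 ≤ n) (c : ℂ) : ‖c • (1 : Mat n)‖ = ‖c‖ := by
  have : Nonempty (Fin n) := ⟨⟨0, hn⟩⟩
  rw [norm_smul, norm_one, mul_one]

include hn hA

theorem IsScalar.star_eq {z : A} {ζ : PrimitiveIdeal A → ℝ} (h : IsScalar n z ζ) : star z = z := by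
  refine eq_of_forall_coord hn hA fun w => ?_
  rw [map_star, h, star_smul, star_one]
  simp

theorem IsScalar.mul_comm {z : A} {ζ : PrimitiveIdeal A → ℝ} (h : IsScalar n z ζ) (a : A) :
    z * a = a * z :=
  eq_of_forall_coord hn hA fun w => by rw [h.coord_mul, h.coord_mul']

theorem IsScalar.continuous {z : A} {ζ : PrimitiveIdeal A → ℝ} (h : IsScalar n z ζ)
    (h0 : ∀ t, 0 ≤ ζ t) : Continuous ζ := by
  have : ζ = fun t => ‖value z t‖ := by
    funext t
    obtain ⟨w, rfl⟩ := hA.exists_frame hn t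
    rw [FrameSpace.norm_value, h, norm_smul_one hn, Complex.norm_real, Real.norm_of_nonneg (h0 _)]
  rw [this]
  exact continuous_norm_value hn hA z

theorem IsScalar.cfc {z : A} {ζ : PrimitiveIdeal A → ℝ} (h : IsScalar n z ζ) {f : ℝ → ℝ}
    (hf : Continuous f) (hf0 : f 0 = 0) : IsScalar n (cfcₙ f z) fun t => f (ζ t) := by
  intro w
  have hz : IsSelfAdjoint z := h.star_eq hn hA
  have e : ∀ r : ℝ, ((r : ℝ) : ℂ) • (1 : Mat n) = algebraMap ℝ (Mat n) r := by
    intro r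
    rw [Algebra.algebraMap_eq_smul_one, ← Complex.coe_smul]
  rw [w.coord.map_cfcₙ f z hf.continuousOn hf0 w.coord.continuous_of_cstar hz (hz.map _), h, e, e,
    cfcₙ_eq_cfc hf.continuousOn hf0, cfc_algebraMap]

/-- Central elements supported in a neighbourhood of a point. -/
theorem exists_isScalar {V : Set (PrimitiveIdeal A)} (hV : IsOpen V) {t : PrimitiveIdeal A}
    (ht : t ∈ V) : ∃ (z : A) (ζ : PrimitiveIdeal A → ℝ), IsScalar n z ζ ∧ (∀ s, 0 ≤ ζ s) ∧
      0 < ζ t ∧ ∀ s ∉ V, ζ s = 0 := by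
  obtain ⟨w, rfl⟩ := hA.exists_frame hn t
  obtain ⟨c, hc, hcV⟩ := exists_notMem_of_isOpen hn hA hV ht
  -- The eigenvalues `1, …, n` are the centres of the bump functions, which therefore cut out `n`
  -- orthogonal elements that are nonzero at the point.
  let d : Mat n := Matrix.diagonal fun i => (((i : ℕ) + 1 : ℝ) : ℂ)
  have hd : star d = d := by
    rw [Matrix.star_eq_conjTranspose, Matrix.diagonal_conjTranspose]
    congr 1
    funext i
    simp
  obtain ⟨h, hh, hhd⟩ := w.exists_selfAdjoint_lift hd
  let p : Fin n → A := fun i => bump i h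
  have hp : ∀ i, p i ∉ w.base.toSubmodule := by
    intro i
    rw [← FrameSpace.coord_eq_zero_iff, map_bump _ _ hh, hhd]
    refine bump_ne_zero hd ?_
    have : ((((i : ℕ) : ℝ) + 1 : ℝ) : ℂ) ∈ spectrum ℂ d := by
      rw [spectrum_diagonal]
      exact ⟨i, rfl⟩
    exact (spectrum.algebraMap_mem_iff ℂ (r := ((i : ℕ) : ℝ) + 1)).1 this
  let k : Fin n := ⟨0, hn⟩
  -- Inserting `c` makes the connecting elements vanish off `V`; primeness of the fibre keeps them
  -- nonzero at the given point.
  have ha : ∀ i, ∃ a, p i * a * p k ∉ w.base.toSubmodule ∧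
      ∀ s ∉ V, p i * a * p k ∈ s.toSubmodule := by
    intro i
    obtain ⟨x, hx⟩ := exists_mul_mul_notMem hn hA _ (hp i) hc
    obtain ⟨y, hy⟩ := exists_mul_mul_notMem hn hA _ hx (hp k)
    have e : p i * (x * c * y) * p k = p i * x * c * y * p k := by simp only [mul_assoc]
    refine ⟨x * c * y, by rwa [e], fun s hs => ?_⟩
    exact s.mul_mem_right _ (s.mul_mem_left _ (s.mul_mem_right _ (s.mul_mem_left _ (hcV s hs))))
  choose a ha haV using ha
  obtain ⟨z, ζ, hζ⟩ := exists_isScalar_of_orthogonal hn p a k (fun i => star_bump _ _)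
    (fun i j hij => bump_mul_bump h fun e => hij (Fin.ext e))
  have hnorm : ∀ v : FrameSpace n A, ‖value z v.base‖ = ‖ζ v‖ := by
    intro v
    rw [FrameSpace.norm_value, (hζ v).1, norm_smul_one hn]
  -- The scalar of `z` may be complex; that of `star z * z` is its squared modulus.
  refine ⟨star z * z, fun s => ‖value z s‖ ^ 2, fun v => ?_, fun s => by positivity, ?_, ?_⟩
  · simp only [hnorm]
    rw [map_mul, map_star, (hζ v).1, star_smul, star_one, smul_mul_smul_comm, one_mul,
      RCLike.star_def, ← Complex.normSq_eq_conj_mul_self, Complex.normSq_eq_norm_sq]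
  · change 0 < ‖value z w.base‖ ^ 2
    have : 0 < ‖value z w.base‖ := by
      rw [hnorm, norm_pos_iff, ne_eq, (hζ w).2]
      rintro ⟨i, hi⟩
      exact ha i ((FrameSpace.coord_eq_zero_iff _ _).1 hi)
    positivity
  · intro s hs
    obtain ⟨v, rfl⟩ := hA.exists_frame hn s
    have : ζ v = 0 := (hζ v).2.2 ⟨k, (FrameSpace.coord_eq_zero_iff _ _).2 (haV k _ hs)⟩
    change ‖value z v.base‖ ^ 2 = 0
    rw [hnorm, this]; simp

/-- Partitions of unity by central elements. -/
theorem exists_partition {K : Set (PrimitiveIdeal A)} (hK : IsCompact K)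
    (V : PrimitiveIdeal A → Set (PrimitiveIdeal A)) (hV : ∀ t ∈ K, IsOpen (V t) ∧ t ∈ V t) :
    ∃ (F : Finset (PrimitiveIdeal A)) (z : PrimitiveIdeal A → A)
      (g : PrimitiveIdeal A → PrimitiveIdeal A → ℝ), (∀ i ∈ F, i ∈ K) ∧
      (∀ i ∈ F, IsScalar n (z i) (g i)) ∧ (∀ i ∈ F, ∀ t, 0 ≤ g i t) ∧
      (∀ i ∈ F, ∀ t ∉ V i, g i t = 0) ∧ (∀ t, ∑ i ∈ F, g i t ≤ 1) ∧
      ∀ t ∈ K, ∑ i ∈ F, g i t = 1 := by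
  have hex : ∀ t, ∃ (z : A) (ζ : PrimitiveIdeal A → ℝ), t ∈ K → IsScalar n z ζ ∧ (∀ s, 0 ≤ ζ s) ∧
      0 < ζ t ∧ ∀ s ∉ V t, ζ s = 0 := by
    intro t
    by_cases ht : t ∈ K
    · obtain ⟨z, ζ, h⟩ := exists_isScalar hn hA (hV t ht).1 (hV t ht).2
      exact ⟨z, ζ, fun _ => h⟩
    · exact ⟨0, 0, fun h => absurd h ht⟩
  choose z ζ h using hex
  have hcont : ∀ t ∈ K, Continuous (ζ t) := fun t ht => (h t ht).1.continuous hn hA (h t ht).2.1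
  obtain ⟨F, hFK, hF⟩ := hK.elim_nhds_subcover (fun t => {s | 0 < ζ t s}) fun t ht =>
    (isOpen_lt continuous_const (hcont t ht)).mem_nhds (h t ht).2.2.1
  let W : PrimitiveIdeal A → ℝ := fun t => ∑ i ∈ F, ζ i t
  have hW0 : ∀ t, 0 ≤ W t := fun t => Finset.sum_nonneg fun i hi => (h i (hFK i hi)).2.1 t
  have hWc : Continuous W := continuous_finsetSum _ fun i hi => hcont i (hFK i hi)
  have hWK : ∀ t ∈ K, 0 < W t := by
    intro t ht
    obtain ⟨i, hi, hti⟩ := Set.mem_iUnion₂.1 (hF ht)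
    exact Finset.sum_pos' (fun i hi => (h i (hFK i hi)).2.1 t) ⟨i, hi, hti⟩
  obtain ⟨δ, hδ, hδK⟩ : ∃ δ > 0, ∀ t ∈ K, δ ≤ W t := by
    rcases K.eq_empty_or_nonempty with rfl | hne
    · exact ⟨1, one_pos, by simp⟩
    · obtain ⟨t₀, ht₀, hmin⟩ := hK.exists_isMinOn hne hWc.continuousOn
      exact ⟨W t₀, hWK t₀ ht₀, fun t ht => hmin ht⟩
  -- This normalizes by two conditions at once: `f 0 = 0`, as the non-unital calculus requires, and
  -- `x * f x = (x / max x δ) ^ 2`, which is at most one for `x ≥ 0` and equals one for `x ≥ δ`.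
  let f : ℝ → ℝ := fun x => x / (max x δ) ^ 2
  have hf : Continuous f := by
    refine continuous_id.div (by fun_prop) fun x => ?_
    have : 0 < max x δ := lt_max_of_lt_right hδ
    positivity
  have hf0 : f 0 = 0 := by simp [f]
  have hfnn : ∀ x, 0 ≤ x → 0 ≤ f x := fun x hx => by positivity
  have hf1 : ∀ x, 0 ≤ x → x * f x ≤ 1 := by
    intro x hx
    have h1 : 0 < max x δ := lt_max_of_lt_right hδ
    have h2 : x ≤ max x δ := le_max_left _ _
    simp only [f]
    rw [mul_div_assoc', div_le_one (by positivity)]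
    nlinarith
  have hf2 : ∀ x, δ ≤ x → x * f x = 1 := by
    intro x hx
    have h1 : 0 < x := hδ.trans_le hx
    simp only [f, max_eq_left hx]
    field_simp
  have hsum : IsScalar n (∑ i ∈ F, z i) W := IsScalar.sum F fun i hi => (h i (hFK i hi)).1
  have hk := hsum.cfc hn hA hf hf0
  have hg : ∀ t, ∑ i ∈ F, ζ i t * f (W t) = W t * f (W t) := fun t => by rw [← Finset.sum_mul]
  refine ⟨F, fun i => z i * cfcₙ f (∑ i ∈ F, z i), fun i t => ζ i t * f (W t), hFK,
    fun i hi => (h i (hFK i hi)).1.mul hk, fun i hi t =>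
      mul_nonneg ((h i (hFK i hi)).2.1 t) (hfnn _ (hW0 t)), ?_, ?_, ?_⟩
  · intro i hi t ht
    simp only [(h i (hFK i hi)).2.2.2 t ht, zero_mul]
  · intro t
    rw [hg]
    exact hf1 _ (hW0 t)
  · intro t ht
    rw [hg]
    exact hf2 _ (hδK t ht)

/-- A frame is isometric onto the fibre, so its seminorm separates points. -/
theorem eq_value_of_norm_sub_eq_zero {t : PrimitiveIdeal A} {s : Fibre t} {a : A}
    (h : ‖s - value a t‖ = 0) : s = value a t := by
  obtain ⟨w, rfl⟩ := hA.exists_frame hn t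
  rw [w.norm_sub_value, norm_eq_zero, sub_eq_zero] at h
  rw [← w.frame_coord, ← h]
  exact (w.frame.apply_symm_apply s).symm

/-- A combination of locally approximating elements, by a partition of unity, approximates. -/
theorem exists_approx_section (s : ∀ t : PrimitiveIdeal A, Fibre t) (b : A)
    (hb : ∀ t, ‖s t‖ ≤ ‖value b t‖) {ε : ℝ} (hε : 0 < ε)
    (hloc : ∀ t₀, ∃ a : A, ∀ᶠ t in 𝓝 t₀, ‖s t - value a t‖ < ε) :
    ∃ c : A, ∀ t, ‖s t - value c t‖ ≤ ε := by
  choose a ha using hloc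
  have hV : ∀ t₀, ∃ V : Set (PrimitiveIdeal A), (∀ t ∈ V, ‖s t - value (a t₀) t‖ < ε) ∧
      IsOpen V ∧ t₀ ∈ V := fun t₀ => eventually_nhds_iff.1 (ha t₀)
  choose V hV hVo hVt using hV
  -- The weights add up to one only on the compact set where `ε ≤ ‖b(t)‖`. Elsewhere the section has
  -- norm below `ε`, which pays for the missing weight `1 - G`.
  obtain ⟨F, z, g, -, hz, hg0, hgV, hg1, hgK⟩ := exists_partition hn hA
    (isCompact_le_norm_value hn hA b hε) V fun t _ => ⟨hVo t, hVt t⟩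
  refine ⟨∑ i ∈ F, z i * a i, fun t => ?_⟩
  obtain ⟨w, rfl⟩ := hA.exists_frame hn t
  set S := w.frame.symm (s w.base) with hS
  rw [w.norm_sub_value, ← hS]
  have hterm : ∀ i ∈ F, ‖((g i w.base : ℝ) : ℂ) • (S - w.coord (a i))‖ ≤ g i w.base * ε := by
    intro i hi
    rw [norm_smul, Complex.norm_real, Real.norm_of_nonneg (hg0 i hi _)]
    by_cases hm : w.base ∈ V i
    · refine mul_le_mul_of_nonneg_left ?_ (hg0 i hi _)
      rw [hS, ← w.norm_sub_value]
      exact (hV i _ hm).le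
    · rw [hgV i hi _ hm]; simp
  set G := ∑ i ∈ F, g i w.base with hG
  have hG1 : G ≤ 1 := hg1 _
  have hrest : ‖((1 - G : ℝ) : ℂ) • S‖ ≤ (1 - G) * ε := by
    rw [norm_smul, Complex.norm_real, Real.norm_of_nonneg (sub_nonneg.2 hG1)]
    by_cases hm : ε ≤ ‖value b w.base‖
    · have : G = 1 := hgK _ hm
      rw [this]; simp
    · refine mul_le_mul_of_nonneg_left ?_ (sub_nonneg.2 hG1)
      rw [hS, w.norm_symm]
      exact (hb _).trans (not_le.1 hm).le
  have e : S - w.coord (∑ i ∈ F, z i * a i) =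
      ∑ i ∈ F, ((g i w.base : ℝ) : ℂ) • (S - w.coord (a i)) + ((1 - G : ℝ) : ℂ) • S := by
    rw [map_sum, Finset.sum_congr rfl fun i hi => (hz i hi).coord_mul w (a i)]
    simp only [smul_sub, Finset.sum_sub_distrib]
    rw [← Finset.sum_smul, hG]
    push_cast
    module
  rw [e]
  calc _ ≤ ∑ i ∈ F, g i w.base * ε + (1 - G) * ε :=
        (norm_add_le _ _).trans (add_le_add (norm_sum_le_of_le _ hterm) hrest)
    _ = ε := by rw [← Finset.sum_mul, ← hG]; ring

/-- Sections which are locally approximable by elements of `A` and vanish at infinity are given by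
elements of `A`. -/
theorem exists_section (s : ∀ t : PrimitiveIdeal A, Fibre t) (b : A)
    (hb : ∀ t, ‖s t‖ ≤ ‖value b t‖)
    (hloc : ∀ t₀, ∀ ε > 0, ∃ a : A, ∀ᶠ t in 𝓝 t₀, ‖s t - value a t‖ < ε) :
    ∃ c : A, ∀ t, value c t = s t := by
  have hex : ∀ m : ℕ, ∃ c : A, ∀ t, ‖s t - value c t‖ ≤ 1 / ((m : ℝ) + 1) := fun m =>
    exists_approx_section hn hA s b hb (by positivity) fun t₀ => hloc t₀ _ (by positivity)
  choose c hc using hex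
  have hlim : Tendsto (fun m : ℕ => 1 / ((m : ℝ) + 1)) atTop (𝓝 0) := tendsto_one_div_add_atTop_nhds_zero_nat
  -- Uniform closeness in all fibres is closeness in `A`, so completeness of `A` provides the limit.
  have hcauchy : CauchySeq c := by
    refine cauchySeq_of_le_tendsto_0 (fun N : ℕ => 2 * (1 / ((N : ℝ) + 1))) ?_
      (by simpa using hlim.const_mul 2)
    intro p q N hp hq
    rw [dist_eq_norm]
    refine norm_le_of_forall_value hn hA (by positivity) fun t => ?_
    have e : value (c p - c q) t = (s t - value (c q) t) - (s t - value (c p) t) := by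
      rw [value_sub]; abel
    have hmono : ∀ r : ℕ, N ≤ r → 1 / ((r : ℝ) + 1) ≤ 1 / ((N : ℝ) + 1) := fun r hr => by
      gcongr
    rw [e]
    calc _ ≤ ‖s t - value (c q) t‖ + ‖s t - value (c p) t‖ := norm_sub_le _ _
      _ ≤ 1 / ((N : ℝ) + 1) + 1 / ((N : ℝ) + 1) :=
        add_le_add ((hc q t).trans (hmono q hq)) ((hc p t).trans (hmono p hp))
      _ = _ := by ring
  obtain ⟨x, hx⟩ := cauchySeq_tendsto_of_complete hcauchy
  refine ⟨x, fun t => (eq_value_of_norm_sub_eq_zero hn hA ?_).symm⟩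
  have h1 : Tendsto (fun m : ℕ => 1 / ((m : ℝ) + 1) + ‖c m - x‖) atTop (𝓝 0) := by
    simpa using hlim.add (tendsto_iff_norm_sub_tendsto_zero.1 hx)
  refine le_antisymm (ge_of_tendsto h1 (Eventually.of_forall fun m => ?_)) (norm_nonneg _)
  have e : s t - value x t = (s t - value (c m) t) + value (c m - x) t := by
    rw [value_sub]; abel
  rw [e]
  refine (norm_add_le _ _).trans (add_le_add (hc m t) ?_)
  exact Submodule.Quotient.norm_mk_le _ _

/-- Approximation of an element by its product with a partition of unity. -/
theorem exists_partition_approx (a : A) {ε : ℝ} (hε : 0 < ε)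
    (V : PrimitiveIdeal A → Set (PrimitiveIdeal A))
    (hV : ∀ t, ε ≤ ‖value a t‖ → IsOpen (V t) ∧ t ∈ V t) :
    ∃ (F : Finset (PrimitiveIdeal A)) (z : PrimitiveIdeal A → A)
      (g : PrimitiveIdeal A → PrimitiveIdeal A → ℝ), (∀ i ∈ F, IsScalar n (z i) (g i)) ∧
      (∀ i ∈ F, ∀ t, 0 ≤ g i t) ∧ (∀ i ∈ F, ∀ t ∉ V i, g i t = 0) ∧
      ‖a - (∑ i ∈ F, z i) * a‖ ≤ ε := by
  obtain ⟨F, z, g, -, hz, hg0, hgV, hg1, hgK⟩ := exists_partition hn hA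
    (isCompact_le_norm_value hn hA a hε) V hV
  have hs := IsScalar.sum F hz
  refine ⟨F, z, g, hz, hg0, hgV, ?_⟩
  refine norm_le_of_forall_coord hn hA hε fun w => ?_
  set G := ∑ i ∈ F, g i w.base with hG
  have hG1 : G ≤ 1 := hg1 _
  have e : w.coord (a - (∑ i ∈ F, z i) * a) = ((1 - G : ℝ) : ℂ) • w.coord a := by
    rw [map_sub, hs.coord_mul]
    push_cast
    rw [sub_smul, one_smul, hG]
    push_cast; rfl
  rw [e, norm_smul, Complex.norm_real, Real.norm_of_nonneg (sub_nonneg.2 hG1)]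
  by_cases hm : ε ≤ ‖value a w.base‖
  · have : G = 1 := hgK _ hm
    rw [this]; simpa using hε.le
  · rw [FrameSpace.norm_value, not_le] at hm
    have hG0 : 0 ≤ G := Finset.sum_nonneg fun i hi => hg0 i hi _
    nlinarith [norm_nonneg (w.coord a)]

/-- Approximation of an element by its product with a central element which vanishes outside a given
open set. -/
theorem exists_isScalar_mul_approx (a : A) {ε : ℝ} (hε : 0 < ε) {V : Set (PrimitiveIdeal A)}
    (hV : IsOpen V) (haV : ∀ t, ε ≤ ‖value a t‖ → t ∈ V) :
    ∃ (z : A) (ζ : PrimitiveIdeal A → ℝ), IsScalar n z ζ ∧ (∀ t ∉ V, ζ t = 0) ∧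
      ‖a - z * a‖ ≤ ε := by
  obtain ⟨F, z, g, hz, -, hgV, h⟩ := exists_partition_approx hn hA a hε (fun _ => V) fun t ht =>
    ⟨hV, haV t ht⟩
  exact ⟨_, _, IsScalar.sum F hz, fun t ht => Finset.sum_eq_zero fun i hi => hgV i hi t ht, h⟩

end Sections

/-! ### Reductions of the structure group as subsets of the frame space -/

section Reduction

open PrimitiveIdeal Filter

variable {n : ℕ} {A : Type u} [NonUnitalCStarAlgebra A]

/-- A reduction of the frame bundle to `Aut(M_n, D_n)`, given by the set of adapted frames. -/
structure IsReduction (R : Set (FrameSpace n A)) : Prop where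
  smul_mem : ∀ w ∈ R, ∀ g ∈ autDiag n, MulOpposite.op g • w ∈ R
  exists_smul : ∀ w ∈ R, ∀ w' ∈ R, w.base = w'.base → ∃ g ∈ autDiag n, MulOpposite.op g • w = w'
  exists_section : ∀ t : PrimitiveIdeal A, ∃ (V : Set (PrimitiveIdeal A))
    (σ : PrimitiveIdeal A → FrameSpace n A), IsOpen V ∧ t ∈ V ∧ ContinuousOn σ V ∧
      ∀ s ∈ V, σ s ∈ R ∧ (σ s).base = s

theorem FrameSpace.smul_left_injective {w : FrameSpace n A} {g k : AutMat n}
    (h : MulOpposite.op g • w = MulOpposite.op k • w) : g = k := by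
  rw [← diff_eq_of_smul (w := w) (w' := MulOpposite.op k • w) rfl h,
    diff_eq_of_smul (w := w) (w' := MulOpposite.op k • w) rfl rfl]

theorem Extension.mk_smul {G : Type*} [Group G] (H : Subgroup G) {Q : Type*}
    [MulAction (H)ᵐᵒᵖ Q] (x : Q) (h : H) (g : G) :
    Extension.mk H (MulOpposite.op h • x) g = Extension.mk H x (h * g) :=
  (Quotient.sound (s := extensionSetoid H Q) ⟨h, rfl, rfl⟩ : Extension.mk H x (h * g) = _).symm

theorem Extension.smul_mk {G : Type*} [Group G] (H : Subgroup G) {Q : Type*}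
    [MulAction (H)ᵐᵒᵖ Q] (x : Q) (g k : G) :
    MulOpposite.op k • Extension.mk H x g = Extension.mk H x (g * k) := rfl

theorem IsPrincipalBundle.exists_smul_eq {G : Type*} [Group G] [TopologicalSpace G] {P T : Type*}
    [TopologicalSpace P] [TopologicalSpace T] [MulAction Gᵐᵒᵖ P] {p : P → T}
    (hp : IsPrincipalBundle G p) {x y : P} (h : p x = p y) :
    ∃ g : G, MulOpposite.op g • x = y := by
  obtain ⟨e, he, hact⟩ := hp.locally_trivial (p x)
  refine ⟨(e x).2⁻¹ * (e y).2, ?_⟩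
  set g := (e x).2⁻¹ * (e y).2
  have hx : x ∈ e.source := e.mem_source.2 he
  have hy : y ∈ e.source := e.mem_source.2 (h ▸ he)
  have hgx : MulOpposite.op g • x ∈ e.source := e.mem_source.2 (by rw [hp.proj_smul]; exact he)
  refine e.injOn hgx hy (Prod.ext ?_ ?_)
  · exact (e.coe_fst hgx).trans (((hp.proj_smul g x).trans h).trans (e.coe_fst hy).symm)
  · exact (hact x he g).trans (by simp [g])

/-- The adapted frames are the images of the classes `[x, 1]`; local trivializations of `Q`,
inverted at the unit of the group, provide the sections. -/
theorem exists_isReduction_of_reducesTo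
    (h : ReducesTo (autDiag n) (FrameSpace.base : FrameSpace n A → PrimitiveIdeal A)) :
    ∃ R : Set (FrameSpace n A), IsReduction R := by
  obtain ⟨Q, _, _, q, hq, f, hf, hfq⟩ := h
  let H := autDiag n
  refine ⟨Set.range fun x : Q => f (Extension.mk H x 1), ?_, ?_, ?_⟩
  · rintro _ ⟨x, rfl⟩ g hg
    refine ⟨MulOpposite.op (⟨g, hg⟩ : H) • x, ?_⟩
    simp only
    rw [← hf, Extension.mk_smul, Extension.smul_mk, one_mul, mul_one]
  · rintro _ ⟨x, rfl⟩ _ ⟨y, rfl⟩ hb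
    simp only at hb
    rw [hfq, hfq] at hb
    obtain ⟨g, rfl⟩ := hq.exists_smul_eq hb
    refine ⟨g, g.2, ?_⟩
    simp only
    rw [← hf, Extension.mk_smul, Extension.smul_mk, one_mul, mul_one]
  · intro t
    obtain ⟨e, he, -⟩ := hq.locally_trivial t
    have hmk : Continuous fun x : Q => f (Extension.mk H x 1) := by
      refine f.continuous.comp ?_
      exact continuous_quotient_mk'.comp (Continuous.prodMk_left (1 : AutMat n))
    refine ⟨e.baseSet, fun s => f (Extension.mk H (e.invFun (s, 1)) 1), e.open_baseSet, he, ?_, ?_⟩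
    · refine hmk.comp_continuousOn (e.continuousOn_invFun.comp (by fun_prop) ?_)
      intro s hs
      exact e.mem_target.2 hs
    · intro s hs
      refine ⟨⟨_, rfl⟩, ?_⟩
      rw [hfq]
      exact e.proj_symm_apply' hs

namespace IsReduction

variable {R : Set (FrameSpace n A)} (hR : IsReduction R)

/-- The action of `Aut(M_n, D_n)` on adapted frames. -/
noncomputable abbrev mulAction : MulAction (autDiag n)ᵐᵒᵖ R where
  smul g w := ⟨MulOpposite.op (g.unop : AutMat n) • (w : FrameSpace n A),
    hR.smul_mem w w.2 g.unop g.unop.2⟩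
  one_smul _ := rfl
  mul_smul _ _ _ := rfl

include hR

/-- A local section `σ` trivializes: each adapted frame over `V` is `σ · γ` for a unique `γ`, which
depends continuously on the frame by `FrameSpace.tendsto_of_smul_eq`. -/
theorem isPrincipalBundle :
    letI := hR.mulAction
    IsPrincipalBundle (autDiag n) fun w : R => (w : FrameSpace n A).base := by
  let _ := hR.mulAction
  refine ⟨fun _ _ => rfl, fun t => ?_⟩
  obtain ⟨V, σ, hV, htV, hσ, hσR⟩ := hR.exists_section t
  have hγ : ∀ w : R, ∃ g : autDiag n, (w : FrameSpace n A).base ∈ V →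
      MulOpposite.op (g : AutMat n) • σ (w : FrameSpace n A).base = w := by
    intro w
    by_cases hw : (w : FrameSpace n A).base ∈ V
    · obtain ⟨g, hg, h⟩ := hR.exists_smul _ (hσR _ hw).1 w w.2 (hσR _ hw).2
      exact ⟨⟨g, hg⟩, fun _ => h⟩
    · exact ⟨1, fun h => absurd h hw⟩
  choose γ hγ using hγ
  have huniq : ∀ (w : R), (w : FrameSpace n A).base ∈ V → ∀ g : AutMat n,
      MulOpposite.op g • σ (w : FrameSpace n A).base = w → g = γ w := by
    intro w hw g hg
    have hb : (σ (w : FrameSpace n A).base).base = (w : FrameSpace n A).base := (hσR _ hw).2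
    rw [← FrameSpace.diff_eq_of_smul hb hg, FrameSpace.diff_eq_of_smul hb (hγ w hw)]
  classical
  -- Off `V` the value is a dummy; it only has to be some adapted frame.
  let inv : PrimitiveIdeal A × autDiag n → R := fun y =>
    if hy : y.1 ∈ V then ⟨MulOpposite.op (y.2 : AutMat n) • σ y.1,
      hR.smul_mem _ (hσR _ hy).1 _ y.2.2⟩ else ⟨σ t, (hσR t htV).1⟩
  have hinv : ∀ y, y.1 ∈ V → (inv y : FrameSpace n A) = MulOpposite.op (y.2 : AutMat n) • σ y.1 := by
    intro y hy
    simp only [inv, dif_pos hy]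
  have hinvb : ∀ y, y.1 ∈ V → (inv y : FrameSpace n A).base = y.1 := by
    intro y hy
    rw [hinv y hy, FrameSpace.base_smul, (hσR _ hy).2]
  have hbase : Continuous fun w : R => (w : FrameSpace n A).base :=
    FrameSpace.continuous_base.comp continuous_subtype_val
  let e : Bundle.Trivialization (autDiag n) fun w : R => (w : FrameSpace n A).base :=
    { toFun := fun w => ((w : FrameSpace n A).base, γ w)
      invFun := inv
      source := {w | (w : FrameSpace n A).base ∈ V}
      target := V ×ˢ Set.univ
      map_source' := fun w hw => ⟨hw, trivial⟩
      map_target' := fun y hy => by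
        change (inv y : FrameSpace n A).base ∈ V
        rw [hinvb y hy.1]; exact hy.1
      left_inv' := fun w hw => by
        apply Subtype.ext
        exact (hinv ((w : FrameSpace n A).base, γ w) hw).trans (hγ w hw)
      right_inv' := fun y hy => by
        have hb := hinvb y hy.1
        refine Prod.ext hb (Subtype.ext ?_)
        refine (huniq (inv y) (by rw [hb]; exact hy.1) y.2 ?_).symm
        rw [hb, hinv y hy.1]
      open_source := hV.preimage hbase
      open_target := hV.prod isOpen_univ
      continuousOn_toFun := by
        refine hbase.continuousOn.prodMk ?_
        intro w hw
        rw [ContinuousWithinAt, tendsto_subtype_rng]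
        refine FrameSpace.tendsto_of_smul_eq
          (w := fun v : R => σ (v : FrameSpace n A).base)
          (w₀ := σ (w : FrameSpace n A).base) (w' := fun v : R => (v : FrameSpace n A)) ?_
          (continuous_subtype_val.continuousWithinAt) ?_ (hγ w hw)
        · exact ((hσ.continuousAt (hV.mem_nhds hw)).tendsto.comp hbase.continuousAt).mono_left
            nhdsWithin_le_nhds
        · filter_upwards [self_mem_nhdsWithin] with v hv
          exact hγ v hv
      continuousOn_invFun := by
        intro y hy
        rw [ContinuousWithinAt, tendsto_subtype_rng, hinv y hy.1]
        have h1 : Tendsto (fun x : PrimitiveIdeal A × autDiag n =>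
            MulOpposite.op (x.2 : AutMat n) • σ x.1) (𝓝[V ×ˢ Set.univ] y)
            (𝓝 (MulOpposite.op (y.2 : AutMat n) • σ y.1)) := by
          refine FrameSpace.tendsto_smul ?_ ?_
          · exact ((continuous_subtype_val.comp continuous_snd).tendsto y).mono_left
              nhdsWithin_le_nhds
          · exact ((hσ.continuousAt (hV.mem_nhds hy.1)).tendsto.comp
              (continuous_fst.tendsto y)).mono_left nhdsWithin_le_nhds
        refine h1.congr' ?_
        filter_upwards [self_mem_nhdsWithin] with x hx
        exact (hinv x hx.1).symm
      baseSet := V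
      open_baseSet := hV
      source_eq := rfl
      target_eq := rfl
      proj_toFun := fun _ _ => rfl }
  refine ⟨e, htV, fun w hw g => ?_⟩
  change γ (MulOpposite.op g • w) = γ w * g
  apply Subtype.ext
  refine (huniq (MulOpposite.op g • w) hw (γ w * g : AutMat n) ?_).symm
  change MulOpposite.op (γ w * g : AutMat n) • σ (w : FrameSpace n A).base =
    MulOpposite.op (g : AutMat n) • (w : FrameSpace n A)
  conv_rhs => rw [← hγ w hw]
  rw [smul_smul, ← MulOpposite.op_mul]

theorem exists_mem (t : PrimitiveIdeal A) : ∃ w ∈ R, w.base = t := by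
  obtain ⟨V, σ, -, ht, -, h⟩ := hR.exists_section t
  exact ⟨σ t, (h t ht).1, (h t ht).2⟩

/-- The isomorphism is `[w, g] ↦ w · g`: onto because every fibre has an adapted frame, injective
because two of them differ by the subgroup. Its inverse is continuous since, locally, it is the
class of `σ` and the translation from `σ` to the given frame. -/
theorem reducesTo :
    ReducesTo (autDiag n) (FrameSpace.base : FrameSpace n A → PrimitiveIdeal A) := by
  let _ := hR.mulAction
  let H := autDiag n
  have hsm : ∀ (g : H) (w : R), ((MulOpposite.op g • w : R) : FrameSpace n A) =
      MulOpposite.op (g : AutMat n) • (w : FrameSpace n A) := fun _ _ => rfl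
  refine ⟨R, inferInstance, hR.mulAction, fun w => (w : FrameSpace n A).base,
    hR.isPrincipalBundle, ?_⟩
  let F : Extension H R → FrameSpace n A := Quotient.lift
    (fun y : R × AutMat n => MulOpposite.op y.2 • (y.1 : FrameSpace n A)) (by
      rintro ⟨x, g⟩ ⟨y, k⟩ ⟨h, h₁, h₂⟩
      simp only at h₁ h₂
      rw [h₁, h₂, hsm, smul_smul, ← MulOpposite.op_mul])
  have hF : ∀ (x : R) (g : AutMat n),
      F (Extension.mk H x g) = MulOpposite.op g • (x : FrameSpace n A) := fun _ _ => rfl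
  have hFc : Continuous F := by
    refine Continuous.quotient_lift ?_ _
    rw [continuous_iff_continuousAt]
    intro y
    exact FrameSpace.tendsto_smul (continuous_snd.tendsto y)
      ((continuous_subtype_val.comp continuous_fst).tendsto y)
  have hinj : Function.Injective F := by
    rintro ⟨x, g⟩ ⟨y, k⟩ h
    change MulOpposite.op g • (x : FrameSpace n A) = MulOpposite.op k • (y : FrameSpace n A) at h
    have hb : (x : FrameSpace n A).base = (y : FrameSpace n A).base := by
      rw [← FrameSpace.base_smul (x : FrameSpace n A) g, h, FrameSpace.base_smul]
    obtain ⟨d, hd, hxy⟩ := hR.exists_smul x x.2 y y.2 hb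
    refine Quotient.sound ⟨⟨d, hd⟩, Subtype.ext hxy.symm, ?_⟩
    rw [← hxy, smul_smul, ← MulOpposite.op_mul] at h
    exact FrameSpace.smul_left_injective h
  have hsurj : Function.Surjective F := by
    intro w
    obtain ⟨x, hx, hb⟩ := hR.exists_mem w.base
    exact ⟨Extension.mk H ⟨x, hx⟩ (FrameSpace.diff x w hb), FrameSpace.smul_diff x w hb⟩
  let E : Extension H R ≃ FrameSpace n A := Equiv.ofBijective F ⟨hinj, hsurj⟩
  have hE : Continuous E.symm := by
    rw [continuous_iff_continuousAt]
    intro w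
    obtain ⟨V, σ, hV, hwV, hσ, hσR⟩ := hR.exists_section w.base
    have hev : ∀ᶠ v in 𝓝 w, v.base ∈ V :=
      FrameSpace.continuous_base.continuousAt.eventually (hV.mem_nhds hwV)
    have hγ : ∀ v : FrameSpace n A, ∃ y : R × AutMat n, v.base ∈ V →
        (y.1 : FrameSpace n A) = σ v.base ∧ MulOpposite.op y.2 • σ v.base = v := by
      intro v
      by_cases hv : v.base ∈ V
      · exact ⟨(⟨σ v.base, (hσR _ hv).1⟩, FrameSpace.diff _ v (hσR _ hv).2), fun _ =>
          ⟨rfl, FrameSpace.smul_diff _ v (hσR _ hv).2⟩⟩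
      · exact ⟨(⟨σ w.base, (hσR _ hwV).1⟩, 1), fun h => absurd h hv⟩
    choose γ hγ using hγ
    have hsymm : ∀ v : FrameSpace n A, v.base ∈ V →
        E.symm v = Extension.mk H (γ v).1 (γ v).2 := by
      intro v hv
      rw [Equiv.symm_apply_eq]
      change v = MulOpposite.op (γ v).2 • ((γ v).1 : FrameSpace n A)
      rw [(hγ v hv).1, (hγ v hv).2]
    have hσt : Tendsto (fun v : FrameSpace n A => σ v.base) (𝓝 w) (𝓝 (σ w.base)) :=
      (hσ.continuousAt (hV.mem_nhds hwV)).tendsto.comp FrameSpace.continuous_base.continuousAt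
    have h1 : Tendsto γ (𝓝 w) (𝓝 (γ w)) := by
      rw [Prod.tendsto_iff]
      constructor
      · rw [tendsto_subtype_rng, (hγ w hwV).1]
        refine hσt.congr' ?_
        filter_upwards [hev] with v hv
        exact (hγ v hv).1.symm
      · refine FrameSpace.tendsto_of_smul_eq hσt tendsto_id ?_ (hγ w hwV).2
        filter_upwards [hev] with v hv
        exact (hγ v hv).2
    have h2 : Tendsto (fun v => Extension.mk H (γ v).1 (γ v).2) (𝓝 w)
        (𝓝 (Extension.mk H (γ w).1 (γ w).2)) :=
      ((continuous_quotient_mk' (s := extensionSetoid H R)).tendsto (γ w)).comp h1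
    rw [ContinuousAt, hsymm w hwV]
    refine h2.congr' ?_
    filter_upwards [hev] with v hv
    exact (hsymm v hv).symm
  refine ⟨⟨E, hFc, hE⟩, ?_, ?_⟩
  · rintro g ⟨x, k⟩
    change MulOpposite.op (k * g) • (x : FrameSpace n A) =
      MulOpposite.op g • MulOpposite.op k • (x : FrameSpace n A)
    rw [smul_smul, ← MulOpposite.op_mul]
  · intro x g
    rfl

end IsReduction

end Reduction

/-! ### Sections adapted to a reduction -/

section Adapted

open scoped Matrix.Norms.L2Operator

open PrimitiveIdeal Filter

variable {n : ℕ}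

/-- The diagonal part of a matrix. -/
def diagPart (x : Mat n) : Mat n := Matrix.diagonal x.diag

theorem isDiag_diagPart (x : Mat n) : (diagPart x).IsDiag := Matrix.isDiag_diagonal _

theorem diagPart_eq_self {x : Mat n} (hx : x.IsDiag) : diagPart x = x := hx.diagonal_diag

theorem diagPart_add (x y : Mat n) : diagPart (x + y) = diagPart x + diagPart y := by
  simp [diagPart, Matrix.diag_add]

theorem diagPart_sub (x y : Mat n) : diagPart (x - y) = diagPart x - diagPart y := by
  simp [diagPart, Matrix.diag_sub]

theorem diagPart_smul (c : ℂ) (x : Mat n) : diagPart (c • x) = c • diagPart x := by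
  simp [diagPart, Matrix.diag_smul, Matrix.diagonal_smul]

theorem diagPart_mul_left {d : Mat n} (hd : d.IsDiag) (x : Mat n) :
    diagPart (d * x) = d * diagPart x := by
  rw [← hd.diagonal_diag]
  ext i j
  by_cases h : i = j
  · subst h; simp [diagPart]
  · simp [diagPart, h]

theorem diagPart_mul_right {d : Mat n} (hd : d.IsDiag) (x : Mat n) :
    diagPart (x * d) = diagPart x * d := by
  rw [← hd.diagonal_diag]
  ext i j
  by_cases h : i = j
  · subst h; simp [diagPart]
  · simp [diagPart, h]

theorem continuous_diagPart : Continuous (diagPart : Mat n → Mat n) := by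
  unfold diagPart
  fun_prop

/-- A diagonal entry is a coordinate of the image of a unit basis vector. -/
theorem norm_diagPart_le (x : Mat n) : ‖diagPart x‖ ≤ ‖x‖ := by
  rw [diagPart, Matrix.l2_opNorm_diagonal]
  refine (pi_norm_le_iff_of_nonneg (norm_nonneg _)).2 fun i => ?_
  have h1 := Matrix.l2_opNorm_mulVec x (EuclideanSpace.single i (1 : ℂ))
  rw [PiLp.norm_single, norm_one, mul_one] at h1
  refine le_trans ?_ h1
  have h2 := PiLp.norm_apply_le (p := 2) (WithLp.toLp 2 (x.mulVec (EuclideanSpace.single i (1 : ℂ)))) i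
  simpa using h2

/-- The diagonal entries of `x* x` are the squared norms of the columns of `x`. -/
theorem diagPart_star_mul_self_eq_zero {x : Mat n} (h : diagPart (star x * x) = 0) : x = 0 := by
  ext i j
  have h1 : (star x * x) j j = 0 := by
    have := congrFun (congrFun h j) j
    simpa [diagPart] using this
  have h2 : ∑ k, ‖x k j‖ ^ 2 = 0 := by
    have e : (star x * x) j j = ((∑ k, ‖x k j‖ ^ 2 : ℝ) : ℂ) := by
      rw [Matrix.mul_apply]
      push_cast
      refine Finset.sum_congr rfl fun k _ => ?_
      rw [Matrix.star_apply, RCLike.star_def, ← Complex.normSq_eq_conj_mul_self,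
        Complex.normSq_eq_norm_sq]
      push_cast; rfl
    rw [e] at h1
    exact_mod_cast h1
  have h3 := (Finset.sum_eq_zero_iff_of_nonneg fun k _ => by positivity).1 h2 i (Finset.mem_univ i)
  simpa using h3

theorem Matrix.IsDiag.mul_comm_of_isDiag {x y : Mat n} (hx : x.IsDiag) (hy : y.IsDiag) :
    x * y = y * x := by
  rw [← hx.diagonal_diag, ← hy.diagonal_diag, Matrix.diagonal_mul_diagonal,
    Matrix.diagonal_mul_diagonal]
  congr 1
  funext k
  exact mul_comm _ _

theorem isDiag_single (i : Fin n) (c : ℂ) : (Matrix.single i i c : Mat n).IsDiag := by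
  intro k l hkl
  rw [Matrix.single_apply, if_neg]
  rintro ⟨rfl, rfl⟩
  exact hkl rfl

theorem isDiag_map {g : AutMat n} (hg : g ∈ autDiag n) {x : Mat n} (hx : x.IsDiag) :
    (g x).IsDiag := by
  have h : (fun x => g x) '' diagMat n = diagMat n := hg
  have : g x ∈ (fun x => g x) '' diagMat n := ⟨x, hx, rfl⟩
  rw [h] at this
  exact this

/-- The off-diagonal part is the sum of the `e x - e x e` over the diagonal units `e`. Under `g`
each `e` becomes a diagonal idempotent `q`, and `q y - q y q` has diagonal part `q d - q d q = 0`,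
because `d` commutes with `q`. -/
theorem diagPart_map {g : AutMat n} (hg : g ∈ autDiag n) (x : Mat n) :
    diagPart (g x) = g (diagPart x) := by
  have hsum : x - diagPart x =
      ∑ i, (Matrix.single i i (1 : ℂ) * x - Matrix.single i i (1 : ℂ) * x * Matrix.single i i 1) := by
    rw [Finset.sum_sub_distrib, ← Finset.sum_mul, Matrix.sum_single_one, one_mul]
    congr 1
    ext k l
    rw [Matrix.sum_apply]
    by_cases hkl : k = l
    · subst hkl
      rw [Finset.sum_eq_single k]
      · simp [diagPart]
      · intro i _ hi
        rw [Matrix.mul_single_apply_of_ne (hbj := hi.symm)]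
      · simp
    · rw [Finset.sum_eq_zero]
      · simp [diagPart, hkl]
      · intro i _
        by_cases hil : l = i
        · subst hil
          rw [Matrix.mul_single_apply_same, Matrix.single_mul_apply_of_ne (h := hkl)]
          simp
        · rw [Matrix.mul_single_apply_of_ne (hbj := hil)]
  have hzero : diagPart (g (x - diagPart x)) = 0 := by
    rw [hsum, map_sum]
    have hadd : ∀ (F : Finset (Fin n)) (f : Fin n → Mat n),
        diagPart (∑ i ∈ F, f i) = ∑ i ∈ F, diagPart (f i) := by
      intro F f
      classical
      induction F using Finset.induction_on with
      | empty => simp [diagPart]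
      | insert i F hi ih => rw [Finset.sum_insert hi, Finset.sum_insert hi, diagPart_add, ih]
    rw [hadd]
    refine Finset.sum_eq_zero fun i _ => ?_
    have hgd := isDiag_map hg (isDiag_single i 1)
    have hidem : (Matrix.single i i (1 : ℂ) : Mat n) * Matrix.single i i 1 = Matrix.single i i 1 := by
      rw [Matrix.single_mul_single_same, one_mul]
    have e1 : g (Matrix.single i i (1 : ℂ)) * g (Matrix.single i i (1 : ℂ)) =
        g (Matrix.single i i (1 : ℂ)) := by rw [← map_mul, hidem]
    rw [map_sub, map_mul, map_mul, map_mul, diagPart_sub, diagPart_mul_right hgd, diagPart_mul_left hgd]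
    rw [mul_assoc, (isDiag_diagPart _).mul_comm_of_isDiag hgd, ← mul_assoc, e1, sub_self]
  have : g x = g (diagPart x) + g (x - diagPart x) := by rw [← map_add]; congr 1; abel
  rw [this, diagPart_add, hzero, add_zero, diagPart_eq_self (isDiag_map hg (isDiag_diagPart x))]

variable {A : Type u} [NonUnitalCStarAlgebra A]
variable (hn : 1 ≤ n) (hA : IsHomogeneous n A) {R : Set (FrameSpace n A)} (hR : IsReduction R)

include hn hA hR

namespace IsReduction

omit hn hA in
theorem ext_coord {a b : A} (h : ∀ w ∈ R, w.coord a = w.coord b) : a = b := by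
  refine eq_of_forall_value fun t => ?_
  obtain ⟨w, hw, rfl⟩ := hR.exists_mem t
  rw [← FrameSpace.frame_coord, h w hw, FrameSpace.frame_coord]

theorem norm_le {a : A} {r : ℝ} (hr : 0 < r) (h : ∀ w ∈ R, ‖w.coord a‖ ≤ r) : ‖a‖ ≤ r := by
  refine norm_le_of_forall_value hn hA hr fun t => ?_
  obtain ⟨w, hw, rfl⟩ := hR.exists_mem t
  rw [FrameSpace.norm_value]
  exact h w hw

/-- Continuous functions on the adapted frames which are equivariant and vanish at infinity are given
by elements of `A`. -/
theorem exists_coord_eq (Ψ : FrameSpace n A → Mat n)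
    (heq : ∀ w ∈ R, ∀ g ∈ autDiag n, Ψ (MulOpposite.op g • w) = g.symm (Ψ w))
    (hcont : ContinuousOn Ψ R) (b : A) (hb : ∀ w ∈ R, ‖Ψ w‖ ≤ ‖w.coord b‖) :
    ∃ c : A, ∀ w ∈ R, w.coord c = Ψ w := by
  -- Equality in the total space avoids transport between fibres; equivariance makes the point
  -- independent of the adapted frame.
  have hs : ∀ t : PrimitiveIdeal A, ∃ x : Fibre t, ∀ w ∈ R, w.base = t →
      (⟨t, x⟩ : BundleSpace A) = w.toBundle (Ψ w) := by
    intro t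
    obtain ⟨r, hr, rfl⟩ := hR.exists_mem t
    refine ⟨r.frame (Ψ r), fun w hw hb => ?_⟩
    obtain ⟨g, hg, rfl⟩ := hR.exists_smul r hr w hw hb.symm
    rw [FrameSpace.toBundle_smul, heq r hr g hg, StarAlgEquiv.apply_symm_apply]
    rfl
  choose s hs using hs
  have hsw : ∀ w ∈ R, s w.base = w.frame (Ψ w) := by
    intro w hw
    have := hs w.base w hw rfl
    simp only [FrameSpace.toBundle, BundleSpace.mk.injEq, heq_eq_eq, true_and] at this
    exact this
  obtain ⟨c, hc⟩ := _root_.exists_section hn hA s b (by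
      intro t
      obtain ⟨w, hw, rfl⟩ := hR.exists_mem t
      rw [hsw w hw, FrameSpace.norm_frame, FrameSpace.norm_value]
      exact hb w hw) (by
      intro t₀ ε hε
      obtain ⟨V, σ, hV, htV, hσ, hσR⟩ := hR.exists_section t₀
      obtain ⟨a, ha⟩ := (σ t₀).coord_surjective (Ψ (σ t₀))
      refine ⟨a, ?_⟩
      have h1 : Tendsto σ (𝓝[V] t₀) (𝓝[R] (σ t₀)) :=
        tendsto_nhdsWithin_iff.2 ⟨hσ t₀ htV, by
          filter_upwards [self_mem_nhdsWithin] with t ht using (hσR t ht).1⟩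
      rw [hV.nhdsWithin_eq htV] at h1
      have h2 : Tendsto (fun t => Ψ (σ t) - (σ t).coord a) (𝓝 t₀) (𝓝 0) := by
        have := ((hcont (σ t₀) (hσR t₀ htV).1).tendsto.comp h1).sub
          (((FrameSpace.continuous_coord a).tendsto (σ t₀)).comp
            (h1.mono_right nhdsWithin_le_nhds))
        rw [ha, sub_self] at this
        exact this
      have h3 := (h2.norm).eventually (gt_mem_nhds (by simpa using hε : ‖(0 : Mat n)‖ < ε))
      filter_upwards [h3, hV.mem_nhds htV] with t ht htV
      have hb := (hσR t htV).2
      have key : ‖s (σ t).base - value a (σ t).base‖ < ε := by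
        rw [hsw _ (hσR t htV).1, ← FrameSpace.frame_coord, ← FrameSpace.frame_sub,
          FrameSpace.norm_frame]
        exact ht
      rwa [hb] at key)
  refine ⟨c, fun w hw => ?_⟩
  rw [FrameSpace.coord_def, hc, hsw w hw, StarAlgEquiv.symm_apply_apply]

omit hR in
/-- Sections which are given in an adapted local frame, cut off by a central element. -/
theorem exists_local {V : Set (PrimitiveIdeal A)} {σ : PrimitiveIdeal A → FrameSpace n A}
    (hV : IsOpen V) (hσ : ContinuousOn σ V) (hσb : ∀ s ∈ V, (σ s).base = s) {z : A}
    {ζ : PrimitiveIdeal A → ℝ} (hz : IsScalar n z ζ) (hζ : ∀ t, 0 ≤ ζ t) (hζV : ∀ t ∉ V, ζ t = 0)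
    (Θ : Mat n → Mat n) (hΘ : Continuous Θ) (hΘn : ∀ x, ‖Θ x‖ ≤ ‖x‖) (a : A) :
    ∃ m : A, (∀ t ∈ V, (σ t).coord m = ((ζ t : ℝ) : ℂ) • Θ ((σ t).coord a)) ∧
      ∀ t ∉ V, value m t = 0 := by
  have hs : ∀ t : PrimitiveIdeal A, ∃ x : Fibre t,
      (t ∈ V → (⟨t, x⟩ : BundleSpace A) =
        (σ t).toBundle (((ζ t : ℝ) : ℂ) • Θ ((σ t).coord a))) ∧ (t ∉ V → x = 0) := by
    intro t
    by_cases ht : t ∈ V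
    · have hb := hσb t ht
      generalize ((ζ t : ℝ) : ℂ) • Θ ((σ t).coord a) = y
      generalize σ t = w at hb
      subst hb
      exact ⟨w.frame y, fun _ => rfl, fun h => absurd ht h⟩
    · exact ⟨0, fun h => absurd h ht, fun _ => rfl⟩
  choose s hs hs0 using hs
  have hsw : ∀ t ∈ V, s (σ t).base = (σ t).frame (((ζ t : ℝ) : ℂ) • Θ ((σ t).coord a)) := by
    intro t ht
    have h1 := hs t ht
    have hb := hσb t ht
    have h2 : (⟨(σ t).base, s (σ t).base⟩ : BundleSpace A) = ⟨t, s t⟩ := by rw [hb]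
    rw [h1] at h2
    simp only [FrameSpace.toBundle, BundleSpace.mk.injEq, heq_eq_eq, true_and] at h2
    exact h2
  have hzn : ∀ w : FrameSpace n A, ‖value (z * a) w.base‖ = ζ w.base * ‖w.coord a‖ := by
    intro w
    rw [FrameSpace.norm_value, hz.coord_mul, norm_smul, Complex.norm_real,
      Real.norm_of_nonneg (hζ _)]
  have hbound : ∀ t, ‖s t‖ ≤ ‖value (z * a) t‖ := by
    intro t
    by_cases ht : t ∈ V
    · have h1 : ‖s (σ t).base‖ ≤ ‖value (z * a) (σ t).base‖ := by
        rw [hsw t ht, FrameSpace.norm_frame, hzn, norm_smul, Complex.norm_real,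
          Real.norm_of_nonneg (hζ _), hσb t ht]
        exact mul_le_mul_of_nonneg_left (hΘn _) (hζ _)
      rwa [hσb t ht] at h1
    · rw [hs0 t ht, norm_zero]
      exact norm_nonneg _
  obtain ⟨m, hm⟩ := _root_.exists_section hn hA s (z * a) hbound (by
    intro t₀ ε hε
    by_cases ht₀ : t₀ ∈ V
    · obtain ⟨c, hc⟩ := (σ t₀).coord_surjective (((ζ t₀ : ℝ) : ℂ) • Θ ((σ t₀).coord a))
      refine ⟨c, ?_⟩
      have h1 : Tendsto σ (𝓝 t₀) (𝓝 (σ t₀)) := hσ.continuousAt (hV.mem_nhds ht₀)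
      have hco : ∀ x : A, Tendsto (fun t => (σ t).coord x) (𝓝 t₀) (𝓝 ((σ t₀).coord x)) := fun x =>
        FrameSpace.tendsto_nhds_iff.1 h1 x
      have h2 : Tendsto (fun t => ((ζ t : ℝ) : ℂ) • Θ ((σ t).coord a) - (σ t).coord c) (𝓝 t₀)
          (𝓝 0) := by
        have := (((Complex.continuous_ofReal.comp (hz.continuous hn hA hζ)).tendsto t₀).smul
          ((hΘ.tendsto _).comp (hco a))).sub (hco c)
        rw [hc] at this
        simpa using this
      have h3 := (h2.norm).eventually (gt_mem_nhds (by simpa using hε : ‖(0 : Mat n)‖ < ε))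
      filter_upwards [h3, hV.mem_nhds ht₀] with t ht htV
      have key : ‖s (σ t).base - value c (σ t).base‖ < ε := by
        rw [hsw t htV, ← FrameSpace.frame_coord, ← FrameSpace.frame_sub, FrameSpace.norm_frame]
        exact ht
      rwa [hσb t htV] at key
    -- Outside `V` zero is a good approximation: the section is dominated by the continuous function
    -- `‖(z a)(t)‖`, which vanishes at `t₀`.
    · refine ⟨0, ?_⟩
      have h0 : ‖value (z * a) t₀‖ = 0 := by
        obtain ⟨w, rfl⟩ := hA.exists_frame hn t₀
        rw [hzn, hζV _ ht₀, zero_mul]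
      have h1 := ((continuous_norm_value hn hA (z * a)).tendsto t₀).eventually
        (gt_mem_nhds (by rw [h0]; exact hε))
      filter_upwards [h1] with t ht
      rw [value_zero, sub_zero]
      exact (hbound t).trans_lt ht)
  refine ⟨m, fun t ht => ?_, fun t ht => by rw [hm, hs0 t ht]⟩
  rw [FrameSpace.coord_def, hm, hsw t ht, StarAlgEquiv.symm_apply_apply]

end IsReduction

end Adapted

/-! ### The Cartan subalgebra of a reduction -/

section OfReduction

open scoped Matrix.Norms.L2Operator

open PrimitiveIdeal Filter

variable {n : ℕ}

theorem Matrix.IsDiag.mul_isDiag {x y : Mat n} (hx : x.IsDiag) (hy : y.IsDiag) : (x * y).IsDiag := by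
  rw [← hx.diagonal_diag, ← hy.diagonal_diag, Matrix.diagonal_mul_diagonal]
  exact Matrix.isDiag_diagonal _

theorem Matrix.IsDiag.star_isDiag {x : Mat n} (hx : x.IsDiag) : (star x).IsDiag :=
  hx.conjTranspose

theorem isClosed_isDiag : IsClosed {x : Mat n | x.IsDiag} := by
  have : {x : Mat n | x.IsDiag} = {x | diagPart x = x} := by
    ext x
    exact ⟨diagPart_eq_self, fun h => h ▸ isDiag_diagPart x⟩
  rw [this]
  exact isClosed_eq continuous_diagPart continuous_id

theorem isDiag_of_commute_single {x : Mat n}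
    (h : ∀ i, x * Matrix.single i i 1 = Matrix.single i i 1 * x) : x.IsDiag := by
  intro i j hij
  have := congrFun (congrFun (h j) i) j
  rwa [Matrix.mul_single_apply_same, Matrix.single_mul_apply_of_ne (h := hij), mul_one] at this

theorem exists_diagPart_star_mul_self (x : Mat n) :
    ∃ d : Mat n, d.IsDiag ∧ diagPart (star x * x) = star d * d := by
  refine ⟨Matrix.diagonal fun j => ((√(∑ k, ‖x k j‖ ^ 2) : ℝ) : ℂ), Matrix.isDiag_diagonal _, ?_⟩
  rw [Matrix.star_eq_conjTranspose (Matrix.diagonal _), Matrix.diagonal_conjTranspose,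
    Matrix.diagonal_mul_diagonal, diagPart]
  congr 1
  funext j
  have h0 : (0 : ℝ) ≤ ∑ k, ‖x k j‖ ^ 2 := Finset.sum_nonneg fun k _ => by positivity
  rw [Pi.star_apply, RCLike.star_def, Complex.conj_ofReal, ← Complex.ofReal_mul,
    Real.mul_self_sqrt h0, Matrix.diag_apply, Matrix.mul_apply]
  push_cast
  refine Finset.sum_congr rfl fun k _ => ?_
  rw [Matrix.star_apply, RCLike.star_def, ← Complex.normSq_eq_conj_mul_self,
    Complex.normSq_eq_norm_sq]
  push_cast
  rfl

/-- A matrix whose conjugates of diagonal matrices stay diagonal because it has at most one nonzero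
entry. -/
theorem isDiag_single_mul_mul (j k : Fin n) (x y : Mat n) :
    (Matrix.single j j 1 * x * Matrix.single k k 1 * y *
      star (Matrix.single j j 1 * x * Matrix.single k k 1)).IsDiag := by
  have e : Matrix.single j j 1 * x * Matrix.single k k 1 * y *
      star (Matrix.single j j 1 * x * Matrix.single k k 1) =
      Matrix.single j j 1 * (x * Matrix.single k k 1 * y * Matrix.single k k 1 * star x) *
        Matrix.single j j 1 := by
    simp only [star_mul, Matrix.star_eq_conjTranspose, Matrix.conjTranspose_single, star_one, mul_assoc]
  rw [e, Matrix.single_mul_mul_single]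
  exact isDiag_single j _

variable {A : Type u} [NonUnitalCStarAlgebra A]

/-- The subalgebra of the sections which are diagonal in the adapted frames. -/
def adaptedSubalgebra (R : Set (FrameSpace n A)) : NonUnitalStarSubalgebra ℂ A where
  carrier := {a | ∀ w ∈ R, (w.coord a).IsDiag}
  add_mem' := fun ha hb w hw => by rw [map_add]; exact (ha w hw).add (hb w hw)
  zero_mem' := fun w _ => by rw [map_zero]; exact Matrix.isDiag_zero
  mul_mem' := fun ha hb w hw => by rw [map_mul]; exact (ha w hw).mul_isDiag (hb w hw)
  smul_mem' := fun c a ha w hw => by rw [map_smul]; exact (ha w hw).smul c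
  star_mem' := fun ha w hw => by rw [map_star]; exact (ha w hw).star_isDiag

theorem mem_adaptedSubalgebra {R : Set (FrameSpace n A)} {a : A} :
    a ∈ adaptedSubalgebra R ↔ ∀ w ∈ R, (w.coord a).IsDiag := Iff.rfl

theorem isClosed_adaptedSubalgebra (R : Set (FrameSpace n A)) :
    IsClosed (adaptedSubalgebra R : Set A) := by
  have : (adaptedSubalgebra R : Set A) = ⋂ w ∈ R, w.coord ⁻¹' {x : Mat n | x.IsDiag} := by
    ext a
    simp [mem_adaptedSubalgebra]
  rw [this]
  exact isClosed_biInter fun w _ =>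
    isClosed_isDiag.preimage (NonUnitalStarAlgHom.continuous_of_cstar w.coord)

theorem IsScalar.mem_adaptedSubalgebra {R : Set (FrameSpace n A)} {z : A}
    {ζ : PrimitiveIdeal A → ℝ} (h : IsScalar n z ζ) : z ∈ adaptedSubalgebra R := fun w _ => by
  rw [h]
  exact Matrix.isDiag_one.smul _

variable (hn : 1 ≤ n) (hA : IsHomogeneous n A) {R : Set (FrameSpace n A)} (hR : IsReduction R)

include hn hA hR

namespace IsReduction

/-- The diagonal part commutes with `Aut(M_n, D_n)`, so it does not depend on the adapted frame, and
it is dominated by `a` itself. -/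
theorem exists_diagPart (a : A) : ∃ c : A, ∀ w ∈ R, w.coord c = diagPart (w.coord a) := by
  refine exists_coord_eq hn hA hR (fun w => diagPart (w.coord a)) (fun w _ g hg => ?_)
    (continuous_diagPart.comp (FrameSpace.continuous_coord a)).continuousOn a
    fun w _ => norm_diagPart_le _
  rw [FrameSpace.coord_smul]
  exact diagPart_map (inv_mem hg) _

theorem exists_condExp : ∃ E : A →ₗ[ℂ] adaptedSubalgebra R,
    ∀ a, ∀ w ∈ R, w.coord (E a : A) = diagPart (w.coord a) := by
  choose E hE using exists_diagPart hn hA hR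
  refine ⟨⟨⟨fun a => ⟨E a, fun w hw => by rw [hE a w hw]; exact isDiag_diagPart _⟩,
    fun a b => ?_⟩, fun c a => ?_⟩, hE⟩
  · refine Subtype.ext (hR.ext_coord fun w hw => ?_)
    change w.coord (E (a + b)) = w.coord (E a + E b)
    rw [map_add, hE _ w hw, hE _ w hw, hE _ w hw, map_add, diagPart_add]
  · refine Subtype.ext (hR.ext_coord fun w hw => ?_)
    change w.coord (E (c • a)) = w.coord (c • E a)
    rw [map_smul, hE _ w hw, hE _ w hw, map_smul, diagPart_smul]

theorem exists_isFaithfulCondExp :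
    ∃ E : A →ₗ[ℂ] adaptedSubalgebra R, IsFaithfulCondExp (adaptedSubalgebra R) E := by
  obtain ⟨E, hE⟩ := exists_condExp hn hA hR
  refine ⟨E, ?_, ?_, ?_, ?_, ?_, ?_⟩
  · intro b
    refine Subtype.ext (hR.ext_coord fun w hw => ?_)
    rw [hE _ w hw, diagPart_eq_self (b.2 w hw)]
  · intro a
    rcases eq_or_ne a 0 with rfl | ha
    · simp
    · refine norm_le hn hA hR (norm_pos_iff.2 ha) fun w hw => ?_
      change ‖w.coord (E a : A)‖ ≤ ‖a‖
      rw [hE a w hw]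
      exact (norm_diagPart_le _).trans (NonUnitalStarAlgHom.norm_apply_le w.coord a)
  · intro a
    set y : A := (E (star a * a) : A) with hy
    have hyw : ∀ w ∈ R, ∃ d : Mat n, w.coord y = star d * d := by
      intro w hw
      obtain ⟨d, -, hd⟩ := exists_diagPart_star_mul_self (w.coord a)
      exact ⟨d, by rw [hy, hE _ w hw, map_mul, map_star, hd]⟩
    have hys : IsSelfAdjoint y := by
      refine hR.ext_coord fun w hw => ?_
      obtain ⟨d, hd⟩ := hyw w hw
      rw [map_star, hd, star_mul, star_star]
    -- The square root witnessing positivity is taken inside the closed subalgebra by functional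
    -- calculus. The absolute value is harmless: `y` is positive in every adapted frame, so `|y| =
    -- y`.
    have hc : Continuous fun x : ℝ => √|x| := by fun_prop
    have : IsClosed (adaptedSubalgebra R : Set A) := isClosed_adaptedSubalgebra R
    have hbs : star (cfcₙ (fun x : ℝ => √|x|) y) = cfcₙ (fun x : ℝ => √|x|) y :=
      (cfcₙ_predicate (fun x : ℝ => √|x|) y : IsSelfAdjoint _)
    refine ⟨⟨cfcₙ (fun x : ℝ => √|x|) y, cfcₙ_mem (𝕜' := ℂ) _ (E (star a * a)).2⟩, ?_⟩
    refine Subtype.ext ?_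
    change y = star (cfcₙ (fun x : ℝ => √|x|) y) * cfcₙ (fun x : ℝ => √|x|) y
    rw [hbs, ← cfcₙ_mul (fun x : ℝ => √|x|) (fun x : ℝ => √|x|) y hc.continuousOn (by simp)
      hc.continuousOn (by simp)]
    simp only [Real.mul_self_sqrt (abs_nonneg _)]
    refine hR.ext_coord fun w hw => ?_
    obtain ⟨d, hd⟩ := hyw w hw
    have hm := w.coord.map_cfcₙ (fun x : ℝ => |x|) y continuous_abs.continuousOn (by simp)
      (NonUnitalStarAlgHom.continuous_of_cstar w.coord) hys (hys.map w.coord)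
    rw [hm, hd]
    have hsa : IsSelfAdjoint (star d * d) := IsSelfAdjoint.star_mul_self d
    conv_lhs => rw [← cfcₙ_id' ℝ (star d * d) hsa]
    refine cfcₙ_congr fun x hx => ?_
    rw [quasispectrum_eq_spectrum_union_zero] at hx
    rcases hx with hx | hx
    · exact (abs_of_nonneg (spectrum_star_mul_self_nonneg x hx)).symm
    · rw [Set.mem_singleton_iff.1 hx]; simp
  · intro b a
    refine Subtype.ext (hR.ext_coord fun w hw => ?_)
    change _ = w.coord ((b : A) * (E a : A))
    rw [hE _ w hw, map_mul, map_mul, hE _ w hw, diagPart_mul_left (b.2 w hw)]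
  · intro a b
    refine Subtype.ext (hR.ext_coord fun w hw => ?_)
    change _ = w.coord ((E a : A) * (b : A))
    rw [hE _ w hw, map_mul, map_mul, hE _ w hw, diagPart_mul_right (b.2 w hw)]
  · intro a ha
    refine hR.ext_coord fun w hw => ?_
    rw [map_zero]
    refine diagPart_star_mul_self_eq_zero ?_
    rw [← map_star, ← map_mul, ← hE _ w hw, ha]
    exact map_zero _

theorem exists_mem_coord_eq {w : FrameSpace n A} (hw : w ∈ R) {x : Mat n} (hx : x.IsDiag) :
    ∃ b ∈ adaptedSubalgebra R, w.coord b = x := by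
  obtain ⟨a, rfl⟩ := w.coord_surjective x
  obtain ⟨b, hb⟩ := exists_diagPart hn hA hR a
  refine ⟨b, fun w hw => ?_, ?_⟩
  · rw [hb w hw]
    exact isDiag_diagPart _
  · rw [hb w hw, diagPart_eq_self hx]

/-- In an adapted frame every diagonal matrix unit is the value of an element of the subalgebra, and
only diagonal matrices commute with all of these. -/
theorem maximal_adaptedSubalgebra : Maximal (fun C : NonUnitalStarSubalgebra ℂ A =>
    IsClosed (C : Set A) ∧ ∀ x ∈ C, ∀ y ∈ C, x * y = y * x) (adaptedSubalgebra R) := by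
  refine ⟨⟨isClosed_adaptedSubalgebra R, fun x hx y hy => hR.ext_coord fun w hw => ?_⟩, ?_⟩
  · rw [map_mul, map_mul]
    exact (hx w hw).mul_comm_of_isDiag (hy w hw)
  · rintro C ⟨-, hC⟩ hBC c hc w hw
    refine isDiag_of_commute_single fun i => ?_
    obtain ⟨b, hb, hbw⟩ := exists_mem_coord_eq hn hA hR hw (isDiag_single i 1)
    rw [← hbw, ← map_mul, ← map_mul, hC c hc b (hBC hb)]

omit hR in
-- The approximate unit of the subalgebra itself works for `A`: some central `z` in the subalgebra
-- nearly fixes `a`, and `e z` tends to `z`, so `e a` is close to `e z a`, to `z a` and to `a`.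
theorem exists_approximateUnit : ∃ l : Filter A, l.IsApproximateUnit ∧
    ∀ᶠ x in l, x ∈ adaptedSubalgebra R := by
  have hcl : IsClosed (adaptedSubalgebra R : Set A) := isClosed_adaptedSubalgebra R
  let _ := CStarAlgebra.spectralOrder (adaptedSubalgebra R)
  have := CStarAlgebra.spectralOrderedRing (adaptedSubalgebra R)
  have hl := CStarAlgebra.increasingApproximateUnit (adaptedSubalgebra R)
  have hnorm := hl.eventually_norm
  have := hl.neBot
  have happ : ∀ a : A, ∀ ε > 0, ∃ z : adaptedSubalgebra R, ‖a - z * a‖ ≤ ε ∧ (z : A) * a = a * z := by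
    intro a ε hε
    obtain ⟨z, ζ, hz, -, h⟩ := exists_isScalar_mul_approx hn hA a hε isOpen_univ fun _ _ => trivial
    exact ⟨⟨z, hz.mem_adaptedSubalgebra⟩, h, hz.mul_comm hn hA a⟩
  refine ⟨(CStarAlgebra.approximateUnit (adaptedSubalgebra R)).map
    (Subtype.val : adaptedSubalgebra R → A), ⟨fun a => ?_, fun a => ?_⟩, ?_⟩
  · rw [tendsto_map'_iff, Metric.tendsto_nhds]
    intro ε hε
    obtain ⟨z, hz, hc⟩ := happ a (ε / 3) (by positivity)
    have h1 : Tendsto (fun e : adaptedSubalgebra R => ‖a * ((z * e - z : adaptedSubalgebra R) : A)‖)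
        (CStarAlgebra.approximateUnit (adaptedSubalgebra R)) (𝓝 0) := by
      have h2 := hl.tendsto_mul_left z
      have h3 := (continuous_subtype_val.tendsto z).comp h2
      have h4 := ((tendsto_const_nhds (x := a)).mul (h3.sub (tendsto_const_nhds (x := (z : A))))).norm
      simpa using h4
    filter_upwards [hnorm, h1.eventually (gt_mem_nhds (by positivity : 0 < ε / 3))] with e he h
    have e1 : a * (e : A) - a = (a - a * z) * (e : A) + a * ((z * e - z : adaptedSubalgebra R) : A)
        - (a - a * z) := by
      push_cast
      noncomm_ring
    rw [← hc] at e1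
    have e2 : ‖(a - z * a) * (e : A)‖ ≤ ε / 3 := by
      refine (norm_mul_le _ _).trans ((mul_le_of_le_one_right (norm_nonneg _) he).trans hz)
    simp only [Function.comp_apply, dist_eq_norm]
    rw [e1]
    calc _ ≤ ‖(a - z * a) * (e : A)‖ + ‖a * ((z * e - z : adaptedSubalgebra R) : A)‖
          + ‖a - z * a‖ := (norm_sub_le _ _).trans (add_le_add_left (norm_add_le _ _) _)
      _ < ε := by linarith
  · rw [tendsto_map'_iff, Metric.tendsto_nhds]
    intro ε hε
    obtain ⟨z, hz, hc⟩ := happ a (ε / 3) (by positivity)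
    have h1 : Tendsto (fun e : adaptedSubalgebra R => ‖((e * z - z : adaptedSubalgebra R) : A) * a‖)
        (CStarAlgebra.approximateUnit (adaptedSubalgebra R)) (𝓝 0) := by
      have h2 := hl.tendsto_mul_right z
      have h3 := (continuous_subtype_val.tendsto z).comp h2
      have h4 := ((h3.sub (tendsto_const_nhds (x := (z : A)))).mul (tendsto_const_nhds (x := a))).norm
      simpa using h4
    filter_upwards [hnorm, h1.eventually (gt_mem_nhds (by positivity : 0 < ε / 3))] with e he h
    have e1 : (e : A) * a - a = (e : A) * (a - z * a) + ((e * z - z : adaptedSubalgebra R) : A) * a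
        - (a - z * a) := by
      push_cast
      noncomm_ring
    have e2 : ‖(e : A) * (a - z * a)‖ ≤ ε / 3 := by
      refine (norm_mul_le _ _).trans ((mul_le_of_le_one_left (norm_nonneg _) he).trans hz)
    simp only [Function.comp_apply, dist_eq_norm]
    rw [e1]
    calc _ ≤ ‖(e : A) * (a - z * a)‖ + ‖((e * z - z : adaptedSubalgebra R) : A) * a‖
          + ‖a - z * a‖ := (norm_sub_le _ _).trans (add_le_add_left (norm_add_le _ _) _)
      _ < ε := by linarith
  · exact Filter.eventually_map.2 (Eventually.of_forall fun x => x.2)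

omit hn hA in
/-- Membership in the adapted subalgebra can be tested in one adapted frame per point. -/
theorem isDiag_coord_of_isDiag {w w' : FrameSpace n A} (hw : w ∈ R) (hw' : w' ∈ R)
    (hb : w.base = w'.base) {a : A} (h : (w.coord a).IsDiag) : (w'.coord a).IsDiag := by
  obtain ⟨g, hg, rfl⟩ := hR.exists_smul w hw w' hw' hb
  rw [FrameSpace.coord_smul]
  exact isDiag_map (inv_mem hg) h

/-- In a local adapted frame the section has at most one nonzero entry, so conjugating by it keeps
matrices diagonal; the cut-off `ζ` extends it by zero. -/
theorem exists_mem_normalizerSet {V : Set (PrimitiveIdeal A)}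
    {σ : PrimitiveIdeal A → FrameSpace n A} (hV : IsOpen V) (hσ : ContinuousOn σ V)
    (hσR : ∀ s ∈ V, σ s ∈ R ∧ (σ s).base = s) {z : A} {ζ : PrimitiveIdeal A → ℝ}
    (hz : IsScalar n z ζ) (hζ : ∀ t, 0 ≤ ζ t) (hζV : ∀ t ∉ V, ζ t = 0) (a : A) (j k : Fin n) :
    ∃ m ∈ normalizerSet (adaptedSubalgebra R),
      (∀ t ∈ V, (σ t).coord m =
        ((ζ t : ℝ) : ℂ) • (Matrix.single j j 1 * (σ t).coord a * Matrix.single k k 1)) ∧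
      ∀ t ∉ V, value m t = 0 := by
  have hnorm : ∀ i : Fin n, ‖(Matrix.single i i 1 : Mat n)‖ ≤ 1 := by
    intro i
    rw [← Matrix.diagonal_single, Matrix.l2_opNorm_diagonal]
    refine (pi_norm_le_iff_of_nonneg zero_le_one).2 fun l => ?_
    rcases eq_or_ne l i with rfl | h
    · simp
    · simp [h]
  obtain ⟨m, hm, hm0⟩ := exists_local hn hA hV hσ (fun s hs => (hσR s hs).2) hz hζ hζV
    (fun x => Matrix.single j j 1 * x * Matrix.single k k 1) (by fun_prop) (fun x => by
      refine (norm_mul_le _ _).trans ((mul_le_of_le_one_right (norm_nonneg _) (hnorm k)).trans ?_)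
      exact (norm_mul_le _ _).trans (mul_le_of_le_one_left (norm_nonneg _) (hnorm j))) a
  refine ⟨m, fun b _ => ⟨fun w hw => ?_, fun w hw => ?_⟩, hm, hm0⟩
  · by_cases ht : w.base ∈ V
    · refine isDiag_coord_of_isDiag hR (hσR _ ht).1 hw (hσR _ ht).2 ?_
      rw [map_mul, map_mul, map_star, hm _ ht, star_smul, smul_mul_assoc, smul_mul_assoc, mul_smul_comm]
      exact ((isDiag_single_mul_mul j k _ _).smul _).smul _
    · have : w.coord m = 0 := by rw [FrameSpace.coord_def, hm0 _ ht, map_zero]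
      rw [map_mul, map_mul, this, zero_mul, zero_mul]
      exact Matrix.isDiag_zero
  · by_cases ht : w.base ∈ V
    · refine isDiag_coord_of_isDiag hR (hσR _ ht).1 hw (hσR _ ht).2 ?_
      rw [map_mul, map_mul, map_star, hm _ ht, star_smul, smul_mul_assoc, smul_mul_assoc, mul_smul_comm]
      refine Matrix.IsDiag.smul _ (Matrix.IsDiag.smul _ ?_)
      have := isDiag_single_mul_mul k j (star ((σ w.base).coord a)) ((σ w.base).coord b)
      simpa only [star_mul, star_star, Matrix.star_eq_conjTranspose, Matrix.conjTranspose_single,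
        star_one, mul_assoc, Matrix.conjTranspose_conjTranspose] using this
    · have : w.coord m = 0 := by rw [FrameSpace.coord_def, hm0 _ ht, map_zero]
      rw [map_mul, this, mul_zero]
      exact Matrix.isDiag_zero

/-- Up to a small error `a` is a finite sum of localized pieces `z i * a`, and each piece is the sum
of its `n²` corners, which are normalizers. -/
theorem topologicalClosure_adjoin_normalizerSet :
    (NonUnitalStarAlgebra.adjoin ℂ (normalizerSet (adaptedSubalgebra R))).topologicalClosure = ⊤ := by
  refine eq_top_iff.2 fun a _ => ?_
  change a ∈ closure (NonUnitalStarAlgebra.adjoin ℂ (normalizerSet (adaptedSubalgebra R)) : Set A)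
  refine Metric.mem_closure_iff.2 fun ε hε => ?_
  choose V σ hV htV hσ hσR using hR.exists_section
  obtain ⟨F, z, g, hz, hg, hgV, h⟩ := exists_partition_approx hn hA a (half_pos hε) V fun t _ =>
    ⟨hV t, htV t⟩
  refine ⟨(∑ i ∈ F, z i) * a, ?_, by rw [dist_eq_norm]; linarith⟩
  rw [Finset.sum_mul]
  refine sum_mem fun i hi => ?_
  choose m hmem hm hm0 using
    exists_mem_normalizerSet hn hA hR (hV i) (hσ i) (hσR i) (hz i hi) (hg i hi) (hgV i hi) a
  have : z i * a = ∑ j, ∑ k, m j k := by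
    refine eq_of_forall_value fun t => ?_
    by_cases ht : t ∈ V i
    · have hb := (hσR i t ht).2
      suffices H : value (z i * a) (σ i t).base = value (∑ j, ∑ k, m j k) (σ i t).base by
        rwa [hb] at H
      rw [← FrameSpace.frame_coord, ← FrameSpace.frame_coord]
      congr 1
      simp only [map_sum, hm _ _ t ht, ← Finset.smul_sum]
      simp only [← Finset.mul_sum, ← Finset.sum_mul, Matrix.sum_single_one, one_mul, mul_one]
      rw [(hz i hi).coord_mul, hb]
    · obtain ⟨w, rfl⟩ := hA.exists_frame hn t
      rw [← FrameSpace.frame_coord, ← FrameSpace.frame_coord]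
      congr 1
      have : ∀ j k, w.coord (m j k) = 0 := fun j k => by
        rw [FrameSpace.coord_def, hm0 j k _ ht, map_zero]
      simp only [map_sum, this, Finset.sum_const_zero]
      rw [(hz i hi).coord_mul, hgV i hi _ ht, Complex.ofReal_zero, zero_smul]
  rw [this]
  exact sum_mem fun j _ => sum_mem fun k _ => NonUnitalStarAlgebra.subset_adjoin ℂ _ (hmem j k)

theorem isCartanSubalgebra : IsCartanSubalgebra (adaptedSubalgebra R) where
  maximal_abelian := maximal_adaptedSubalgebra hn hA hR
  approximate_unit := exists_approximateUnit hn hA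
  regular := topologicalClosure_adjoin_normalizerSet hn hA hR
  expectation := exists_isFaithfulCondExp hn hA hR

end IsReduction

end OfReduction

/-! ### The fibres of a Cartan subalgebra -/

section Fibres

open scoped Matrix.Norms.L2Operator

open PrimitiveIdeal Filter

variable {n : ℕ}

/-- A commutative *-subalgebra of `M_n` contains a self-adjoint element with as many eigenvalues as
its dimension. -/
theorem exists_isSelfAdjoint_mem_spectrum (D : StarSubalgebra ℂ (Mat n))
    (hD : ∀ x ∈ D, ∀ y ∈ D, x * y = y * x) :
    ∃ h ∈ D, IsSelfAdjoint h ∧ ∀ i < Module.finrank ℂ D, ((i : ℝ) + 1) ∈ spectrum ℝ h := by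
  have hcl : IsClosed (D : Set (Mat n)) :=
    Submodule.closed_of_finiteDimensional (Subalgebra.toSubmodule D.toSubalgebra)
  let _ : CommCStarAlgebra D :=
    { StarSubalgebra.cstarAlgebra D with
      mul_comm := fun x y => Subtype.ext (hD x x.2 y y.2) }
  have hfd : FiniteDimensional ℂ D :=
    inferInstanceAs (FiniteDimensional ℂ (Subalgebra.toSubmodule D.toSubalgebra))
  let X := WeakDual.characterSpace ℂ D
  have hfin : Finite X := by
    refine Finite.of_injective (fun χ : X => WeakDual.CharacterSpace.toAlgHom χ) fun χ χ' h => ?_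
    refine DFunLike.ext _ _ fun x => ?_
    exact DFunLike.congr_fun h x
  have := Fintype.ofFinite X
  let G := gelfandStarTransform D
  -- The Gelfand transform embeds `D` in the functions on its characters.
  have hcard : Module.finrank ℂ D ≤ Fintype.card X := by
    rw [← Module.finrank_fintype_fun_eq_card (R := ℂ)]
    let Φ : D →ₗ[ℂ] (X → ℂ) :=
      { toFun := fun x χ => G x χ
        map_add' := fun x y => by funext χ; rw [map_add]; rfl
        map_smul' := fun c x => by funext χ; rw [map_smul]; rfl }
    refine LinearMap.finrank_le_finrank_of_injective (f := Φ) fun x y hxy => ?_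
    exact EquivLike.injective G (ContinuousMap.ext fun χ => congrFun hxy χ)
  let e := Fintype.equivFin X
  -- Numbering the characters from one gives values at the centres of the bump functions.
  let f : C(X, ℂ) := ⟨fun χ => (((e χ : ℕ) : ℝ) + 1 : ℝ), continuous_of_discreteTopology⟩
  refine ⟨(G.symm f : D), (G.symm f).2, ?_, fun i hi => ?_⟩
  · have hf : star f = f := by
      ext χ
      exact Complex.conj_ofReal _
    have : star (G.symm f) = G.symm f := by rw [← map_star, hf]
    exact congrArg Subtype.val this
  · let χ₀ : X := e.symm ⟨i, hi.trans_le hcard⟩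
    classical
    -- The indicator of `χ₀` is a nonzero element annihilated by `f - (i + 1)`, which is therefore
    -- not invertible.
    let q : C(X, ℂ) := ⟨fun χ => if χ = χ₀ then 1 else 0, continuous_of_discreteTopology⟩
    have hq0 : (G.symm q : Mat n) ≠ 0 := by
      intro h
      have h1 : G.symm q = 0 := Subtype.ext h
      have h2 : q = 0 := by
        rw [← G.apply_symm_apply q, h1, map_zero]
      have := DFunLike.congr_fun h2 χ₀
      simp [q] at this
    have hfq : f * q = (((i : ℝ) + 1 : ℝ) : ℂ) • q := by
      ext χ
      by_cases h : χ = χ₀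
      · subst h
        simp [f, q, χ₀]
      · simp [q, h]
    have hmul : ((G.symm f : D) : Mat n) * (G.symm q : D) =
        (((i : ℝ) + 1 : ℝ) : ℂ) • ((G.symm q : D) : Mat n) := by
      have : G.symm f * G.symm q = (((i : ℝ) + 1 : ℝ) : ℂ) • G.symm q := by
        rw [← map_mul, hfq, map_smul]
      exact congrArg Subtype.val this
    rw [spectrum.mem_iff]
    intro hu
    refine hq0 ((hu.mul_right_eq_zero).1 ?_)
    rw [sub_mul, hmul, Algebra.algebraMap_eq_smul_one, smul_mul_assoc, one_mul, sub_eq_zero]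
    exact (Complex.coe_smul _ _).symm

/-- Testing on the matrix unit at `(a, i)`, where `P i a ≠ 0`, writes `c * P x y` as the product `P
x a * P i y`; the entry `(i, a)` shows `c ≠ 0`. -/
theorem exists_vecMulVec {P : Mat n} (hP : P ≠ 0) (h : ∀ Y, ∃ c : ℂ, P * Y * P = c • P) :
    ∃ u v : Fin n → ℂ, P = Matrix.vecMulVec u v := by
  obtain ⟨i, a, hia⟩ : ∃ i a, P i a ≠ 0 := by
    by_contra! hc
    exact hP (Matrix.ext hc)
  obtain ⟨c, hc⟩ := h (Matrix.single a i 1)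
  have key : ∀ x y, P x a * P i y = c * P x y := fun x y => by
    have := congrFun (congrFun hc x) y
    rwa [Matrix.mul_single_mul_apply] at this
  have hc0 : c ≠ 0 := by
    rintro rfl
    have := key i a
    rw [zero_mul] at this
    exact mul_ne_zero hia hia this
  refine ⟨fun x => c⁻¹ * P x a, fun y => P i y, ?_⟩
  ext x y
  rw [Matrix.vecMulVec_apply, mul_assoc, key, inv_mul_cancel_left₀ hc0]

/-- Each `P i` has rank at most one, and a combination of `k` of them is the identity on an
`n`-dimensional space. -/
theorem le_of_one_mem_span {k : ℕ} {P : Fin k → Mat n} (hP : ∀ i, P i ≠ 0)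
    (h : ∀ i Y, ∃ c : ℂ, P i * Y * P i = c • P i) (h1 : (1 : Mat n) ∈ Submodule.span ℂ (Set.range P)) :
    n ≤ k := by
  choose u v huv using fun i => exists_vecMulVec (hP i) (h i)
  obtain ⟨c, hc⟩ := (Submodule.mem_span_range_iff_exists_fun ℂ).1 h1
  have htop : Submodule.span ℂ (Set.range u) = ⊤ := by
    refine eq_top_iff.2 fun x _ => ?_
    have : x = ∑ i, (c i * (v i ⬝ᵥ x)) • u i := by
      conv_lhs => rw [← Matrix.one_mulVec x, ← hc, Matrix.sum_mulVec]
      refine Finset.sum_congr rfl fun i _ => ?_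
      rw [Matrix.smul_mulVec, huv i, Matrix.vecMulVec_mulVec, mul_smul]
      simp
    rw [this]
    exact sum_mem fun i _ => Submodule.smul_mem _ _ (Submodule.subset_span ⟨i, rfl⟩)
  have h2 := finrank_range_le_card (R := ℂ) u
  rw [Set.finrank, htop, finrank_top, Module.finrank_fintype_fun_eq_card, Fintype.card_fin,
    Fintype.card_fin] at h2
  exact h2

theorem linearIndependent_of_orthogonal {k : ℕ} {P : Fin k → Mat n} (hs : ∀ i, star (P i) = P i)
    (ho : ∀ i j, i ≠ j → P i * P j = 0) (h0 : ∀ i, P i ≠ 0) : LinearIndependent ℂ P := by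
  refine Fintype.linearIndependent_iff.2 fun c hc i => ?_
  have h1 : (∑ j, c j • P j) * P i = c i • (star (P i) * P i) := by
    rw [Finset.sum_mul, Finset.sum_eq_single i]
    · rw [smul_mul_assoc, hs]
    · intro j _ hj
      rw [smul_mul_assoc, ho j i hj, smul_zero]
    · simp
  rw [hc, zero_mul] at h1
  rcases smul_eq_zero.1 h1.symm with h | h
  · exact h
  · exact absurd ((CStarRing.star_mul_self_eq_zero_iff _).1 h) (h0 i)

/-- Multiplying by `P j` isolates the coefficient at `j`; self-adjointness ensures `P j * P j ≠ 0`
unless `P j = 0`. -/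
theorem exists_smul_of_mul_eq_zero {k : ℕ} {P : Fin k → Mat n} (hs : ∀ i, star (P i) = P i)
    (ho : ∀ i j, i ≠ j → P i * P j = 0) {i : Fin k} {x : Mat n}
    (hx : x ∈ Submodule.span ℂ (Set.range P)) (h : ∀ j, j ≠ i → P j * x = 0) :
    ∃ c : ℂ, x = c • P i := by
  obtain ⟨c, rfl⟩ := (Submodule.mem_span_range_iff_exists_fun ℂ).1 hx
  refine ⟨c i, Finset.sum_eq_single i (fun j _ hj => ?_) (by simp)⟩
  have h1 := h j hj
  rw [Finset.mul_sum, Finset.sum_eq_single j] at h1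
  · rw [mul_smul_comm] at h1
    rcases smul_eq_zero.1 h1 with h | h
    · rw [h, zero_smul]
    · have : P j = 0 := (CStarRing.star_mul_self_eq_zero_iff _).1 (by rw [hs]; exact h)
      rw [this, smul_zero]
  · intro l _ hl
    rw [mul_smul_comm, ho j l hl.symm, smul_zero]
  · simp

theorem exists_mul_eq_smul {k : ℕ} {P : Fin k → Mat n} (hs : ∀ i, star (P i) = P i)
    (ho : ∀ i j, i ≠ j → P i * P j = 0) {i : Fin k} (hsq : P i * P i ∈ Submodule.span ℂ (Set.range P))
    {x : Mat n} (hx : x ∈ Submodule.span ℂ (Set.range P)) : ∃ c : ℂ, x * P i = c • P i := by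
  obtain ⟨d, hd⟩ := exists_smul_of_mul_eq_zero hs ho (i := i) hsq fun j hj => by
    rw [← mul_assoc, ho j i hj, zero_mul]
  obtain ⟨c, rfl⟩ := (Submodule.mem_span_range_iff_exists_fun ℂ).1 hx
  refine ⟨c i * d, ?_⟩
  rw [Finset.sum_mul, Finset.sum_eq_single i]
  · rw [smul_mul_assoc, hd, smul_smul]
  · intro j _ hj
    rw [smul_mul_assoc, ho j i hj, smul_zero]
  · simp

variable {A : Type u} [NonUnitalCStarAlgebra A]

/-- The image of `B` in `M_n` under a frame. -/
def fibreImage (B : NonUnitalStarSubalgebra ℂ A) (w : FrameSpace n A) : Submodule ℂ (Mat n) where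
  carrier := {x | ∃ b ∈ B, w.coord b = x}
  add_mem' := by
    rintro _ _ ⟨a, ha, rfl⟩ ⟨b, hb, rfl⟩
    exact ⟨a + b, add_mem ha hb, map_add _ _ _⟩
  zero_mem' := ⟨0, zero_mem _, map_zero _⟩
  smul_mem' := by
    rintro c _ ⟨a, ha, rfl⟩
    exact ⟨c • a, SMulMemClass.smul_mem c ha, map_smul _ _ _⟩

theorem finrank_fibreImage_le (B : NonUnitalStarSubalgebra ℂ A) {w w' : FrameSpace n A}
    (h : w.base = w'.base) :
    Module.finrank ℂ (fibreImage B w') ≤ Module.finrank ℂ (fibreImage B w) := by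
  have hle : (fibreImage B w').map
      (FrameSpace.diff w w' h).toStarAlgHom.toAlgHom.toLinearMap ≤ fibreImage B w := by
    rintro _ ⟨_, ⟨b, hb, rfl⟩, rfl⟩
    exact ⟨b, hb, (FrameSpace.diff_coord w w' h b).symm⟩
  rw [(Submodule.equivMapOfInjective
    (FrameSpace.diff w w' h).toStarAlgHom.toAlgHom.toLinearMap (EquivLike.injective (FrameSpace.diff w w' h))
    (fibreImage B w')).finrank_eq]
  exact Submodule.finrank_mono hle

/-! ### Fibres of a Cartan subalgebra: dimension and orthogonal elements -/

namespace IsCartanSubalgebra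

variable {B : NonUnitalStarSubalgebra ℂ A} (hB : IsCartanSubalgebra B)

include hB

theorem isClosed : IsClosed (B : Set A) := hB.maximal_abelian.1.1

theorem mul_comm {x y : A} (hx : x ∈ B) (hy : y ∈ B) : x * y = y * x :=
  hB.maximal_abelian.1.2 x hx y hy

/-- The double commutant of `B ∪ {x}` is a closed commutative *-subalgebra containing `B`, so
maximality of `B` applies to it. -/
theorem mem_of_commute {x : A} (hx : star x = x) (h : ∀ b ∈ B, b * x = x * b) : x ∈ B := by
  let S : Set A := (B : Set A) ∪ {x}
  let C := NonUnitalStarSubalgebra.centralizer ℂ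
    (NonUnitalStarSubalgebra.centralizer ℂ S : Set A)
  have hSS : ∀ a ∈ S, ∀ b ∈ S, a * b = b * a := by
    rintro a (ha | rfl) b (hb | rfl)
    · exact hB.mul_comm ha hb
    · exact h a ha
    · exact (h b hb).symm
    · rfl
  have hSstar : ∀ a ∈ S, star a ∈ S := by
    rintro a (ha | rfl)
    · exact Or.inl (star_mem ha)
    · exact Or.inr hx
  have hS : ∀ {a : A}, a ∈ NonUnitalStarSubalgebra.centralizer ℂ S ↔ ∀ g ∈ S, g * a = a * g := by
    intro a
    rw [NonUnitalStarSubalgebra.mem_centralizer_iff]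
    exact ⟨fun h g hg => (h g hg).1, fun h g hg => ⟨h g hg, h _ (hSstar g hg)⟩⟩
  have hC : ∀ {a : A}, a ∈ C → ∀ g, (∀ s ∈ S, s * g = g * s) → g * a = a * g := by
    intro a ha g hg
    exact ((NonUnitalStarSubalgebra.mem_centralizer_iff ℂ).1 ha g (hS.2 hg)).1
  have hSC : S ⊆ C := by
    intro s hs
    refine (NonUnitalStarSubalgebra.mem_centralizer_iff ℂ).2 fun g hg => ⟨?_, ?_⟩
    · exact (hS.1 hg s hs).symm
    · exact (hS.1 (star_mem hg) s hs).symm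
  have hmax := hB.maximal_abelian.2 (y := C) ⟨?_, ?_⟩ (fun b hb => hSC (Or.inl hb))
  · exact hmax (hSC (Or.inr rfl))
  · rw [NonUnitalStarSubalgebra.coe_centralizer]
    exact Set.isClosed_centralizer _
  · intro a ha b hb
    exact hC hb a fun s hs => hC ha s fun s' hs' => hSS s' hs' s hs

variable (hn : 1 ≤ n) (hA : IsHomogeneous n A)

omit hB in
theorem isSelfAdjoint_half (a : A) : star ((1 / 2 : ℂ) • (a + star a)) = (1 / 2 : ℂ) • (a + star a) := by
  rw [star_smul, star_add, star_star, add_comm (star a)]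
  congr 1
  simp

omit hB in
theorem exists_selfAdjoint_lift {w : FrameSpace n A} {x : Mat n} (hx : x ∈ fibreImage B w)
    (hxs : star x = x) : ∃ h ∈ B, IsSelfAdjoint h ∧ w.coord h = x := by
  obtain ⟨a, ha, rfl⟩ := hx
  refine ⟨(1 / 2 : ℂ) • (a + star a), SMulMemClass.smul_mem _ (add_mem ha (star_mem ha)),
    isSelfAdjoint_half a, ?_⟩
  rw [map_smul, map_add, map_star, hxs, ← two_smul ℂ (w.coord a), smul_smul]
  norm_num

/-- The approximate unit tends to the identity in each frame, and finite-dimensional subspaces are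
closed. -/
theorem one_mem_fibreImage (w : FrameSpace n A) : (1 : Mat n) ∈ fibreImage B w := by
  obtain ⟨l, hl, hlB⟩ := hB.approximate_unit
  have := hl.neBot
  obtain ⟨a, ha⟩ := w.coord_surjective 1
  have h1 : Tendsto (fun e => w.coord e) l (𝓝 1) := by
    have h2 := ((NonUnitalStarAlgHom.continuous_of_cstar w.coord).tendsto a).comp
      (hl.tendsto_mul_right a)
    rw [ha] at h2
    refine h2.congr fun e => ?_
    rw [Function.comp_apply, map_mul, ha, mul_one]
  have hcl : IsClosed (fibreImage B w : Set (Mat n)) := Submodule.closed_of_finiteDimensional _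
  refine hcl.mem_of_tendsto h1 ?_
  filter_upwards [hlB] with e he using ⟨e, he, rfl⟩

/-- The image of `B` in `M_n` as a unital *-subalgebra. -/
def fibreSubalgebra (w : FrameSpace n A) : StarSubalgebra ℂ (Mat n) where
  carrier := fibreImage B w
  add_mem' := add_mem
  mul_mem' := by
    rintro _ _ ⟨a, ha, rfl⟩ ⟨b, hb, rfl⟩
    exact ⟨a * b, mul_mem ha hb, map_mul _ _ _⟩
  one_mem' := one_mem_fibreImage hB w
  zero_mem' := zero_mem _
  algebraMap_mem' := fun c => by
    rw [Algebra.algebraMap_eq_smul_one]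
    exact Submodule.smul_mem _ _ (one_mem_fibreImage hB w)
  star_mem' := by
    rintro _ ⟨a, ha, rfl⟩
    exact ⟨star a, star_mem ha, map_star _ _⟩

include hn hA

theorem isScalar_mem {z : A} {ζ : PrimitiveIdeal A → ℝ} (hz : IsScalar n z ζ) : z ∈ B :=
  hB.mem_of_commute (hz.star_eq hn hA) fun b _ => (hz.mul_comm hn hA b).symm

/-- An element vanishing at a point is nearly `z * a` for a central `z` that vanishes there, and the
expectation is linear over `z`, which lies in `B`. -/
theorem coord_condExp_eq_zero {E : A →ₗ[ℂ] B} (hE : IsFaithfulCondExp B E) {w : FrameSpace n A}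
    {a : A} (ha : w.coord a = 0) : w.coord (E a : A) = 0 := by
  refine norm_le_zero_iff.1 (le_of_forall_pos_le_add fun ε hε => ?_)
  rw [zero_add]
  obtain ⟨z, ζ, hz, hζ, h⟩ := exists_isScalar_mul_approx hn hA a hε
    (isOpen_compl_point hn hA w.base) (by
      rintro t ht rfl
      rw [FrameSpace.norm_value, ha, norm_zero] at ht
      linarith)
  have hzB := isScalar_mem hB hn hA hz
  have hEz : (E (a - z * a) : A) = E a - z * (E a : A) := by
    rw [map_sub, hE.map_mul_left ⟨z, hzB⟩ a]
    rfl
  have h1 : w.coord (E a : A) = w.coord (E (a - z * a) : A) := by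
    rw [hEz, map_sub, hz.coord_mul, hζ _ (fun h => h rfl), Complex.ofReal_zero, zero_smul, sub_zero]
  rw [h1]
  exact (NonUnitalStarAlgHom.norm_apply_le w.coord _).trans ((hE.norm_le _).trans h)

/-- A conditional expectation acts on the fibres. -/
theorem exists_fibreMap {E : A →ₗ[ℂ] B} (hE : IsFaithfulCondExp B E) (w : FrameSpace n A) :
    ∃ F : Mat n →ₗ[ℂ] Mat n, (∀ a, F (w.coord a) = w.coord (E a : A)) ∧ (∀ x, ‖F x‖ ≤ ‖x‖) ∧
      LinearMap.IsProj (fibreImage B w) F := by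
  have hlift : ∀ x : Mat n, ∃ a : A, w.coord a = x ∧ ‖a‖ ≤ ‖x‖ := by
    intro x
    obtain ⟨a, rfl⟩ := w.coord_surjective x
    exact exists_map_eq_norm_le w.coord a
  choose s hs hsn using hlift
  have key : ∀ {a b : A}, w.coord a = w.coord b → w.coord (E a : A) = w.coord (E b : A) := by
    intro a b hab
    have := coord_condExp_eq_zero hB hn hA hE (w := w) (a := a - b) (by rw [map_sub, hab, sub_self])
    rw [map_sub] at this
    rw [← sub_eq_zero, ← map_sub]
    exact this
  let F : Mat n →ₗ[ℂ] Mat n :=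
    { toFun := fun x => w.coord (E (s x) : A)
      map_add' := fun x y => by
        rw [← map_add]
        have : (E (s x) : A) + (E (s y) : A) = (E (s x + s y) : A) := by rw [map_add]; rfl
        rw [this]
        exact key (by rw [map_add, hs, hs, hs])
      map_smul' := fun c x => by
        rw [RingHom.id_apply, ← map_smul]
        have : c • (E (s x) : A) = (E (c • s x) : A) := by rw [map_smul]; rfl
        rw [this]
        exact key (by rw [map_smul, hs, hs]) }
  refine ⟨F, fun a => key (hs _), fun x => ?_, fun x => ⟨_, (E (s x)).2, rfl⟩, ?_⟩
  · exact (NonUnitalStarAlgHom.norm_apply_le w.coord _).trans ((hE.norm_le _).trans (hsn x))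
  · rintro _ ⟨b, hb, rfl⟩
    have := key (hs (w.coord b))
    rw [hE.map_coe ⟨b, hb⟩] at this
    exact this

/-- Otherwise some ultrafilter tends to the point through fibres of the wrong dimension. The frames
converge along it, and with them the fibre projections, hence their traces; these are the integers
in question. -/
theorem eventually_finrank_eq (w₀ : FrameSpace n A) :
    ∀ᶠ t in 𝓝 w₀.base, ∀ w : FrameSpace n A, w.base = t →
      Module.finrank ℂ (fibreImage B w) = Module.finrank ℂ (fibreImage B w₀) := by
  obtain ⟨E, hE⟩ := hB.expectation
  by_contra hcon
  rw [not_eventually] at hcon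
  push Not at hcon
  have hne := frequently_iff_neBot.1 hcon
  let 𝒰 := Ultrafilter.of (𝓝 w₀.base ⊓ 𝓟 {t | ∃ w : FrameSpace n A, w.base = t ∧
    Module.finrank ℂ (fibreImage B w) ≠ Module.finrank ℂ (fibreImage B w₀)})
  have h𝒰 : (𝒰 : Filter (PrimitiveIdeal A)) ≤ 𝓝 w₀.base := (Ultrafilter.of_le _).trans inf_le_left
  have hbad : ∀ᶠ t in (𝒰 : Filter (PrimitiveIdeal A)), ∃ w : FrameSpace n A, w.base = t ∧
      Module.finrank ℂ (fibreImage B w) ≠ Module.finrank ℂ (fibreImage B w₀) :=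
    le_principal_iff.1 ((Ultrafilter.of_le _).trans inf_le_right)
  have hex : ∀ t, ∃ w : FrameSpace n A, w.base = t ∧
      ((∃ w : FrameSpace n A, w.base = t ∧
        Module.finrank ℂ (fibreImage B w) ≠ Module.finrank ℂ (fibreImage B w₀)) →
        Module.finrank ℂ (fibreImage B w) ≠ Module.finrank ℂ (fibreImage B w₀)) := by
    intro t
    by_cases h : ∃ w : FrameSpace n A, w.base = t ∧
        Module.finrank ℂ (fibreImage B w) ≠ Module.finrank ℂ (fibreImage B w₀)
    · obtain ⟨w, hw, hw'⟩ := h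
      exact ⟨w, hw, fun _ => hw'⟩
    · obtain ⟨w, hw⟩ := hA.exists_frame hn t
      exact ⟨w, hw, fun h' => absurd h' h⟩
  choose w hw hwb using hex
  obtain ⟨w₁, hb₁, hlim⟩ := FrameSpace.exists_tendsto hn hA 𝒰 w (t := w₀.base) (by
    simp only [hw]; exact h𝒰)
  choose F hF hFn hFp using fun w => exists_fibreMap hB hn hA hE (n := n) w
  have hFt : ∀ x, Tendsto (fun t => F (w t) x) 𝒰 (𝓝 (F w₁ x)) := by
    intro x
    obtain ⟨a, rfl⟩ := w₁.coord_surjective x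
    have h1 := FrameSpace.tendsto_nhds_iff.1 hlim (E a : A)
    have h2 : Tendsto (fun t => F (w t) (w₁.coord a - (w t).coord a)) 𝒰 (𝓝 0) := by
      refine squeeze_zero_norm (fun t => hFn _ _) ?_
      have := ((tendsto_const_nhds (x := w₁.coord a)).sub
        (FrameSpace.tendsto_nhds_iff.1 hlim a)).norm
      rwa [sub_self, norm_zero] at this
    have h3 := h2.add h1
    rw [zero_add, ← hF] at h3
    refine h3.congr fun t => ?_
    rw [map_sub, hF (w t), sub_add_cancel]
  have htr : Tendsto (fun t => LinearMap.trace ℂ (Mat n) (F (w t))) 𝒰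
      (𝓝 (LinearMap.trace ℂ (Mat n) (F w₁))) := by
    let b := Module.finBasis ℂ (Mat n)
    have e : ∀ G : Mat n →ₗ[ℂ] Mat n, LinearMap.trace ℂ (Mat n) G = ∑ i, b.coord i (G (b i)) := by
      intro G
      rw [LinearMap.trace_eq_matrix_trace ℂ b, Matrix.trace]
      exact Finset.sum_congr rfl fun i _ => LinearMap.toMatrix_apply b b G i i
    simp only [e]
    refine tendsto_finsetSum _ fun i _ => ?_
    exact ((LinearMap.continuous_of_finiteDimensional (b.coord i)).tendsto _).comp (hFt _)
  simp only [(hFp _).trace] at htr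
  have h1 : ∀ᶠ t in (𝒰 : Filter (PrimitiveIdeal A)),
      Module.finrank ℂ (fibreImage B (w t)) = Module.finrank ℂ (fibreImage B w₁) := by
    filter_upwards [htr.eventually (Metric.ball_mem_nhds _ one_pos)] with t ht
    rw [dist_eq_norm] at ht
    have h2 : ‖(((Module.finrank ℂ (fibreImage B (w t)) : ℤ) -
        (Module.finrank ℂ (fibreImage B w₁) : ℤ) : ℤ) : ℂ)‖ < 1 := by
      push_cast
      exact ht
    rw [Complex.norm_intCast] at h2
    have h3 : |(Module.finrank ℂ (fibreImage B (w t)) : ℤ) -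
        (Module.finrank ℂ (fibreImage B w₁) : ℤ)| < 1 := by exact_mod_cast h2
    have h4 := Int.abs_lt_one_iff.1 h3
    omega
  obtain ⟨t, ht, hbt⟩ := (h1.and hbad).exists
  refine hwb t hbt (ht.trans ?_)
  exact le_antisymm (finrank_fibreImage_le B hb₁.symm) (finrank_fibreImage_le B hb₁)

/-- Near a point, the fibres of a Cartan subalgebra are spanned by orthogonal elements. -/
theorem exists_orthogonal_span (t₀ : PrimitiveIdeal A) :
    ∃ (k : ℕ) (p : Fin k → A) (V : Set (PrimitiveIdeal A)), IsOpen V ∧ t₀ ∈ V ∧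
      (∀ i, p i ∈ B) ∧ (∀ i, star (p i) = p i) ∧ (∀ i j, i ≠ j → p i * p j = 0) ∧
      ∀ w : FrameSpace n A, w.base ∈ V → (∀ i, w.coord (p i) ≠ 0) ∧
        fibreImage B w = Submodule.span ℂ (Set.range fun i => w.coord (p i)) := by
  obtain ⟨w₀, rfl⟩ := hA.exists_frame hn t₀
  obtain ⟨x, hx, hxs, hxspec⟩ := exists_isSelfAdjoint_mem_spectrum (fibreSubalgebra hB w₀) (by
    rintro _ ⟨a, ha, rfl⟩ _ ⟨b, hb, rfl⟩
    rw [← map_mul, hB.mul_comm ha hb, map_mul])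
  obtain ⟨h, hhB, hh, rfl⟩ := exists_selfAdjoint_lift hx hxs
  let k := Module.finrank ℂ (fibreImage B w₀)
  have hk : Module.finrank ℂ (fibreSubalgebra hB w₀) = k := rfl
  let p : Fin k → A := fun i => bump i h
  have hcl : IsClosed (B : Set A) := hB.isClosed
  have hpB : ∀ i, p i ∈ B := fun i => cfcₙ_mem (𝕜' := ℂ) _ hhB
  have hps : ∀ i, star (p i) = p i := fun i => star_bump _ _
  have hpo : ∀ i j, i ≠ j → p i * p j = 0 := fun i j hij =>
    bump_mul_bump h fun hc => hij (Fin.ext hc)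
  have hp0 : ∀ i, p i ∉ w₀.base.toSubmodule := by
    intro i hi
    rw [← FrameSpace.coord_eq_zero_iff, map_bump w₀.coord i hh] at hi
    exact bump_ne_zero (hh.map w₀.coord) (hxspec i (by rw [hk]; exact i.2)) hi
  have hev : ∀ᶠ t in 𝓝 w₀.base, ∀ i, p i ∉ t.toSubmodule :=
    eventually_all.2 fun i =>
      (show IsOpen {t : PrimitiveIdeal A | p i ∉ t.toSubmodule} from
        TopologicalSpace.isOpen_generateFrom_of_mem ⟨p i, rfl⟩).mem_nhds (hp0 i)
  obtain ⟨V, hV, hVo, htV⟩ := eventually_nhds_iff.1 (hev.and (eventually_finrank_eq hB hn hA w₀))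
  refine ⟨k, p, V, hVo, htV, hpB, hps, hpo, fun w hw => ?_⟩
  have hw0 : ∀ i, w.coord (p i) ≠ 0 := fun i hi =>
    (hV _ hw).1 i ((FrameSpace.coord_eq_zero_iff w _).1 hi)
  have hli : LinearIndependent ℂ fun i => w.coord (p i) :=
    linearIndependent_of_orthogonal (fun i => by rw [← map_star, hps])
      (fun i j hij => by rw [← map_mul, hpo i j hij, map_zero]) hw0
  -- The `k` nonzero orthogonal values are independent, and `V` was chosen so that the fibres still
  -- have dimension `k`.
  refine ⟨hw0, (Submodule.eq_of_le_of_finrank_eq ?_ ?_).symm⟩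
  · rw [Submodule.span_le]
    rintro _ ⟨i, rfl⟩
    exact ⟨p i, hpB i, rfl⟩
  · rw [finrank_span_eq_card hli, Fintype.card_fin]
    exact ((hV _ hw).2 w rfl).symm

/-- Near a point, a Cartan subalgebra contains `n` orthogonal elements with nonzero values. -/
theorem exists_orthogonal (t₀ : PrimitiveIdeal A) :
    ∃ (p : Fin n → A), (∀ i, p i ∈ B) ∧ (∀ i, star (p i) = p i) ∧
      (∀ i j, i ≠ j → p i * p j = 0) ∧ ∀ i, p i ∉ t₀.toSubmodule := by
  obtain ⟨k, p, V, hV, htV, hpB, hps, hpo, hpV⟩ := exists_orthogonal_span hB hn hA t₀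
  obtain ⟨w₀, rfl⟩ := hA.exists_frame hn t₀
  suffices hnk : n ≤ k by
    refine ⟨fun i => p (Fin.castLE hnk i), fun i => hpB _, fun i => hps _, fun i j hij => hpo _ _ ?_,
      fun i hi => (hpV w₀ htV).1 _ ((FrameSpace.coord_eq_zero_iff w₀ _).2 hi)⟩
    exact fun h => hij (Fin.castLE_injective hnk h)
  have hcorner : ∀ (w : FrameSpace n A), w.base ∈ V → ∀ i, ∀ x ∈ fibreImage B w,
      ∃ c : ℂ, x * w.coord (p i) = c • w.coord (p i) := by
    intro w hw i x hx
    have hspan := (hpV w hw).2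
    refine exists_mul_eq_smul (P := fun i => w.coord (p i)) (fun i => by rw [← map_star, hps])
      (fun i j hij => by rw [← map_mul, hpo i j hij, map_zero]) ?_ (hspan ▸ hx)
    rw [← hspan, ← map_mul]
    exact ⟨_, mul_mem (hpB i) (hpB i), rfl⟩
  obtain ⟨z, ζ, hz, -, hζ0, hζV⟩ := exists_isScalar hn hA hV htV
  -- Over `V` the fibre of `B` acts on `p i` by scalars, so `p i * y * p i` commutes with it there;
  -- elsewhere `z` vanishes. Maximality then puts the product into `B`.
  have hmem : ∀ i y, star y = y → z * (p i * y * p i) ∈ B := by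
    intro i y hy
    refine hB.mem_of_commute ?_ fun b hb => eq_of_forall_coord hn hA fun w => ?_
    · rw [star_mul, hz.star_eq hn hA, star_mul, star_mul, hps, hy, ← mul_assoc,
        ← hz.mul_comm hn hA]
    · by_cases hw : w.base ∈ V
      · obtain ⟨c, hc⟩ := hcorner w hw i (w.coord b) ⟨b, hb, rfl⟩
        have hc' : w.coord (p i) * w.coord b = c • w.coord (p i) := by
          rw [← map_mul, hB.mul_comm (hpB i) hb, map_mul, hc]
        rw [map_mul, map_mul _ _ b, hz.coord_mul, map_mul, map_mul, mul_smul_comm, smul_mul_assoc]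
        congr 1
        rw [← mul_assoc, ← mul_assoc, hc, smul_mul_assoc, smul_mul_assoc, mul_assoc _ _ (w.coord b),
          hc', mul_smul_comm]
      · rw [map_mul, map_mul _ _ b, hz.coord_mul, hζV _ hw, Complex.ofReal_zero, zero_smul, mul_zero,
          zero_mul]
  have hz0 : ((ζ w₀.base : ℝ) : ℂ) ≠ 0 := Complex.ofReal_ne_zero.2 hζ0.ne'
  have hsaY : ∀ i (Y : Mat n), star Y = Y → w₀.coord (p i) * Y * w₀.coord (p i) ∈ fibreImage B w₀ := by
    intro i Y hY
    obtain ⟨y, hy, rfl⟩ := w₀.exists_selfAdjoint_lift hY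
    have h1 : w₀.coord (z * (p i * y * p i)) ∈ fibreImage B w₀ := ⟨_, hmem i y hy, rfl⟩
    rw [hz.coord_mul, map_mul, map_mul] at h1
    exact (Submodule.smul_mem_iff _ hz0).1 h1
  have hallY : ∀ i (Y : Mat n), w₀.coord (p i) * Y * w₀.coord (p i) ∈ fibreImage B w₀ := by
    intro i Y
    have e : Y = (realPart Y : Mat n) + Complex.I • (imaginaryPart Y : Mat n) :=
      (realPart_add_I_smul_imaginaryPart Y).symm
    rw [e, mul_add, add_mul, mul_smul_comm, smul_mul_assoc]
    exact add_mem (hsaY i _ (realPart Y).2) (Submodule.smul_mem _ _ (hsaY i _ (imaginaryPart Y).2))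
  -- The matrix `p i Y p i` lies in the span of the `p j` and is annihilated by the others, hence is
  -- a multiple of `p i`: the corner is one-dimensional and `p i` has rank one.
  refine le_of_one_mem_span (P := fun i => w₀.coord (p i)) (hpV w₀ htV).1 (fun i Y => ?_)
    ((hpV w₀ htV).2 ▸ one_mem_fibreImage hB w₀)
  refine exists_smul_of_mul_eq_zero (P := fun i => w₀.coord (p i)) (fun i => by rw [← map_star, hps])
    (fun i j hij => by rw [← map_mul, hpo i j hij, map_zero]) ((hpV w₀ htV).2 ▸ hallY i Y)
    fun j hj => ?_
  rw [← mul_assoc, ← mul_assoc, ← map_mul, hpo j i hj, map_zero, zero_mul, zero_mul]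

end IsCartanSubalgebra

end Fibres

/-! ### The reduction given by a Cartan subalgebra -/

section OfCartan

open scoped Matrix.Norms.L2Operator

open PrimitiveIdeal Filter

variable {n : ℕ} {A : Type u} [NonUnitalCStarAlgebra A]

/-- The frames which carry the diagonal matrices onto the fibre of `B`. -/
def adaptedFrames (n : ℕ) (B : NonUnitalStarSubalgebra ℂ A) : Set (FrameSpace n A) :=
  {w | ∀ x : Mat n, x.IsDiag ↔ x ∈ fibreImage B w}

theorem smul_mem_adaptedFrames {B : NonUnitalStarSubalgebra ℂ A} {w : FrameSpace n A}
    (hw : w ∈ adaptedFrames n B) {g : AutMat n} (hg : g ∈ autDiag n) :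
    MulOpposite.op g • w ∈ adaptedFrames n B := by
  intro x
  have h1 : x.IsDiag ↔ (g x).IsDiag := by
    refine ⟨isDiag_map hg, fun h => ?_⟩
    have := isDiag_map (inv_mem hg) h
    rwa [show g⁻¹ (g x) = x from g.symm_apply_apply x] at this
  rw [h1, hw]
  refine exists_congr fun b => and_congr_right fun _ => ?_
  rw [FrameSpace.coord_smul]
  exact ⟨fun h => by rw [h, StarAlgEquiv.symm_apply_apply],
    fun h => by rw [← h, StarAlgEquiv.apply_symm_apply]⟩

theorem diff_mem_autDiag {B : NonUnitalStarSubalgebra ℂ A} {w w' : FrameSpace n A}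
    (hw : w ∈ adaptedFrames n B) (hw' : w' ∈ adaptedFrames n B) (h : w.base = w'.base) :
    FrameSpace.diff w w' h ∈ autDiag n := by
  change (fun x => FrameSpace.diff w w' h x) '' diagMat n = diagMat n
  ext y
  constructor
  · rintro ⟨x, hx, rfl⟩
    obtain ⟨b, hb, rfl⟩ := (hw' x).1 hx
    simp only [FrameSpace.diff_coord]
    exact (hw _).2 ⟨b, hb, rfl⟩
  · intro hy
    obtain ⟨b, hb, rfl⟩ := (hw y).1 hy
    exact ⟨w'.coord b, (hw' _).2 ⟨b, hb, rfl⟩, FrameSpace.diff_coord w w' h b⟩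

/-- The diagonal units are multiples of values of `B`, so the fibre contains `D_n`; being
commutative, it contains nothing else. -/
theorem mem_adaptedFrames_of_coord {B : NonUnitalStarSubalgebra ℂ A}
    (hB : ∀ x ∈ B, ∀ y ∈ B, x * y = y * x) {w : FrameSpace n A} {p : Fin n → A}
    (hp : ∀ i, p i ∈ B) {c : Fin n → ℂ} (hc : ∀ i, c i ≠ 0)
    (h : ∀ i, w.coord (p i) = Matrix.single i i (c i)) : w ∈ adaptedFrames n B := by
  have hsingle : ∀ i, Matrix.single i i (1 : ℂ) = (c i)⁻¹ • w.coord (p i) := by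
    intro i
    rw [h, Matrix.smul_single, smul_eq_mul, inv_mul_cancel₀ (hc i)]
  intro x
  constructor
  · intro hx
    have e : x = ∑ i, x i i • Matrix.single i i (1 : ℂ) := by
      conv_lhs => rw [← hx.diagonal_diag]
      ext k l
      rw [Matrix.sum_apply, Finset.sum_eq_single k]
      · rcases eq_or_ne k l with rfl | hkl
        · simp
        · simp [hkl]
      · intro i _ hi
        simp [hi]
      · simp
    rw [e]
    refine sum_mem fun i _ => Submodule.smul_mem _ _ ?_
    rw [hsingle]
    exact Submodule.smul_mem _ _ ⟨p i, hp i, rfl⟩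
  · rintro ⟨b, hb, rfl⟩
    refine isDiag_of_commute_single fun i => ?_
    rw [hsingle, mul_smul_comm, smul_mul_assoc, ← map_mul, ← map_mul, hB b hb (p i) (hp i)]

/-- The frames in which the elements `v i` are nonnegative multiples of the matrix units `e_{i i₀}`. -/
def IsNormalizedFrame (v : Fin n → A) (i₀ : Fin n) (w : FrameSpace n A) : Prop :=
  ∀ i, w.coord (v i) = Matrix.single i i₀ ((‖w.coord (v i) i i₀‖ : ℝ) : ℂ)

/-- The automorphism relating the frames sends each unit of column `i₀` to a positive multiple of
itself. It is isometric, so the multiple is one, and these units generate `M_n`. -/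
theorem IsNormalizedFrame.eq {v : Fin n → A} {i₀ : Fin n} {w w' : FrameSpace n A}
    (hw : IsNormalizedFrame v i₀ w) (hw' : IsNormalizedFrame v i₀ w') (h : w.base = w'.base)
    (hv : ∀ i, v i ∉ w.base.toSubmodule) : w = w' := by
  set g := FrameSpace.diff w w' h with hg
  have hcol : ∀ i, g (Matrix.single i i₀ 1) = Matrix.single i i₀ 1 := by
    intro i
    have h1 := FrameSpace.diff_coord w w' h (v i)
    have h0 : w.coord (v i) ≠ 0 := fun h0 => hv i ((FrameSpace.coord_eq_zero_iff w _).1 h0)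
    have h0' : w'.coord (v i) ≠ 0 := fun h0 => hv i (by
      rw [h]; exact (FrameSpace.coord_eq_zero_iff w' _).1 h0)
    rw [← hg] at h1
    have hn := AutMat.norm_map g (w'.coord (v i))
    rw [h1] at hn
    rw [hw i, hw' i] at h1 hn
    rw [hw i] at h0
    rw [hw' i] at h0'
    set r := ‖w.coord (v i) i i₀‖
    set r' := ‖w'.coord (v i) i i₀‖
    have e : ∀ s : ℝ, Matrix.single i i₀ (s : ℂ) = (s : ℂ) • (Matrix.single i i₀ 1 : Mat n) := by
      intro s
      rw [Matrix.smul_single, smul_eq_mul, mul_one]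
    rw [e] at h0 h0'
    rw [e, e] at h1 hn
    have hr' : (r' : ℂ) ≠ 0 := fun hc => h0' (by rw [hc, zero_smul])
    have he : (Matrix.single i i₀ 1 : Mat n) ≠ 0 := fun hc => h0' (by rw [hc, smul_zero])
    rw [norm_smul, norm_smul, Complex.norm_real, Complex.norm_real,
      Real.norm_of_nonneg (norm_nonneg _), Real.norm_of_nonneg (norm_nonneg _)] at hn
    have hrr : r = r' := mul_right_cancel₀ (norm_ne_zero_iff.2 he) hn
    rw [hrr, map_smul] at h1
    exact smul_right_injective _ hr' h1
  have hall : ∀ i j, g (Matrix.single i j 1) = Matrix.single i j 1 := by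
    intro i j
    have e : (Matrix.single i j 1 : Mat n) = Matrix.single i i₀ 1 * star (Matrix.single j i₀ 1) := by
      rw [Matrix.star_eq_conjTranspose, Matrix.conjTranspose_single, star_one,
        Matrix.single_mul_single_same, mul_one]
    rw [e, map_mul, map_star, hcol, hcol]
  have hone : g = 1 := by
    refine StarAlgEquiv.ext fun x => ?_
    change g x = x
    have e : x = ∑ i, ∑ j, x i j • (Matrix.single i j 1 : Mat n) := by
      conv_lhs => rw [Matrix.matrix_eq_sum_single x]
      simp only [Matrix.smul_single, smul_eq_mul, mul_one]
    conv_lhs => rw [e]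
    conv_rhs => rw [e]
    simp only [map_sum, map_smul, hall]
  have := FrameSpace.smul_diff w w' h
  rw [← hg, hone] at this
  rw [← this]
  exact (one_smul _ w).symm

/-- Adapted frames can be normalized by a diagonal unitary. -/
theorem FrameSpace.exists_normalized (w : FrameSpace n A) {p a : Fin n → A} {i₀ : Fin n}
    (hs : ∀ i, star (p i) = p i) (ho : ∀ i j, i ≠ j → p i * p j = 0) (ha : a i₀ = p i₀ * p i₀)
    (h0 : ∀ i, w.coord (p i * a i * p i₀) ≠ 0) :
    ∃ w' : FrameSpace n A, w'.base = w.base ∧ IsNormalizedFrame (fun i => p i * a i * p i₀) i₀ w' ∧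
      ∃ c : Fin n → ℂ, (∀ i, c i ≠ 0) ∧ ∀ i, w'.coord (p i) = Matrix.single i i (c i) := by
  obtain ⟨w₁, hb, c, hc, hw₁⟩ := w.exists_adapted p hs ho fun i hi => h0 i (by
    rw [map_mul, map_mul, hi, zero_mul, zero_mul])
  let γ : Fin n → ℂ := fun i => c i * w₁.coord (a i) i i₀ * c i₀
  have hγ : ∀ i, w₁.coord (p i * a i * p i₀) = Matrix.single i i₀ (γ i) := by
    intro i
    rw [map_mul, map_mul, hw₁, hw₁, Matrix.single_mul_mul_single]
  have hγ0 : ∀ i, γ i ≠ 0 := by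
    intro i hi
    refine h0 i ((FrameSpace.coord_eq_zero_iff w _).2 ?_)
    rw [← hb, ← FrameSpace.coord_eq_zero_iff, hγ, hi, Matrix.single_zero]
  have hcreal : star (c i₀) = c i₀ := by
    have h1 := congrArg w₁.coord (hs i₀)
    rw [map_star, hw₁, Matrix.star_eq_conjTranspose, Matrix.conjTranspose_single] at h1
    simpa using congrFun (congrFun h1 i₀) i₀
  -- As `a i₀ = p i₀ * p i₀`, the number `γ i₀` is the fourth power of the real number `c i₀`, hence
  -- positive. Its phase is one, so conjugation by the phases `u` corrects each `γ i` independently.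
  have hγi₀ : γ i₀ = ((‖γ i₀‖ : ℝ) : ℂ) := by
    have e : γ i₀ = ((Complex.normSq (c i₀) ^ 2 : ℝ) : ℂ) := by
      have h2 : c i₀ * c i₀ = (Complex.normSq (c i₀) : ℂ) := by
        rw [Complex.normSq_eq_conj_mul_self]
        congr 1
        exact hcreal.symm
      simp only [γ, ha, map_mul, hw₁, Matrix.single_mul_single_same, Matrix.single_apply_same]
      push_cast
      rw [← h2]
      ring
    rw [e, Complex.norm_real, Real.norm_of_nonneg (by positivity)]
  let u : Fin n → ℂ := fun i => γ i / (‖γ i‖ : ℝ)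
  have hnorm : ∀ i, ((‖γ i‖ : ℝ) : ℂ) ≠ 0 := fun i =>
    Complex.ofReal_ne_zero.2 (norm_ne_zero_iff.2 (hγ0 i))
  have hu : ∀ i, star (u i) * u i = 1 := by
    intro i
    have h1 : ‖u i‖ = 1 := by
      rw [norm_div, Complex.norm_real, norm_norm, div_self (norm_ne_zero_iff.2 (hγ0 i))]
    rw [RCLike.star_def, ← Complex.normSq_eq_conj_mul_self, Complex.normSq_eq_norm_sq, h1]
    simp
  have hui₀ : u i₀ = 1 := by
    change γ i₀ / (‖γ i₀‖ : ℝ) = 1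
    conv_lhs => rw [← hγi₀]
    exact div_self (hγ0 i₀)
  have huγ : ∀ i, star (u i) * γ i = (‖γ i‖ : ℝ) := by
    intro i
    have : γ i = u i * (‖γ i‖ : ℝ) := (div_mul_cancel₀ _ (hnorm i)).symm
    conv_lhs => rw [this, ← mul_assoc, hu, one_mul]
  have hU : Matrix.diagonal u ∈ unitary (Mat n) := by
    rw [Unitary.mem_iff, Matrix.star_eq_conjTranspose, Matrix.diagonal_conjTranspose,
      Matrix.diagonal_mul_diagonal, Matrix.diagonal_mul_diagonal, ← Matrix.diagonal_one]
    constructor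
    · congr 1
      funext i
      exact hu i
    · congr 1
      funext i
      rw [mul_comm]
      exact hu i
  let g : AutMat n := Unitary.conjStarAlgAut ℂ (Mat n) ⟨Matrix.diagonal u, hU⟩
  have hg : ∀ i j (x : ℂ), g.symm (Matrix.single i j x) = Matrix.single i j (star (u i) * x * u j) := by
    intro i j x
    change star (Matrix.diagonal u) * Matrix.single i j x * Matrix.diagonal u = _
    rw [Matrix.star_eq_conjTranspose, Matrix.diagonal_conjTranspose]
    ext k l
    rw [Matrix.mul_diagonal, Matrix.diagonal_mul]
    by_cases hk : i = k ∧ j = l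
    · obtain ⟨rfl, rfl⟩ := hk
      simp
    · simp [hk]
  refine ⟨MulOpposite.op g • w₁, hb, fun i => ?_, c, hc, fun i => ?_⟩
  · rw [FrameSpace.coord_smul, hγ, hg, huγ, hui₀, mul_one, Matrix.single_apply_same,
      Complex.norm_real, norm_norm]
  · rw [FrameSpace.coord_smul, hw₁, hg, mul_right_comm, hu, one_mul]

variable (hn : 1 ≤ n) (hA : IsHomogeneous n A)

include hn hA

/-- Any ultralimit of the frames is again normalized over the limit point, and normalized frames are
unique. -/
theorem continuousOn_of_isNormalizedFrame {v : Fin n → A} {i₀ : Fin n}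
    {V : Set (PrimitiveIdeal A)} (hV : IsOpen V) (hvV : ∀ t ∈ V, ∀ i, v i ∉ t.toSubmodule)
    {σ : PrimitiveIdeal A → FrameSpace n A} (hσ : ∀ t, (σ t).base = t)
    (hσv : ∀ t ∈ V, IsNormalizedFrame v i₀ (σ t)) : ContinuousOn σ V := by
  refine fun t ht => ContinuousAt.continuousWithinAt ?_
  refine (tendsto_iff_ultrafilter _ _ _).2 fun 𝒰 h𝒰 => ?_
  obtain ⟨w, hwb, hw⟩ := FrameSpace.exists_tendsto hn hA 𝒰 σ (t := t) (by
    simp only [hσ]; exact h𝒰)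
  suffices hwσ : w = σ t by rwa [← hwσ]
  refine IsNormalizedFrame.eq (v := v) (i₀ := i₀) (fun i => ?_) (hσv t ht) (hwb.trans (hσ t).symm)
    (hwb ▸ hvV t ht)
  have h1 := FrameSpace.tendsto_nhds_iff.1 hw (v i)
  have hc : Continuous fun x : Mat n => Matrix.single i i₀ ((‖x i i₀‖ : ℝ) : ℂ) := by
    have : Continuous fun x : Mat n => x i i₀ := continuous_id.matrix_elem i i₀
    have e : (fun x : Mat n => Matrix.single i i₀ ((‖x i i₀‖ : ℝ) : ℂ)) =
        fun x => ((‖x i i₀‖ : ℝ) : ℂ) • (Matrix.single i i₀ 1 : Mat n) := by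
      funext x
      rw [Matrix.smul_single, smul_eq_mul, mul_one]
    rw [e]
    fun_prop
  refine tendsto_nhds_unique h1 (((hc.tendsto _).comp h1).congr' ?_)
  filter_upwards [h𝒰 (hV.mem_nhds ht)] with s hs
  exact (hσv s hs i).symm

/-- Near a point, `n` orthogonal elements of `B` diagonalize its fibres, and normalizing connecting
elements `v i` singles out one adapted frame over each nearby point. -/
theorem IsCartanSubalgebra.isReduction {B : NonUnitalStarSubalgebra ℂ A}
    (hB : IsCartanSubalgebra B) : IsReduction (adaptedFrames n B) where
  smul_mem _ hw _ hg := smul_mem_adaptedFrames hw hg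
  exists_smul w hw w' hw' h := ⟨_, diff_mem_autDiag hw hw' h, FrameSpace.smul_diff w w' h⟩
  exists_section t₀ := by
    obtain ⟨p, hpB, hps, hpo, hp0⟩ := exists_orthogonal hB hn hA t₀
    obtain ⟨w, rfl⟩ := hA.exists_frame hn t₀
    obtain ⟨w₀, hb, c, hc, hw₀⟩ := w.exists_adapted p hps hpo fun i hi =>
      hp0 i ((FrameSpace.coord_eq_zero_iff w _).1 hi)
    let i₀ : Fin n := ⟨0, hn⟩
    choose a' ha' using fun i => w₀.coord_surjective (Matrix.single i i₀ 1)
    -- The lifts of the units `(i, i₀)` make the `v i` nonzero at the point; slot `i₀` is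
    -- overwritten so that its phase is trivial in every frame.
    let a : Fin n → A := Function.update a' i₀ (p i₀ * p i₀)
    have hai₀ : a i₀ = p i₀ * p i₀ := Function.update_self _ _ _
    let v : Fin n → A := fun i => p i * a i * p i₀
    have hv : ∀ i, v i ∉ w.base.toSubmodule := by
      intro i hi
      rw [← hb, ← FrameSpace.coord_eq_zero_iff, map_mul, map_mul, hw₀, hw₀] at hi
      rcases eq_or_ne i i₀ with rfl | hne
      · rw [hai₀, map_mul, hw₀, Matrix.single_mul_single_same, Matrix.single_mul_single_same,
          Matrix.single_mul_single_same] at hi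
        have := congrFun (congrFun hi i₀) i₀
        rw [Matrix.single_apply_same] at this
        exact mul_ne_zero (mul_ne_zero (hc _) (mul_ne_zero (hc _) (hc _))) (hc _) this
      · rw [show a i = a' i from Function.update_of_ne hne _ _, ha',
          Matrix.single_mul_single_same, Matrix.single_mul_single_same] at hi
        have := congrFun (congrFun hi i) i₀
        rw [Matrix.single_apply_same] at this
        exact mul_ne_zero (mul_ne_zero (hc _) one_ne_zero) (hc _) this
    let V : Set (PrimitiveIdeal A) := ⋂ i, {t | v i ∉ t.toSubmodule}
    have hV : IsOpen V := isOpen_iInter_of_finite fun i =>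
      TopologicalSpace.isOpen_generateFrom_of_mem ⟨v i, rfl⟩
    have hex : ∀ t : PrimitiveIdeal A, ∃ w : FrameSpace n A, w.base = t ∧
        (t ∈ V → IsNormalizedFrame v i₀ w ∧ w ∈ adaptedFrames n B) := by
      intro t
      obtain ⟨w, rfl⟩ := hA.exists_frame hn t
      by_cases ht : w.base ∈ V
      · obtain ⟨w', hb', hw', c, hc, hwc⟩ := w.exists_normalized (a := a) (i₀ := i₀) hps hpo hai₀
          fun i hi => Set.mem_iInter.1 ht i ((FrameSpace.coord_eq_zero_iff w _).1 hi)
        exact ⟨w', hb', fun _ => ⟨hw', mem_adaptedFrames_of_coord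
          (fun x hx y hy => hB.mul_comm hx hy) hpB hc hwc⟩⟩
      · exact ⟨w, rfl, fun h => absurd h ht⟩
    choose σ hσb hσV using hex
    exact ⟨V, σ, hV, Set.mem_iInter.2 hv, continuousOn_of_isNormalizedFrame hn hA hV
      (fun t ht i => Set.mem_iInter.1 ht i) hσb (fun t ht => (hσV t ht).1),
      fun t ht => ⟨(hσV t ht).2, hσb t⟩⟩

end OfCartan
theorem proposition2p2 {A : Type u} [NonUnitalCStarAlgebra A] (n : ℕ) (hn : 1 ≤ n)
    (hA : IsHomogeneous n A) :
    (∃ B : NonUnitalStarSubalgebra ℂ A, IsCartanSubalgebra B) ↔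
      ReducesTo (autDiag n) (FrameSpace.base : FrameSpace n A → PrimitiveIdeal A) := by
  constructor
  · rintro ⟨B, hB⟩
    exact (hB.isReduction hn hA).reducesTo
  · intro h
    obtain ⟨R, hR⟩ := exists_isReduction_of_reducesTo h
    exact ⟨_, hR.isCartanSubalgebra hn hA⟩
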